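/- Let $N\ge 1$ and let $\mathcal D$ be a distribution of tangent subspaces of codimension $1$ on $\mathbb R^N$ with a global frame $X_i=\sum_{j=1}^N A_i^j(x)\,\partial/\partial x^j$ ($i=1,\dots,N$) of vector fields such that $X_1,\dots,X_{N-1}$ span $\mathcal D_x$ at every point $x$, the $A_i^j$ are real-valued $C^\infty$ functions all of whose derivatives (including those of order $0$) are bounded on $\mathbb R^N$, and $|\det(A_i^j(x))|\ge c>0$ for all $x$. Let $(B_j^k)$ be the inverse matrix, $\sum_j A_i^jB_j^k=\delta_i^k$. Put $$\rho_x(\xi)=\Big(\sum_{i=1}^{N-1}\Big|\sum_{j=1}^N A_i^j(x)\xi_j\Big|^2\Big)^{1/2},\qquad D_\xi=\sum_{j=1}^N B_j^N(x)\frac{\partial}{\partial \xi_j},$$ $$D_i=\frac{\partial}{\partial x^i}+\sum_{k,p,l=1}^N \frac{\partial B_k^p}{\partial x^i}(x)\,A_p^l(x)\,\xi_l\,\frac{\partial}{\partial\xi_k}\quad(1\le i\le N),$$ and $D^I=D_{i_1}\cdots D_{i_k}$ for $I=(i_1,\dots,i_k)$. For $m,n\in\mathbb R$ let $S^{m,n}$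 be the set of all $a\in C^\infty(\mathbb R^N\times\mathbb R^N;\mathbb C)$ such that for every multiindex $\alpha$, every integer $\beta\ge 0$ and every tuple $I$ there is a constant $C_{\alpha,\beta,I}$ with $$|\partial_\xi^\alpha D_\xi^\beta D^I a(x,\xi)|\le C_{\alpha,\beta,I}\,(1+|\xi|)^{m-\beta}\,\big(1+\rho_x(\xi)+|\xi|^{1/2}\big)^{n-|\alpha|}\quad\text{for all }x,\xi\in\mathbb R^N.$$ For $a\in S^{m,n}$ and $f$ in the Schwartz space $\mathcal S(\mathbb R^N)$ let $$T_af(x)=\int_{\mathbb R^N}a(x,\xi)\,\widehat f(\xi)\,e^{2\pi i x\cdot\xi}\,d\xi,\qquad \widehat f(\xi)=\int_{\mathbb R^N} f(y)\,e^{-2\pi i y\cdot\xi}\,dy .$$ **Theorem.** Let $m,n\in\mathbb R$ and $a\in S^{m,n}$. Then there is a symbol $a^*\in S^{m,n}$ such that $T_{a^*}$ is the adjoint $T_a^*$ of $T_a$ with respect to the standard $L^2$ inner product on $\mathbb R^N$; that is, $T_af$ and $T_{a^*}g$ belong to $L^2(\mathbb R^N)$ for all $f,g\in\mathcal S(\mathbb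 R^N)$, and $$\int_{\mathbb R^N} T_af(x)\,\overline{g(x)}\,dx=\int_{\mathbb R^N} f(x)\,\overline{T_{a^*}g(x)}\,dx\qquad\text{for all } f,g\in\mathcal S(\mathbb R^N).$$ -/

import Mathlib

open MeasureTheory FourierTransform SchwartzMap
open scoped ContDiff ComplexConjugate

noncomputable section

namespace MixedSymbol

/-- `ℝ^N` with `N = d + 1 ≥ 1`. The last coordinate (index `N` in the usual numbering) is
`Fin.last d`; the first `N - 1` coordinates are the `Fin.castSucc i` with `i : Fin d`. -/
abbrev E (d : ℕ) : Type := EuclideanSpace ℝ (Fin (d + 1))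

/-- The `j`-th coordinate vector of `ℝ^N`. -/
def coordVec {d : ℕ} (j : Fin (d + 1)) : E d := EuclideanSpace.single j 1

/-- A global frame `X_1, …, X_N` of vector fields on `ℝ^N`, the first `N - 1` of which span the
codimension one distribution `D` at every point. The coefficients of the frame are smooth, each of
their derivatives (of every order, including order zero) is bounded on `ℝ^N`, and the determinant
of the coefficient matrix is bounded away from zero. -/
structure AdaptedFrame {d : ℕ} (D : E d → Submodule ℝ (E d)) where
  X : Fin (d + 1) → E d → E d
  smooth : ∀ i j, ContDiff ℝ ∞ (fun x => X i x j)
  bounded : ∀ i j (k : ℕ), ∃ C : ℝ, ∀ x, ‖iteratedFDeriv ℝ k (fun y => X i y j) x‖ ≤ C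
  det_bound : ∃ c : ℝ, 0 < c ∧ ∀ x, c ≤ |(Matrix.of fun i j => X i x j).det|
  span_eq : ∀ x, Submodule.span ℝ (Set.range fun i : Fin d => X i.castSucc x) = D x

namespace AdaptedFrame

variable {d : ℕ} {D : E d → Submodule ℝ (E d)} (F : AdaptedFrame D)

/-- The coefficient matrix: `F.A x i j` is `A_i^j(x)`, where `X_i = ∑_j A_i^j ∂/∂x^j`. -/
def A (x : E d) : Matrix (Fin (d + 1)) (Fin (d + 1)) ℝ := Matrix.of fun i j => F.X i x j

/-- The inverse matrix: `F.B x j k` is `B_j^k(x)`, where `∑_j A_i^j B_j^k = δ_i^k`. -/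
def B (x : E d) : Matrix (Fin (d + 1)) (Fin (d + 1)) ℝ := (F.A x)⁻¹

/-- The components `(M_x ξ)_i = ∑_j A_i^j(x) ξ_j`. -/
def M (x ξ : E d) (i : Fin (d + 1)) : ℝ := ∑ j, F.A x i j * ξ j

/-- The variable seminorm `ρ_x(ξ) = (∑_{i < N} |(M_x ξ)_i|²)^{1/2}`, in which the last component of
`M_x ξ` is left out. -/
def rho (x ξ : E d) : ℝ := Real.sqrt (∑ i : Fin d, |F.M x ξ i.castSucc| ^ 2)

end AdaptedFrame

/-- `∂a/∂x^i` for a function `a(x, ξ)`. -/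
def partialX {d : ℕ} (i : Fin (d + 1)) (a : E d → E d → ℂ) : E d → E d → ℂ :=
  fun x ξ => fderiv ℝ (fun y => a y ξ) x (coordVec i)

/-- `∂a/∂ξ_j` for a function `a(x, ξ)`. -/
def partialXi {d : ℕ} (j : Fin (d + 1)) (a : E d → E d → ℂ) : E d → E d → ℂ :=
  fun x ξ => fderiv ℝ (fun η => a x η) ξ (coordVec j)

/-- `∂_ξ^α`, where the multiindex `α` is given as the list of the variables in which to
differentiate, so that `|α| = α.length`. -/
def partialXiList {d : ℕ} (α : List (Fin (d + 1))) (a : E d → E d → ℂ) : E d → E d → ℂ :=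
  α.foldr partialXi a

namespace AdaptedFrame

variable {d : ℕ} {D : E d → Submodule ℝ (E d)} (F : AdaptedFrame D)

/-- The good derivative `D_ξ = ∑_j B_j^N(x) ∂/∂ξ_j`. -/
def goodXi (a : E d → E d → ℂ) : E d → E d → ℂ :=
  fun x ξ => ∑ j, (F.B x j (Fin.last d) : ℂ) * partialXi j a x ξ

/-- The good derivative
`D_i = ∂/∂x^i + ∑_k ∑_p ∑_l (∂B_k^p/∂x^i)(x) A_p^l(x) ξ_l ∂/∂ξ_k`. -/
def goodX (i : Fin (d + 1)) (a : E d → E d → ℂ) : E d → E d → ℂ :=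
  fun x ξ => partialX i a x ξ + ∑ k, ∑ p, ∑ l,
    ((fderiv ℝ (fun y => F.B y k p) x (coordVec i) * F.A x p l * ξ l : ℝ) : ℂ) *
      partialXi k a x ξ

/-- `D^I = D_{i_1} D_{i_2} ⋯ D_{i_k}` for `I = (i_1, …, i_k)`. -/
def goodXList (I : List (Fin (d + 1))) (a : E d → E d → ℂ) : E d → E d → ℂ :=
  I.foldr F.goodX a

/-- The symbol class `S^{m,n}`: smooth `a(x, ξ)` with, for all `α`, `β`, `I`,
`|∂_ξ^α D_ξ^β D^I a| ≤ C (1 + |ξ|)^{m - β} (1 + ρ_x(ξ) + |ξ|^{1/2})^{n - |α|}`. -/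
def symbolClass (m n : ℝ) : Set (E d → E d → ℂ) :=
  {a | ContDiff ℝ ∞ (fun p : E d × E d => a p.1 p.2) ∧
    ∀ (α : List (Fin (d + 1))) (β : ℕ) (I : List (Fin (d + 1))), ∃ C : ℝ, ∀ x ξ : E d,
      ‖partialXiList α (F.goodXi^[β] (F.goodXList I a)) x ξ‖ ≤
        C * (1 + ‖ξ‖) ^ (m - (β : ℝ)) *
          (1 + F.rho x ξ + Real.sqrt ‖ξ‖) ^ (n - (α.length : ℝ))}

end AdaptedFrame

/-- The pseudodifferential operator
`T_a f(x) = ∫ a(x, ξ) f̂(ξ) e^{2π i x·ξ} dξ`, `f` in the Schwartz space, where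
`f̂(ξ) = ∫ f(y) e^{-2π i y·ξ} dy`. -/
def pseudoOp {d : ℕ} (a : E d → E d → ℂ) (f : 𝓢(E d, ℂ)) : E d → ℂ :=
  fun x => ∫ ξ : E d, a x ξ * 𝓕 (f : E d → ℂ) ξ *
    Complex.exp (2 * Real.pi * Complex.I * (inner ℝ x ξ : ℝ))

/-- `S` is the adjoint of `T` with respect to the standard `L²` inner product, both operators being
defined on the Schwartz space: `T` and `S` map Schwartz functions into `L²`, and
`⟨T f, g⟩ = ⟨f, S g⟩` for all Schwartz functions `f`, `g`. -/
def IsL2Adjoint {d : ℕ} (T S : 𝓢(E d, ℂ) → E d → ℂ) : Prop :=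
  (∀ f, MemLp (T f) 2 volume) ∧ (∀ g, MemLp (S g) 2 volume) ∧
    ∀ f g : 𝓢(E d, ℂ), ∫ x, T f x * conj (g x) = ∫ x, f x * conj (S g x)

end MixedSymbol

end

/-! The adjoint ought to have the symbol a*(x,ξ) = ∫∫ conj a(y,η) e^{2πi(x-y)·(η-ξ)} dy dη. This
integral need not converge absolutely, so conj a is multiplied by cutoffs ψ(εy, εη), every bound is
proved uniformly in ε, and ε tends to 0 only at the end (`limInt`).

The phase depends only on x - y and η - ξ. Hence differentiating the integral in (x,ξ) amounts to
differentiating the amplitude c(x,y,η) along ∂_x + ∂_y and ∂_η (`hasFDerivAt_ampInt`), and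
multiplication by ξ_l becomes η_l - (2πi)⁻¹ ∂/∂y^l. So D_i and D_ξ of such an integral are again
such integrals, but the new amplitudes carry coefficients taken at x, while the symbol estimates
concern fields with coefficients at y. The difference of coefficients is O(|x-y|), which is at most
(1+|η|)^{-1/2} times the separation weight 1 + (1+|η|)^{1/2}|x-y| (`ampLE_diff`). This half order,
together with the ∂_η that the coefficient multiplies, is exactly enough: the symbol weight 1 + ρ +
|η|^{1/2} lies between multiples of (1+|η|)^{1/2} and 1+|η|, so order (m+1/2, n-1) is contained in
order (m,n) (`exists_symWt_le`). Good derivatives therefore keep the right order at the price of one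
power of the separation weight (`amp_opGood`, `amp_opTrans`), and membership in S^{m,n} reduces to a
bound without derivatives.

That bound is `exists_ampInt_le`. With λ = (1+|η|)^{1/2}, each ∂_y costs at most λ and each ∂_η
gains at least λ⁻¹, so repeated integration by parts produces arbitrary negative powers of 1 +
λ|x-y| and 1 + |η-ξ|/λ. These absorb the separation weights and the variation of the symbol weight
from (y,η) to (x,ξ), and they leave a kernel whose integral does not depend on (x,ξ).

The definition of S^{m,n} bounds only ordered words in the derivatives. It controls all words
because D_i commutes with D_ξ and [D_i, ∂_ξ] is a combination of ∂_ξ's with bounded smooth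
coefficients (`lie_good_trans`, `lie_good_xi`, `SymBounds.ampLE`).

For cut-off symbols the adjoint identity is Fubini and Fourier inversion (`integral_waveInt_conj`),
and dominated convergence removes the cutoff. Square integrability comes from integrating by parts
in ξ (`SymBounds.waveInt_decay`). -/

open MeasureTheory FourierTransform SchwartzMap
open scoped ContDiff ComplexConjugate

noncomputable section

namespace MixedSymbol

/-! ### Weighted classes of functions stable under products, inverses and derivatives along given
vector fields. -/

section WeightedClass

variable {κ ι V : Type*} [NormedAddCommGroup V] [NormedSpace ℝ V]

/-- The derivative of a family of functions along a vector field. -/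
def along (X : V → V) (u : ι → V → ℂ) : ι → V → ℂ := fun i v => fderiv ℝ (u i) v (X v)

/-- Families of smooth functions that are bounded by the weight `w`. -/
def SmoothBdd (w : ι → V → ℝ) (u : ι → V → ℂ) : Prop :=
  (∀ i, ContDiff ℝ ∞ (u i)) ∧ ∃ C : ℝ, 0 ≤ C ∧ ∀ i v, ‖u i v‖ ≤ C * w i v

/-- Families of smooth functions whose derivatives along words of length at most `k` in the vector
fields `X j` are bounded by the weight `w` times the multipliers `μ j` of the letters. -/
def Cls (X : κ → V → V) (μ : κ → ι → V → ℝ) : ℕ → (ι → V → ℝ) → (ι → V → ℂ) → Prop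
  | 0, w, u => SmoothBdd w u
  | k + 1, w, u => SmoothBdd w u ∧ ∀ j, Cls X μ k (w * μ j) (along (X j) u)

variable {X : κ → V → V} {μ : κ → ι → V → ℝ} {w w' : ι → V → ℝ} {u v : ι → V → ℂ} {k : ℕ}

theorem Cls.smoothBdd (h : Cls X μ k w u) : SmoothBdd w u := by
  cases k with
  | zero => exact h
  | succ k => exact h.1

theorem Cls.contDiff (h : Cls X μ k w u) (i : ι) : ContDiff ℝ ∞ (u i) := h.smoothBdd.1 i

theorem Cls.differentiable (h : Cls X μ k w u) (i : ι) : Differentiable ℝ (u i) :=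
  (h.contDiff i).differentiable (by simp)

theorem Cls.along (h : Cls X μ (k + 1) w u) (j : κ) : Cls X μ k (w * μ j) (along (X j) u) := h.2 j

theorem Cls.of_succ (h : Cls X μ (k + 1) w u) : Cls X μ k w u := by
  induction k generalizing w u with
  | zero => exact h.1
  | succ k ih => exact ⟨h.1, fun j => ih (h.2 j)⟩

theorem SmoothBdd.mono (h : SmoothBdd w u) {C : ℝ} (hC : 0 ≤ C)
    (hw : ∀ i v, w i v ≤ C * w' i v) : SmoothBdd w' u := by
  obtain ⟨h1, C', hC', h2⟩ := h
  refine ⟨h1, C' * C, by positivity, fun i v => (h2 i v).trans ?_⟩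
  rw [mul_assoc]
  exact mul_le_mul_of_nonneg_left (hw i v) hC'

theorem Cls.mono (hμ : ∀ j i v, 0 ≤ μ j i v) (h : Cls X μ k w u) {C : ℝ} (hC : 0 ≤ C)
    (hw : ∀ i v, w i v ≤ C * w' i v) : Cls X μ k w' u := by
  induction k generalizing w w' u with
  | zero => exact SmoothBdd.mono h hC hw
  | succ k ih =>
    refine ⟨h.1.mono hC hw, fun j => ih (h.2 j) fun i v => ?_⟩
    simp only [Pi.mul_apply]
    rw [← mul_assoc]
    exact mul_le_mul_of_nonneg_right (hw i v) (hμ j i v)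

theorem Cls.add (hu : Cls X μ k w u) (hv : Cls X μ k w v) : Cls X μ k w (u + v) := by
  have key : ∀ {w : ι → V → ℝ} {u v : ι → V → ℂ}, SmoothBdd w u → SmoothBdd w v →
      SmoothBdd w (u + v) := by
    rintro w u v ⟨h1, C, hC, h2⟩ ⟨h1', C', hC', h2'⟩
    refine ⟨fun i => (h1 i).add (h1' i), C + C', by positivity, fun i v => ?_⟩
    rw [add_mul]
    exact (norm_add_le _ _).trans (add_le_add (h2 i v) (h2' i v))
  induction k generalizing w u v with
  | zero => exact key hu hv
  | succ k ih =>
    refine ⟨key hu.1 hv.1, fun j => ?_⟩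
    have : MixedSymbol.along (X j) (u + v)
        = MixedSymbol.along (X j) u + MixedSymbol.along (X j) v := by
      funext i x
      simp only [MixedSymbol.along, Pi.add_apply]
      rw [fderiv_add (hu.differentiable i x) (hv.differentiable i x)]
      rfl
    rw [this]
    exact ih (hu.2 j) (hv.2 j)

theorem Cls.zero (hμ : ∀ j i v, 0 ≤ μ j i v) (hw : ∀ i v, 0 ≤ w i v) : Cls X μ k w 0 := by
  have key : ∀ {w : ι → V → ℝ}, (∀ i v, 0 ≤ w i v) → SmoothBdd w (0 : ι → V → ℂ) := by
    intro w hw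
    exact ⟨fun i => contDiff_const, 0, le_rfl, fun i v => by simp⟩
  induction k generalizing w with
  | zero => exact key hw
  | succ k ih =>
    refine ⟨key hw, fun j => ?_⟩
    have : MixedSymbol.along (X j) (0 : ι → V → ℂ) = 0 := by
      funext i x
      simp only [MixedSymbol.along, Pi.zero_apply]
      rw [show ((0 : V → ℂ)) = fun _ => 0 from rfl, fderiv_fun_const]
      rfl
    rw [this]
    exact ih fun i v => mul_nonneg (hw i v) (hμ j i v)

theorem Cls.sum {τ : Type*} (hμ : ∀ j i v, 0 ≤ μ j i v) (hw : ∀ i v, 0 ≤ w i v) (s : Finset τ)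
    {u : τ → ι → V → ℂ} (h : ∀ t ∈ s, Cls X μ k w (u t)) : Cls X μ k w (∑ t ∈ s, u t) := by
  classical
  induction s using Finset.induction_on with
  | empty => simpa using Cls.zero hμ hw
  | insert a s ha ih =>
    rw [Finset.sum_insert ha]
    exact (h a (Finset.mem_insert_self _ _)).add (ih fun t ht => h t (Finset.mem_insert_of_mem ht))

theorem along_mul {X : V → V} (hu : ∀ i, Differentiable ℝ (u i))
    (hv : ∀ i, Differentiable ℝ (v i)) :
    MixedSymbol.along X (u * v) = MixedSymbol.along X u * v + u * MixedSymbol.along X v := by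
  funext i x
  simp only [MixedSymbol.along, Pi.mul_apply, Pi.add_apply]
  rw [fderiv_mul (hu i x) (hv i x)]
  simp only [add_apply, smul_apply, smul_eq_mul]
  ring

theorem Cls.mul (hu : Cls X μ k w u) (hv : Cls X μ k w' v) : Cls X μ k (w * w') (u * v) := by
  have key : ∀ {w w' : ι → V → ℝ} {u v : ι → V → ℂ}, SmoothBdd w u → SmoothBdd w' v →
      SmoothBdd (w * w') (u * v) := by
    rintro w w' u v ⟨h1, C, hC, h2⟩ ⟨h1', C', hC', h2'⟩
    refine ⟨fun i => (h1 i).mul (h1' i), C * C', by positivity, fun i v => ?_⟩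
    simp only [Pi.mul_apply, norm_mul]
    calc _ ≤ (C * w i v) * (C' * w' i v) :=
          mul_le_mul (h2 i v) (h2' i v) (norm_nonneg _) ((norm_nonneg _).trans (h2 i v))
      _ = _ := by ring
  induction k generalizing w w' u v with
  | zero => exact key hu hv
  | succ k ih =>
    refine ⟨key hu.1 hv.1, fun j => ?_⟩
    rw [along_mul hu.differentiable hv.differentiable]
    have h1 := ih (hu.2 j) hv.of_succ
    have h2 := ih hu.of_succ (hv.2 j)
    rw [show w * μ j * w' = w * w' * μ j by ring] at h1
    rw [show w * (w' * μ j) = w * w' * μ j by ring] at h2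
    exact h1.add h2

theorem Cls.const (hμ : ∀ j i v, 0 ≤ μ j i v) (c : ℂ) :
    Cls X μ k (1 : ι → V → ℝ) (fun _ _ => c) := by
  have h0 : SmoothBdd (1 : ι → V → ℝ) (fun _ _ => c) :=
    ⟨fun i => contDiff_const, ‖c‖, norm_nonneg _, fun i v => by simp⟩
  cases k with
  | zero => exact h0
  | succ k =>
    refine ⟨h0, fun j => ?_⟩
    have : MixedSymbol.along (X j) (fun _ _ => c : ι → V → ℂ) = 0 := by
      funext i x
      simp [MixedSymbol.along]
    rw [this]
    exact Cls.zero hμ fun i v => by simpa using hμ j i v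

theorem Cls.const_smul (hμ : ∀ j i v, 0 ≤ μ j i v) (c : ℂ) (hu : Cls X μ k w u) :
    Cls X μ k w (fun i v => c * u i v) := by
  have := (Cls.const (X := X) (k := k) hμ c).mul hu
  rwa [one_mul] at this

theorem Cls.neg (hμ : ∀ j i v, 0 ≤ μ j i v) (hu : Cls X μ k w u) : Cls X μ k w (-u) := by
  have := hu.const_smul hμ (-1)
  convert this using 1
  funext i v
  simp

theorem Cls.sub (hμ : ∀ j i v, 0 ≤ μ j i v) (hu : Cls X μ k w u) (hv : Cls X μ k w v) :
    Cls X μ k w (u - v) := by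
  rw [sub_eq_add_neg]
  exact hu.add (hv.neg hμ)

theorem Cls.prod {τ : Type*} (hμ : ∀ j i v, 0 ≤ μ j i v) (s : Finset τ)
    {u : τ → ι → V → ℂ} (h : ∀ t ∈ s, Cls X μ k 1 (u t)) : Cls X μ k 1 (∏ t ∈ s, u t) := by
  classical
  induction s using Finset.induction_on with
  | empty => exact Cls.const hμ 1
  | insert a s ha ih =>
    rw [Finset.prod_insert ha]
    simpa using (h a (Finset.mem_insert_self _ _)).mul
      (ih fun t ht => h t (Finset.mem_insert_of_mem ht))

theorem Cls.conj (hu : Cls X μ k w u) : Cls X μ k w (fun i v => conj (u i v)) := by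
  have key : ∀ {w : ι → V → ℝ} {u : ι → V → ℂ}, SmoothBdd w u →
      SmoothBdd w (fun i v => conj (u i v)) := by
    rintro w u ⟨h1, C, hC, h2⟩
    exact ⟨fun i => Complex.conjCLE.contDiff.comp (h1 i), C, hC, fun i v => by simpa using h2 i v⟩
  induction k generalizing w u with
  | zero => exact key hu
  | succ k ih =>
    refine ⟨key hu.1, fun j => ?_⟩
    have : MixedSymbol.along (X j) (fun i v => conj (u i v))
        = fun i v => conj (MixedSymbol.along (X j) u i v) := by
      funext i x
      simp only [MixedSymbol.along]
      have := (Complex.conjCLE.hasFDerivAt.comp x (hu.differentiable i x).hasFDerivAt).fderiv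
      change fderiv ℝ (Complex.conjCLE ∘ u i) x (X j x) = _
      rw [this]
      rfl
    rw [this]
    exact ih (hu.2 j)

/-- X(1/u) = -(Xu)/u², whose weight is (wμ)w⁻² = w⁻¹μ. So the lower bound is needed for u only, and
induction on the word length does the rest. -/
theorem Cls.inv {c : ℝ} (hc : 0 < c) (hw : ∀ i v, 0 < w i v) (hμ : ∀ j i v, 0 ≤ μ j i v)
    (hu : Cls X μ k w u) (hlow : ∀ i v, c * w i v ≤ ‖u i v‖) : Cls X μ k w⁻¹ u⁻¹ := by
  have hne : ∀ i v, u i v ≠ 0 := fun i v h => by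
    have := hlow i v
    rw [h, norm_zero] at this
    exact absurd this (not_le.mpr (mul_pos hc (hw i v)))
  have key : SmoothBdd w⁻¹ u⁻¹ := by
    refine ⟨fun i => (hu.contDiff i).inv (hne i), c⁻¹, by positivity, fun i v => ?_⟩
    simp only [Pi.inv_apply, norm_inv]
    rw [← mul_inv]
    exact inv_anti₀ (mul_pos hc (hw i v)) (hlow i v)
  induction k with
  | zero => exact key
  | succ k ih =>
    refine ⟨key, fun j => ?_⟩
    have : MixedSymbol.along (X j) u⁻¹ = -(MixedSymbol.along (X j) u * (u⁻¹ * u⁻¹)) := by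
      funext i x
      simp only [MixedSymbol.along, Pi.neg_apply, Pi.mul_apply, Pi.inv_apply]
      have h := ((hasDerivAt_inv (hne i x)).hasFDerivAt.restrictScalars ℝ).comp x
        (hu.differentiable i x).hasFDerivAt
      change fderiv ℝ ((fun y => y⁻¹) ∘ u i) x (X j x) = _
      rw [h.fderiv]
      simp only [ContinuousLinearMap.comp_apply, ContinuousLinearMap.coe_restrictScalars',
        ContinuousLinearMap.toSpanSingleton_apply, smul_eq_mul]
      rw [sq, mul_inv]
      ring
    rw [this]
    have h := ((hu.2 j).mul ((ih hu.of_succ).mul (ih hu.of_succ))).neg hμ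
    refine h.mono hμ zero_le_one fun i v => ?_
    have := (hw i v).ne'
    simp only [Pi.mul_apply, Pi.inv_apply]
    field_simp
    exact le_rfl

/-- Families all of whose derivatives along words in the vector fields obey the bounds. -/
def AllCls (X : κ → V → V) (μ : κ → ι → V → ℝ) (w : ι → V → ℝ) (u : ι → V → ℂ) : Prop :=
  ∀ k, Cls X μ k w u

theorem AllCls.along (h : AllCls X μ w u) (j : κ) : AllCls X μ (w * μ j) (MixedSymbol.along (X j) u) :=
  fun k => (h (k + 1)).along j

end WeightedClass

/-! ### Smooth functions with bounded derivatives; the coefficients of the frame and of its inverse.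
-/

section BoundedSmooth

variable {d : ℕ}

/-- Smooth real functions on `ℝ^N` all of whose derivatives are bounded. -/
def BddSmooth (f : E d → ℝ) : Prop :=
  AllCls (fun (j : Fin (d + 1)) _ => coordVec j) 1 (1 : Unit → E d → ℝ) fun _ x => (f x : ℂ)

theorem one_nonneg_mult {κ ι V : Type*} :
    ∀ (j : κ) (i : ι) (v : V), 0 ≤ (1 : κ → ι → V → ℝ) j i v := fun _ _ _ => zero_le_one

theorem fderiv_ofReal_comp {V : Type*} [NormedAddCommGroup V] [NormedSpace ℝ V] {f : V → ℝ} {x : V}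
    (hf : DifferentiableAt ℝ f x) (v : V) :
    fderiv ℝ (fun y => (f y : ℂ)) x v = (fderiv ℝ f x v : ℝ) := by
  have h := (Complex.ofRealCLM.hasFDerivAt.comp x hf.hasFDerivAt).fderiv
  change fderiv ℝ (Complex.ofRealCLM ∘ f) x v = _
  rw [h]
  rfl

theorem BddSmooth.contDiff {f : E d → ℝ} (h : BddSmooth f) : ContDiff ℝ ∞ f :=
  Complex.reCLM.contDiff.comp ((h 0).contDiff ())

theorem BddSmooth.differentiable {f : E d → ℝ} (h : BddSmooth f) : Differentiable ℝ f :=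
  h.contDiff.differentiable (by simp)

theorem along_ofReal {f : E d → ℝ} (hf : Differentiable ℝ f) (j : Fin (d + 1)) :
    along (fun _ => coordVec j) (fun (_ : Unit) x => (f x : ℂ))
      = fun _ x => ((fderiv ℝ f x (coordVec j) : ℝ) : ℂ) := by
  funext i x
  exact fderiv_ofReal_comp (hf x) _

theorem BddSmooth.fderiv {f : E d → ℝ} (h : BddSmooth f) (j : Fin (d + 1)) :
    BddSmooth fun x => fderiv ℝ f x (coordVec j) := by
  have := h.along j
  rw [along_ofReal h.differentiable, Pi.one_apply, one_mul] at this
  exact this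

theorem bddSmooth_of_iteratedFDeriv {f : E d → ℝ} (hf : ContDiff ℝ ∞ f)
    (hb : ∀ k : ℕ, ∃ C : ℝ, ∀ x, ‖iteratedFDeriv ℝ k f x‖ ≤ C) : BddSmooth f := by
  intro k
  induction k generalizing f with
  | zero =>
    obtain ⟨C, hC⟩ := hb 0
    refine ⟨fun _ => Complex.ofRealCLM.contDiff.comp hf, C,
      (norm_nonneg _).trans (hC 0), fun _ x => ?_⟩
    simpa using hC x
  | succ k ih =>
    obtain ⟨C, hC⟩ := hb 0
    refine ⟨⟨fun _ => Complex.ofRealCLM.contDiff.comp hf, C,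
      (norm_nonneg _).trans (hC 0), fun _ x => by simpa using hC x⟩, fun j => ?_⟩
    rw [along_ofReal (hf.differentiable (by simp))]
    have hf' : ContDiff ℝ ∞ (fun x => _root_.fderiv ℝ f x) := hf.fderiv_right (by simp)
    have := ih (f := fun x => _root_.fderiv ℝ f x (coordVec j)) (hf'.clm_apply contDiff_const)
      fun l => by
        obtain ⟨C, hC⟩ := hb (l + 1)
        refine ⟨‖(coordVec j : E d)‖ * C, fun x => ?_⟩
        refine (norm_iteratedFDeriv_clm_apply_const (hf'.contDiffAt (x := x))
          (by exact_mod_cast le_top)).trans ?_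
        refine mul_le_mul_of_nonneg_left ?_ (norm_nonneg _)
        rw [norm_iteratedFDeriv_fderiv]
        exact hC x
    simpa using this

theorem BddSmooth.const (c : ℝ) : BddSmooth fun _ : E d => c := fun _ =>
  Cls.const one_nonneg_mult _

theorem BddSmooth.mul {f g : E d → ℝ} (hf : BddSmooth f) (hg : BddSmooth g) :
    BddSmooth fun x => f x * g x := fun k => by
  have := (hf k).mul (hg k)
  rw [one_mul] at this
  convert this using 1
  funext i x
  simp

theorem BddSmooth.sum {τ : Type*} (s : Finset τ) {f : τ → E d → ℝ} (hf : ∀ t ∈ s, BddSmooth (f t)) :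
    BddSmooth fun x => ∑ t ∈ s, f t x := fun k => by
  have := Cls.sum (w := 1) one_nonneg_mult (fun _ _ => zero_le_one) s (fun t ht => hf t ht k)
  convert this using 1
  funext i x
  simp

theorem BddSmooth.prod {τ : Type*} (s : Finset τ) {f : τ → E d → ℝ}
    (hf : ∀ t ∈ s, BddSmooth (f t)) : BddSmooth fun x => ∏ t ∈ s, f t x := fun k => by
  have := Cls.prod one_nonneg_mult s (fun t ht => hf t ht k)
  convert this using 1
  funext i x
  simp

theorem BddSmooth.inv {f : E d → ℝ} (hf : BddSmooth f) {c : ℝ} (hc : 0 < c)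
    (h : ∀ x, c ≤ |f x|) : BddSmooth fun x => (f x)⁻¹ := fun k => by
  have := (hf k).inv (w := 1) hc (fun _ _ => zero_lt_one) one_nonneg_mult (fun _ x => by simpa using h x)
  rw [inv_one] at this
  convert this using 1
  funext i x
  simp

theorem BddSmooth.det {M : E d → Matrix (Fin (d + 1)) (Fin (d + 1)) ℝ}
    (hM : ∀ i j, BddSmooth fun x => M x i j) : BddSmooth fun x => (M x).det := by
  simp only [Matrix.det_apply']
  exact BddSmooth.sum _ fun σ _ => (BddSmooth.const _).mul (BddSmooth.prod _ fun i _ => hM _ _)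

theorem BddSmooth.lipschitz {f : E d → ℝ} (hf : BddSmooth f) :
    ∃ C : ℝ, 0 ≤ C ∧ ∀ x y, |f x - f y| ≤ C * ‖x - y‖ := by
  have h1 : ∀ j, ∃ C : ℝ, 0 ≤ C ∧ ∀ x, |_root_.fderiv ℝ f x (coordVec j)| ≤ C := fun j => by
    obtain ⟨C, hC, h⟩ := ((hf.fderiv j) 0).smoothBdd.2
    exact ⟨C, hC, fun x => by simpa using h () x⟩
  choose C hC h using h1
  refine ⟨∑ j, C j, Finset.sum_nonneg fun j _ => hC j, fun x y => ?_⟩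
  refine (convex_univ : Convex ℝ (Set.univ : Set (E d))).norm_image_sub_le_of_norm_fderiv_le
    (𝕜 := ℝ) (fun z _ => hf.differentiable z) (fun z _ => ?_) (Set.mem_univ y) (Set.mem_univ x)
  refine ContinuousLinearMap.opNorm_le_bound _ (Finset.sum_nonneg fun j _ => hC j) fun v => ?_
  have hv : v = ∑ j, v j • (coordVec j : E d) := by
    ext i
    simp [coordVec, Pi.single_apply]
  conv_lhs => rw [hv]
  rw [map_sum, Finset.sum_mul]
  refine (norm_sum_le _ _).trans (Finset.sum_le_sum fun j _ => ?_)
  rw [map_smul, norm_smul, mul_comm]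
  exact mul_le_mul (h j z) (PiLp.norm_apply_le v j) (norm_nonneg _) (hC j)

namespace AdaptedFrame

variable {D : E d → Submodule ℝ (E d)} (F : AdaptedFrame D)

theorem bddSmooth_A (i j : Fin (d + 1)) : BddSmooth fun x => F.A x i j :=
  bddSmooth_of_iteratedFDeriv (F.smooth i j) (F.bounded i j)

/-- Cramer's rule: an entry of the inverse is a polynomial in the entries of `F.A` divided by the
determinant, which stays away from zero. -/
theorem bddSmooth_B (i j : Fin (d + 1)) : BddSmooth fun x => F.B x i j := by
  obtain ⟨c, hc, hdet⟩ := F.det_bound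
  have h : ∀ x, F.B x i j = (F.A x).det⁻¹ * ((F.A x).updateRow j (Pi.single i 1)).det := by
    intro x
    rw [B, Matrix.inv_def, Ring.inverse_eq_inv', Matrix.smul_apply, Matrix.adjugate_apply,
      smul_eq_mul]
  simp only [h]
  refine ((BddSmooth.det F.bddSmooth_A).inv hc hdet).mul (BddSmooth.det fun k l => ?_)
  by_cases hk : k = j
  · subst hk
    simp only [Matrix.updateRow_self]
    exact BddSmooth.const _
  · simp only [Matrix.updateRow_ne hk]
    exact F.bddSmooth_A k l

/-- The coefficients `∑_p (∂B_k^p/∂x^i) A_p^l` of the good derivative `D_i`. -/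
def L (i k l : Fin (d + 1)) (x : E d) : ℝ :=
  ∑ p, fderiv ℝ (fun y => F.B y k p) x (coordVec i) * F.A x p l

theorem bddSmooth_L (i k l : Fin (d + 1)) : BddSmooth (F.L i k l) :=
  BddSmooth.sum _ fun p _ => ((F.bddSmooth_B k p).fderiv i).mul (F.bddSmooth_A p l)

end AdaptedFrame

end BoundedSmooth

/-! ### The symbol weights and the inclusions between orders. -/

section Weights

variable {d : ℕ}

theorem norm_le_sum_abs {ι : Type*} [Fintype ι] (v : EuclideanSpace ℝ ι) : ‖v‖ ≤ ∑ i, |v i| := by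
  classical
  have hv : v = ∑ j, v j • (EuclideanSpace.single j 1 : EuclideanSpace ℝ ι) := by
    ext i
    simp [Pi.single_apply]
  conv_lhs => rw [hv]
  refine (norm_sum_le _ _).trans (Finset.sum_le_sum fun j _ => ?_)
  rw [norm_smul]
  simp

namespace AdaptedFrame

variable {D : E d → Submodule ℝ (E d)} (F : AdaptedFrame D)

theorem rho_nonneg (x ξ : E d) : 0 ≤ F.rho x ξ := Real.sqrt_nonneg _

theorem rho_eq_norm (x ξ : E d) :
    F.rho x ξ = ‖(WithLp.toLp 2 fun i : Fin d => F.M x ξ i.castSucc : EuclideanSpace ℝ (Fin d))‖ := by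
  simp [rho, EuclideanSpace.norm_eq]

/-- A(x)ξ - A(y)η = A(x)(ξ-η) + (A(x)-A(y))η, where A is bounded and Lipschitz. -/
theorem exists_M_sub_le (i : Fin (d + 1)) : ∃ C : ℝ, 0 ≤ C ∧ ∀ x y ξ η,
    |F.M x ξ i - F.M y η i| ≤ C * (‖ξ - η‖ + ‖x - y‖ * ‖η‖) := by
  have h1 : ∀ j, ∃ C : ℝ, 0 ≤ C ∧ (∀ x, |F.A x i j| ≤ C) ∧
      ∀ x y, |F.A x i j - F.A y i j| ≤ C * ‖x - y‖ := fun j => by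
    obtain ⟨C, hC, h⟩ := (F.bddSmooth_A i j 0).smoothBdd.2
    obtain ⟨C', hC', h'⟩ := (F.bddSmooth_A i j).lipschitz
    exact ⟨C + C', by positivity, fun x => by
      have := h () x
      simp at this
      linarith, fun x y => (h' x y).trans (by gcongr; linarith)⟩
  choose C hC h h' using h1
  refine ⟨∑ j, C j, Finset.sum_nonneg fun j _ => hC j, fun x y ξ η => ?_⟩
  have : F.M x ξ i - F.M y η i
      = ∑ j, (F.A x i j * (ξ - η) j + (F.A x i j - F.A y i j) * η j) := by
    rw [M, M, ← Finset.sum_sub_distrib]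
    refine Finset.sum_congr rfl fun j _ => ?_
    simp only [PiLp.sub_apply]
    ring
  rw [this, Finset.sum_mul]
  refine (Finset.abs_sum_le_sum_abs _ _).trans (Finset.sum_le_sum fun j _ => ?_)
  refine (abs_add_le _ _).trans ?_
  rw [abs_mul, abs_mul, mul_add, ← mul_assoc]
  exact add_le_add (mul_le_mul (h j x) (PiLp.norm_apply_le (ξ - η) j) (abs_nonneg _) (hC j))
    (mul_le_mul (h' j x y) (PiLp.norm_apply_le η j) (abs_nonneg _)
      (mul_nonneg (hC j) (norm_nonneg _)))

theorem exists_rho_le : ∃ C : ℝ, 0 ≤ C ∧ ∀ x y ξ η,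
    F.rho x ξ ≤ F.rho y η + C * (‖ξ - η‖ + ‖x - y‖ * ‖η‖) := by
  choose C hC h using F.exists_M_sub_le
  refine ⟨∑ i : Fin d, C i.castSucc, Finset.sum_nonneg fun j _ => hC _, fun x y ξ η => ?_⟩
  rw [rho_eq_norm, rho_eq_norm, Finset.sum_mul]
  refine (norm_le_norm_add_norm_sub' _ _).trans (add_le_add le_rfl ?_)
  refine (norm_le_sum_abs _).trans (Finset.sum_le_sum fun i _ => ?_)
  exact h i.castSucc x y ξ η

theorem exists_rho_le_norm : ∃ C : ℝ, 0 ≤ C ∧ ∀ x ξ, F.rho x ξ ≤ C * ‖ξ‖ := by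
  obtain ⟨C, hC, h⟩ := F.exists_rho_le
  refine ⟨C, hC, fun x ξ => ?_⟩
  have := h x x ξ 0
  have h0 : F.rho x 0 = 0 := by simp [rho, M]
  simpa [h0] using this

/-- The weight `1 + ρ_y(η) + |η|^{1/2}`. -/
def wt (y η : E d) : ℝ := 1 + F.rho y η + Real.sqrt ‖η‖

theorem one_le_wt (y η : E d) : 1 ≤ F.wt y η := by
  have := F.rho_nonneg y η
  have := Real.sqrt_nonneg ‖η‖
  rw [wt]
  linarith

theorem wt_pos (y η : E d) : 0 < F.wt y η := one_pos.trans_le (F.one_le_wt y η)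

theorem one_add_norm_le_wt_sq (y η : E d) : 1 + ‖η‖ ≤ F.wt y η ^ 2 := by
  have h1 := F.rho_nonneg y η
  have h2 := Real.sqrt_nonneg ‖η‖
  have h3 := Real.sq_sqrt (norm_nonneg η)
  rw [wt]
  nlinarith [mul_nonneg h1 h2, sq_nonneg (F.rho y η)]

theorem exists_wt_le : ∃ C : ℝ, 1 ≤ C ∧ ∀ y η, F.wt y η ≤ C * (1 + ‖η‖) := by
  obtain ⟨C, hC, h⟩ := F.exists_rho_le_norm
  refine ⟨C + 2, by linarith, fun y η => ?_⟩
  have h1 := h y η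
  have h2 : Real.sqrt ‖η‖ ≤ 1 + ‖η‖ := by
    rw [Real.sqrt_le_left (by positivity)]
    nlinarith [norm_nonneg η]
  rw [wt]
  nlinarith [norm_nonneg η]

end AdaptedFrame

/-- The weight `1 + (1 + |η|)^{1/2} |x - y|`. -/
def sepWt (x y η : E d) : ℝ := 1 + Real.sqrt (1 + ‖η‖) * ‖x - y‖

theorem one_le_sepWt (x y η : E d) : 1 ≤ sepWt x y η := by
  have : 0 ≤ Real.sqrt (1 + ‖η‖) * ‖x - y‖ := by positivity
  rw [sepWt]
  linarith

theorem one_add_norm_pos (η : E d) : 0 < 1 + ‖η‖ := by positivity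

namespace AdaptedFrame

variable {D : E d → Submodule ℝ (E d)} (F : AdaptedFrame D)

/-- The symbol weight `(1 + |η|)^m (1 + ρ_y(η) + |η|^{1/2})^n`. -/
def symWt (m n : ℝ) (y η : E d) : ℝ := (1 + ‖η‖) ^ m * F.wt y η ^ n

theorem symWt_pos (m n : ℝ) (y η : E d) : 0 < F.symWt m n y η :=
  mul_pos (Real.rpow_pos_of_pos (one_add_norm_pos η) _) (Real.rpow_pos_of_pos (F.wt_pos y η) _)

theorem symWt_mul (m n m' n' : ℝ) (y η : E d) :
    F.symWt m n y η * F.symWt m' n' y η = F.symWt (m + m') (n + n') y η := by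
  simp only [symWt]
  rw [Real.rpow_add (one_add_norm_pos η), Real.rpow_add (F.wt_pos y η)]
  ring

/-- The weight `F.wt` ranges between (1+|η|)^{1/2} and a multiple of 1+|η|; the two hypotheses
compare the orders at these two extremes. With s and t their slacks, the quotient of the weights is
((1+|η|)/wt)^{2s} (wt²/(1+|η|))^t, and both bases are bounded below. This exchange of orders is what
every later comparison of exponents uses. -/
theorem exists_symWt_le {m n m' n' : ℝ} (h1 : m + n / 2 ≤ m' + n' / 2) (h2 : m + n ≤ m' + n') :
    ∃ C : ℝ, 0 ≤ C ∧ ∀ y η, F.symWt m n y η ≤ C * F.symWt m' n' y η := by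
  obtain ⟨C, hC, h⟩ := F.exists_wt_le
  set s := (m' + n' / 2) - (m + n / 2) with hs
  set t := (m' + n') - (m + n) with ht
  have hs0 : 0 ≤ s := by rw [hs]; linarith
  have ht0 : 0 ≤ t := by rw [ht]; linarith
  refine ⟨(C ^ 2) ^ s, by positivity, fun y η => ?_⟩
  have ha := one_add_norm_pos η
  have hw := F.wt_pos y η
  have e1 : F.symWt m' n' y η = F.symWt m n y η *
      ((((1 + ‖η‖) / F.wt y η) ^ 2) ^ s * (F.wt y η ^ 2 / (1 + ‖η‖)) ^ t) := by
    rw [show m' = m + (2 * s - t) by rw [hs, ht]; ring,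
      show n' = n + (2 * t - 2 * s) by rw [hs, ht]; ring, ← symWt_mul]
    congr 1
    rw [symWt, div_pow, Real.div_rpow (by positivity) (by positivity),
      Real.div_rpow (by positivity) ha.le, ← Real.rpow_natCast, ← Real.rpow_natCast,
      ← Real.rpow_mul ha.le, ← Real.rpow_mul hw.le, ← Real.rpow_mul hw.le,
      Real.rpow_sub ha, Real.rpow_sub hw]
    push_cast
    field_simp
  have e2 : 1 ≤ (C ^ 2) ^ s * (((1 + ‖η‖) / F.wt y η) ^ 2) ^ s := by
    rw [← Real.mul_rpow (by positivity) (by positivity), ← mul_pow]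
    refine Real.one_le_rpow (one_le_pow₀ ?_) hs0
    rw [← mul_div_assoc, one_le_div hw]
    exact h y η
  have e3 : 1 ≤ (F.wt y η ^ 2 / (1 + ‖η‖)) ^ t := by
    refine Real.one_le_rpow ?_ ht0
    rw [one_le_div ha]
    exact F.one_add_norm_le_wt_sq y η
  rw [e1]
  have h0 := (F.symWt_pos m n y η).le
  calc F.symWt m n y η = F.symWt m n y η * (1 * 1) := by ring
    _ ≤ F.symWt m n y η * (((C ^ 2) ^ s * (((1 + ‖η‖) / F.wt y η) ^ 2) ^ s) *
        (F.wt y η ^ 2 / (1 + ‖η‖)) ^ t) :=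
        mul_le_mul_of_nonneg_left (mul_le_mul e2 e3 zero_le_one (zero_le_one.trans e2)) h0
    _ = _ := by ring

/-- The weight of amplitudes `c(x, y, η)`. -/
def ampWt (m n p : ℝ) : ℕ → E d × E d × E d → ℝ :=
  fun _ v => F.symWt m n v.2.1 v.2.2 * sepWt v.1 v.2.1 v.2.2 ^ p

theorem ampWt_pos (m n p : ℝ) (i : ℕ) (v : E d × E d × E d) : 0 < F.ampWt m n p i v :=
  mul_pos (F.symWt_pos _ _ _ _)
    (Real.rpow_pos_of_pos (one_pos.trans_le (one_le_sepWt _ _ _)) _)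

theorem ampWt_mul (m n p m' n' p' : ℝ) :
    F.ampWt m n p * F.ampWt m' n' p' = F.ampWt (m + m') (n + n') (p + p') := by
  funext i v
  simp only [ampWt, Pi.mul_apply]
  rw [← symWt_mul, Real.rpow_add (one_pos.trans_le (one_le_sepWt _ _ _))]
  ring

theorem ampWt_zero : F.ampWt 0 0 0 = 1 := by
  funext i v
  simp [ampWt, symWt]

theorem exists_ampWt_le {m n p m' n' p' : ℝ} (h1 : m + n / 2 ≤ m' + n' / 2)
    (h2 : m + n ≤ m' + n') (h3 : p ≤ p') :
    ∃ C : ℝ, 0 ≤ C ∧ ∀ i v, F.ampWt m n p i v ≤ C * F.ampWt m' n' p' i v := by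
  obtain ⟨C, hC, h⟩ := F.exists_symWt_le h1 h2
  refine ⟨C, hC, fun i v => ?_⟩
  rw [ampWt, ampWt, ← mul_assoc]
  exact mul_le_mul (h _ _) (Real.rpow_le_rpow_of_exponent_le (one_le_sepWt _ _ _) h3)
    (Real.rpow_nonneg (zero_le_one.trans (one_le_sepWt _ _ _)) _)
    (mul_nonneg hC (F.symWt_pos _ _ _ _).le)

end AdaptedFrame

end Weights

/-! ### Amplitudes c(x, y, η), indexed by the cutoff parameter, and the basic examples. -/

section Amplitudes

variable {d : ℕ}

/-- Labels of the vector fields that act on amplitudes `c(x, y, η)`. -/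
inductive Letter (d : ℕ) : Type
  | good (i : Fin (d + 1)) : Letter d
  | dEta (j : Fin (d + 1)) : Letter d
  | trans : Letter d
  | dY (j : Fin (d + 1)) : Letter d

namespace AdaptedFrame

variable {D : E d → Submodule ℝ (E d)} (F : AdaptedFrame D)

/-- The `ξ`-part of the vector field `D_i`. -/
def LVec (i : Fin (d + 1)) (y η : E d) : E d := WithLp.toLp 2 fun k => ∑ l, F.L i k l y * η l

/-- The vector field `D_ξ`. -/
def BVec (y : E d) : E d := WithLp.toLp 2 fun j => F.B y j (Fin.last d)

/-- The vector fields that act on amplitudes. -/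
def field : Letter d → E d × E d × E d → E d × E d × E d
  | .good i, v => (coordVec i, coordVec i, F.LVec i v.2.1 v.2.2)
  | .dEta j, _ => (0, 0, coordVec j)
  | .trans, v => (0, 0, F.BVec v.2.1)
  | .dY j, _ => (0, coordVec j, 0)

/-- The multipliers of the vector fields that act on amplitudes. -/
def mult : Letter d → ℕ → E d × E d × E d → ℝ
  | .good _ => F.ampWt 0 0 0
  | .dEta _ => F.ampWt 0 (-1) 0
  | .trans => F.ampWt (-1) 0 0
  | .dY _ => F.ampWt (1 / 2) 0 0

theorem mult_nonneg (j : Letter d) (i : ℕ) (v : E d × E d × E d) : 0 ≤ F.mult j i v := by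
  cases j <;> exact (F.ampWt_pos _ _ _ i v).le

/-- Amplitudes of order `(m, n)`, up to a power `p` of the separation weight, with bounds on the
derivatives along words of length at most `k`. -/
def AmpLE (k : ℕ) (m n p : ℝ) (c : ℕ → E d × E d × E d → ℂ) : Prop :=
  Cls F.field F.mult k (F.ampWt m n p) c

/-- Amplitudes of order `(m, n)`, up to a power `p` of the separation weight. -/
def Amp (m n p : ℝ) (c : ℕ → E d × E d × E d → ℂ) : Prop := ∀ k, F.AmpLE k m n p c

variable {F} {k : ℕ} {m n p m' n' p' : ℝ} {c c' : ℕ → E d × E d × E d → ℂ}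

theorem AmpLE.mono (h : F.AmpLE k m n p c) (h1 : m + n / 2 ≤ m' + n' / 2)
    (h2 : m + n ≤ m' + n') (h3 : p ≤ p') : F.AmpLE k m' n' p' c := by
  obtain ⟨C, hC, hle⟩ := F.exists_ampWt_le h1 h2 h3
  exact Cls.mono F.mult_nonneg h hC hle

theorem AmpLE.add (h : F.AmpLE k m n p c) (h' : F.AmpLE k m n p c') : F.AmpLE k m n p (c + c') :=
  Cls.add h h'

theorem AmpLE.sum {τ : Type*} (s : Finset τ) {c : τ → ℕ → E d × E d × E d → ℂ}
    (h : ∀ t ∈ s, F.AmpLE k m n p (c t)) : F.AmpLE k m n p (∑ t ∈ s, c t) :=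
  Cls.sum F.mult_nonneg (fun _ _ => (F.ampWt_pos _ _ _ _ _).le) s h

theorem AmpLE.mul (h : F.AmpLE k m n p c) (h' : F.AmpLE k m' n' p' c') :
    F.AmpLE k (m + m') (n + n') (p + p') (c * c') := by
  have := Cls.mul h h'
  rwa [ampWt_mul] at this

theorem AmpLE.sub (h : F.AmpLE k m n p c) (h' : F.AmpLE k m n p c') : F.AmpLE k m n p (c - c') :=
  Cls.sub F.mult_nonneg h h'

theorem AmpLE.zero : F.AmpLE k m n p 0 :=
  Cls.zero F.mult_nonneg fun _ _ => (F.ampWt_pos _ _ _ _ _).le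

theorem AmpLE.const (z : ℂ) : F.AmpLE k 0 0 0 (fun _ _ => z) := by
  rw [AmpLE, ampWt_zero]
  exact Cls.const F.mult_nonneg z

theorem AmpLE.of_eq (h : F.AmpLE k m n p c) (hm : m = m') (hn : n = n') (hp : p = p') :
    F.AmpLE k m' n' p' c := by
  subst hm hn hp
  exact h

/-- To bound words of length `k + 1`, bound the first derivatives. -/
theorem ampLE_succ (h0 : SmoothBdd (F.ampWt m n p) c)
    (hgood : ∀ i, F.AmpLE k m n p (along (F.field (.good i)) c))
    (hEta : ∀ j, F.AmpLE k m (n - 1) p (along (F.field (.dEta j)) c))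
    (htrans : F.AmpLE k (m - 1) n p (along (F.field .trans) c))
    (hY : ∀ j, F.AmpLE k (m + 1 / 2) n p (along (F.field (.dY j)) c)) :
    F.AmpLE (k + 1) m n p c := by
  refine ⟨h0, fun j => ?_⟩
  cases j with
  | good i =>
    simp only [mult, ampWt_mul]
    exact (hgood i).of_eq (by ring) (by ring) (by ring)
  | dEta i =>
    simp only [mult, ampWt_mul]
    exact (hEta i).of_eq (by ring) (by ring) (by ring)
  | trans =>
    simp only [mult, ampWt_mul]
    exact htrans.of_eq (by ring) (by ring) (by ring)
  | dY i =>
    simp only [mult, ampWt_mul]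
    exact (hY i).of_eq (by ring) (by ring) (by ring)

theorem AmpLE.smoothBdd (h : F.AmpLE k m n p c) : SmoothBdd (F.ampWt m n p) c :=
  Cls.smoothBdd h

theorem Amp.good (h : F.Amp m n p c) (i : Fin (d + 1)) :
    F.Amp m n p (along (F.field (.good i)) c) := fun k => by
  have := (h (k + 1)).along (.good i)
  simp only [mult, ampWt_mul] at this
  exact AmpLE.of_eq this (by ring) (by ring) (by ring)

theorem Amp.dEta (h : F.Amp m n p c) (i : Fin (d + 1)) :
    F.Amp m (n - 1) p (along (F.field (.dEta i)) c) := fun k => by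
  have := (h (k + 1)).along (.dEta i)
  simp only [mult, ampWt_mul] at this
  exact AmpLE.of_eq this (by ring) (by ring) (by ring)

theorem Amp.trans (h : F.Amp m n p c) :
    F.Amp (m - 1) n p (along (F.field .trans) c) := fun k => by
  have := (h (k + 1)).along .trans
  simp only [mult, ampWt_mul] at this
  exact AmpLE.of_eq this (by ring) (by ring) (by ring)

theorem Amp.dY (h : F.Amp m n p c) (i : Fin (d + 1)) :
    F.Amp (m + 1 / 2) n p (along (F.field (.dY i)) c) := fun k => by
  have := (h (k + 1)).along (.dY i)
  simp only [mult, ampWt_mul] at this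
  exact AmpLE.of_eq this (by ring) (by ring) (by ring)

theorem fderiv_comp_fst {g : E d → ℂ} (hg : Differentiable ℝ g) (v t : E d × E d × E d) :
    fderiv ℝ (fun v : E d × E d × E d => g v.1) v t = fderiv ℝ g v.1 t.1 := by
  have h := (hg v.1).hasFDerivAt.comp v (hasFDerivAt_fst (𝕜 := ℝ) (p := v))
  change fderiv ℝ (g ∘ Prod.fst) v t = _
  rw [h.fderiv]
  rfl

theorem fderiv_comp_snd {W : Type*} [NormedAddCommGroup W] [NormedSpace ℝ W] {g : W → ℂ}
    (hg : Differentiable ℝ g) (v t : E d × W) :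
    fderiv ℝ (fun v : E d × W => g v.2) v t = fderiv ℝ g v.2 t.2 := by
  have h := (hg v.2).hasFDerivAt.comp v (hasFDerivAt_snd (𝕜 := ℝ) (p := v))
  change fderiv ℝ (g ∘ Prod.snd) v t = _
  rw [h.fderiv]
  rfl

theorem fderiv_comp_fst' {W : Type*} [NormedAddCommGroup W] [NormedSpace ℝ W] {g : E d → ℂ}
    (hg : Differentiable ℝ g) (v t : E d × W) :
    fderiv ℝ (fun v : E d × W => g v.1) v t = fderiv ℝ g v.1 t.1 := by
  have h := (hg v.1).hasFDerivAt.comp v (hasFDerivAt_fst (𝕜 := ℝ) (p := v))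
  change fderiv ℝ (g ∘ Prod.fst) v t = _
  rw [h.fderiv]
  rfl

theorem fderiv_comp_snd_fst {g : E d → ℂ} (hg : Differentiable ℝ g) (v t : E d × E d × E d) :
    fderiv ℝ (fun v : E d × E d × E d => g v.2.1) v t = fderiv ℝ g v.2.1 t.2.1 := by
  have h : Differentiable ℝ fun w : E d × E d => g w.1 := hg.comp differentiable_fst
  rw [fderiv_comp_snd h, fderiv_comp_fst' hg]

theorem fderiv_comp_snd_snd {g : E d → ℂ} (hg : Differentiable ℝ g) (v t : E d × E d × E d) :
    fderiv ℝ (fun v : E d × E d × E d => g v.2.2) v t = fderiv ℝ g v.2.2 t.2.2 := by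
  have h : Differentiable ℝ fun w : E d × E d => g w.2 := hg.comp differentiable_snd
  rw [fderiv_comp_snd h, fderiv_comp_snd hg]

theorem ofReal_differentiable {V : Type*} [NormedAddCommGroup V] [NormedSpace ℝ V] {f : V → ℝ}
    (hf : Differentiable ℝ f) : Differentiable ℝ fun x => (f x : ℂ) :=
  Complex.ofRealCLM.differentiable.comp hf

theorem ofReal_contDiff {V : Type*} [NormedAddCommGroup V] [NormedSpace ℝ V] {f : V → ℝ}
    (hf : ContDiff ℝ ∞ f) : ContDiff ℝ ∞ fun x => (f x : ℂ) :=
  Complex.ofRealCLM.contDiff.comp hf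

variable (F) in
-- Only the good fields move x, so all other derivatives vanish.
theorem ampLE_comp_fst {f : E d → ℝ} (hf : BddSmooth f) (k : ℕ) :
    F.AmpLE k 0 0 0 (fun _ v => (f v.1 : ℂ)) := by
  have h0 : ∀ {f : E d → ℝ}, BddSmooth f →
      SmoothBdd (F.ampWt 0 0 0) (fun _ v => (f v.1 : ℂ)) := by
    intro f hf
    obtain ⟨C, hC, h⟩ := (hf 0).smoothBdd.2
    refine ⟨fun _ => ofReal_contDiff (hf.contDiff.comp contDiff_fst), C, hC, fun i v => ?_⟩
    rw [ampWt_zero]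
    exact h () v.1
  have hd : ∀ X : E d × E d × E d → E d × E d × E d, ∀ {f : E d → ℝ}, BddSmooth f →
      along X (fun (_ : ℕ) v => (f v.1 : ℂ)) = fun _ v => ((fderiv ℝ f v.1 (X v).1 : ℝ) : ℂ) := by
    intro X f hf
    funext i v
    rw [along, fderiv_comp_fst (g := fun x => (f x : ℂ)) (ofReal_differentiable hf.differentiable),
      fderiv_ofReal_comp (hf.differentiable _)]
  induction k generalizing f with
  | zero => exact h0 hf
  | succ k ih =>
    refine ampLE_succ (h0 hf) (fun i => ?_) (fun i => ?_) ?_ (fun i => ?_) <;>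
      rw [hd _ hf] <;> simp only [field, map_zero, Complex.ofReal_zero]
    exacts [ih (hf.fderiv i), AmpLE.zero, AmpLE.zero, AmpLE.zero]

variable (F) in
theorem along_comp_mid {f : E d → ℝ} (hf : BddSmooth f)
    (X : E d × E d × E d → E d × E d × E d) :
    along X (fun (_ : ℕ) v => (f v.2.1 : ℂ))
      = fun _ v => ((fderiv ℝ f v.2.1 (X v).2.1 : ℝ) : ℂ) := by
  funext i v
  rw [along, fderiv_comp_snd_fst (g := fun x => (f x : ℂ))
    (ofReal_differentiable hf.differentiable), fderiv_ofReal_comp (hf.differentiable _)]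

variable (F) in
theorem ampLE_comp_mid {f : E d → ℝ} (hf : BddSmooth f) (k : ℕ) :
    F.AmpLE k 0 0 0 (fun _ v => (f v.2.1 : ℂ)) := by
  have h0 : ∀ {f : E d → ℝ}, BddSmooth f →
      SmoothBdd (F.ampWt 0 0 0) (fun _ v => (f v.2.1 : ℂ)) := by
    intro f hf
    obtain ⟨C, hC, h⟩ := (hf 0).smoothBdd.2
    refine ⟨fun _ => ofReal_contDiff (hf.contDiff.comp (contDiff_fst.comp contDiff_snd)), C, hC,
      fun i v => ?_⟩
    rw [ampWt_zero]
    exact h () v.2.1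
  induction k generalizing f with
  | zero => exact h0 hf
  | succ k ih =>
    refine ampLE_succ (h0 hf) (fun i => ?_) (fun i => ?_) ?_ (fun i => ?_) <;>
      rw [along_comp_mid hf] <;> simp only [field, map_zero, Complex.ofReal_zero]
    exacts [ih (hf.fderiv i), AmpLE.zero, AmpLE.zero,
      (ih (hf.fderiv i)).mono (by norm_num) (by norm_num) le_rfl]

variable (F) in
-- A Lipschitz bound gives |f(x)-f(y)| ≤ C|x-y| ≤ C(1+|η|)^{-1/2} times the separation weight: half
-- an order is gained for one power of that weight. The gain survives differentiation because a good
-- field has equal x- and y-components, so it produces a difference of the same kind; ∂_y destroys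
-- the difference, but it is allowed to cost exactly the half order.
theorem ampLE_diff {f : E d → ℝ} (hf : BddSmooth f) (k : ℕ) :
    F.AmpLE k (-(1 / 2)) 0 1 ((fun _ v => (f v.1 : ℂ)) - fun _ v => (f v.2.1 : ℂ)) := by
  have h0 : ∀ {f : E d → ℝ}, BddSmooth f → SmoothBdd (F.ampWt (-(1 / 2)) 0 1)
      ((fun _ v => (f v.1 : ℂ)) - fun _ v => (f v.2.1 : ℂ)) := by
    intro f hf
    obtain ⟨C, hC, h⟩ := hf.lipschitz
    refine ⟨fun _ => (ofReal_contDiff (hf.contDiff.comp contDiff_fst)).sub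
      (ofReal_contDiff (hf.contDiff.comp (contDiff_fst.comp contDiff_snd))), C, hC, fun i v => ?_⟩
    simp only [Pi.sub_apply, ampWt, symWt, Real.rpow_zero, mul_one, Real.rpow_one]
    rw [← Complex.ofReal_sub, Complex.norm_real]
    refine (h _ _).trans (mul_le_mul_of_nonneg_left ?_ hC)
    have hp := one_add_norm_pos v.2.2
    rw [Real.rpow_neg hp.le, ← Real.sqrt_eq_rpow, sepWt, ← div_eq_inv_mul,
      le_div_iff₀ (Real.sqrt_pos.mpr hp)]
    linarith
  have hd : ∀ {f : E d → ℝ}, BddSmooth f → ∀ X : E d × E d × E d → E d × E d × E d, along X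
      ((fun (_ : ℕ) v => (f v.1 : ℂ)) - fun _ v => (f v.2.1 : ℂ))
        = (fun _ v => ((fderiv ℝ f v.1 (X v).1 : ℝ) : ℂ))
          - fun _ v => ((fderiv ℝ f v.2.1 (X v).2.1 : ℝ) : ℂ) := by
    intro f hf X
    have hf' := ofReal_differentiable hf.differentiable
    funext i v
    simp only [along, Pi.sub_apply]
    rw [fderiv_sub (by exact (hf'.comp differentiable_fst) v)
      (by exact (hf'.comp (differentiable_fst.comp differentiable_snd)) v)]
    simp only [sub_apply]
    rw [fderiv_comp_fst (g := fun x => (f x : ℂ)) hf',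
      fderiv_comp_snd_fst (g := fun x => (f x : ℂ)) hf',
      fderiv_ofReal_comp (hf.differentiable _), fderiv_ofReal_comp (hf.differentiable _)]
  induction k generalizing f with
  | zero => exact h0 hf
  | succ k ih =>
    refine ampLE_succ (h0 hf) (fun i => ?_) (fun i => ?_) ?_ (fun i => ?_) <;>
      rw [hd hf _] <;> simp only [field, map_zero, Complex.ofReal_zero]
    · exact ih (hf.fderiv i)
    · rw [sub_self]; exact AmpLE.zero
    · rw [sub_self]; exact AmpLE.zero
    · exact AmpLE.sub ((AmpLE.const 0).mono (by norm_num) (by norm_num) zero_le_one)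
        ((F.ampLE_comp_mid (hf.fderiv i) k).mono (by norm_num) (by norm_num) zero_le_one)

/-- The coordinate functions `η_l` as amplitudes. -/
def etaCoord (l : Fin (d + 1)) : ℕ → E d × E d × E d → ℂ := fun _ v => (v.2.2 l : ℂ)

theorem coord_differentiable (l : Fin (d + 1)) : Differentiable ℝ fun η : E d => η l :=
  (EuclideanSpace.proj (𝕜 := ℝ) l).differentiable

theorem fderiv_coord (l : Fin (d + 1)) (η t : E d) : fderiv ℝ (fun η : E d => η l) η t = t l := by
  rw [show (fun η : E d => η l) = (EuclideanSpace.proj (𝕜 := ℝ) l : E d → ℝ) from rfl,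
    ContinuousLinearMap.fderiv]
  rfl

theorem along_etaCoord (l : Fin (d + 1)) (X : E d × E d × E d → E d × E d × E d) :
    along X (etaCoord l) = fun _ v => ((X v).2.2 l : ℂ) := by
  funext i v
  change fderiv ℝ (fun v : E d × E d × E d => (v.2.2 l : ℂ)) v (X v) = _
  rw [fderiv_comp_snd_snd (g := fun η : E d => (η l : ℂ))
    (ofReal_differentiable (coord_differentiable l)),
    fderiv_ofReal_comp (coord_differentiable l _), fderiv_coord]

theorem etaCoord_contDiff (l : Fin (d + 1)) (i : ℕ) : ContDiff ℝ ∞ (etaCoord l i) :=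
  ofReal_contDiff ((EuclideanSpace.proj (𝕜 := ℝ) l).contDiff.comp
    (contDiff_snd.comp contDiff_snd))

variable (F) in
-- D_i acts on η by a matrix with bounded smooth entries, so it keeps order (1,0). The derivatives
-- in η are constants of order (0,0), which fit into the required order (1,-1) because `F.wt` is at
-- most a multiple of 1+|η|.
theorem ampLE_etaCoord (l : Fin (d + 1)) (k : ℕ) : F.AmpLE k 1 0 0 (etaCoord l) := by
  have h0 : ∀ l, SmoothBdd (F.ampWt 1 0 0) (etaCoord l) := by
    intro l
    refine ⟨etaCoord_contDiff l, 1, zero_le_one, fun i v => ?_⟩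
    simp only [ampWt, symWt, Real.rpow_zero, mul_one, Real.rpow_one, one_mul, etaCoord]
    have := PiLp.norm_apply_le v.2.2 l
    rw [Complex.norm_real]
    linarith
  induction k generalizing l with
  | zero => exact h0 l
  | succ k ih =>
    refine ampLE_succ (h0 l) (fun i => ?_) (fun i => ?_) ?_ (fun i => ?_) <;>
      rw [along_etaCoord] <;> simp only [field]
    · have : (fun (_ : ℕ) (v : E d × E d × E d) => ((F.LVec i v.2.1 v.2.2 l : ℝ) : ℂ))
          = ∑ q, (fun _ v => (F.L i l q v.2.1 : ℂ)) * etaCoord q := by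
        funext _ v
        simp [LVec, etaCoord]
      rw [this]
      exact AmpLE.sum _ fun q _ => ((F.ampLE_comp_mid (F.bddSmooth_L i l q) k).mul (ih q)).of_eq
        (by ring) (by ring) (by ring)
    · exact (AmpLE.const _).mono (by norm_num) (by norm_num) le_rfl
    · exact (F.ampLE_comp_mid (F.bddSmooth_B l (Fin.last d)) k).of_eq (by ring) rfl rfl
    · exact (AmpLE.const _).mono (by norm_num) (by norm_num) le_rfl

end AdaptedFrame

end Amplitudes

/-! ### Commutators of D_i, D_ξ and ∂_ξ; symbols viewed as amplitudes. -/

section Symbols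

variable {d : ℕ}

/-- The derivative of a function along a vector field. -/
def lie {V : Type*} [NormedAddCommGroup V] [NormedSpace ℝ V] (Z : V → V) (h : V → ℂ) : V → ℂ :=
  fun p => fderiv ℝ h p (Z p)

section Lie

variable {V : Type*} [NormedAddCommGroup V] [NormedSpace ℝ V] {Z Y : V → V} {h g : V → ℂ}

theorem contDiff_lie (hZ : ContDiff ℝ ∞ Z) (hh : ContDiff ℝ ∞ h) : ContDiff ℝ ∞ (lie Z h) :=
  (hh.fderiv_right (by simp)).clm_apply hZ

theorem lie_add (hh : Differentiable ℝ h) (hg : Differentiable ℝ g) :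
    lie Z (h + g) = lie Z h + lie Z g := by
  funext p
  simp only [lie, Pi.add_apply]
  rw [fderiv_add (hh p) (hg p)]
  rfl

theorem lie_mul (hh : Differentiable ℝ h) (hg : Differentiable ℝ g) :
    lie Z (h * g) = lie Z h * g + h * lie Z g := by
  funext p
  simp only [lie, Pi.add_apply, Pi.mul_apply]
  rw [fderiv_mul (hh p) (hg p)]
  simp only [add_apply, smul_apply, smul_eq_mul]
  ring

theorem lie_lie (hh : ContDiff ℝ ∞ h) (hY : Differentiable ℝ Y) (p : V) :
    lie Z (lie Y h) p = fderiv ℝ (fderiv ℝ h) p (Z p) (Y p) + fderiv ℝ h p (fderiv ℝ Y p (Z p)) := by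
  have h1 : DifferentiableAt ℝ (fderiv ℝ h) p :=
    (hh.fderiv_right (m := ∞) (by simp)).differentiable (by simp) p
  change fderiv ℝ (fun q => fderiv ℝ h q (Y q)) p (Z p) = _
  rw [fderiv_clm_apply h1 (hY p)]
  simp [add_comm]

/-- The second-order terms cancel by symmetry of the second derivative; what remains is the bracket
of the fields. -/
theorem lie_comm (hh : ContDiff ℝ ∞ h) (hZ : Differentiable ℝ Z) (hY : Differentiable ℝ Y) (p : V) :
    lie Z (lie Y h) p
      = lie Y (lie Z h) p + fderiv ℝ h p (fderiv ℝ Y p (Z p) - fderiv ℝ Z p (Y p)) := by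
  rw [lie_lie hh hY, lie_lie hh hZ, map_sub]
  have := (hh.contDiffAt (x := p)).isSymmSndFDerivAt
    (by simpa using WithTop.coe_le_coe.mpr (le_top : (2 : ℕ∞) ≤ ⊤)) (Z p) (Y p)
  rw [this]
  ring

end Lie

/-- The coordinate vector fields `∂/∂ξ_j`. -/
def xiField (j : Fin (d + 1)) : E d × E d → E d × E d := fun _ => (0, coordVec j)

theorem contDiff_xiField (j : Fin (d + 1)) : ContDiff ℝ ∞ (xiField (d := d) j) := contDiff_const

theorem clm_zero_prod (T : E d × E d →L[ℝ] ℂ) (t : E d) :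
    T (0, t) = ∑ k, (t k : ℂ) * T (0, coordVec k) := by
  have hv : t = ∑ j, t j • (coordVec j : E d) := by
    ext i
    simp [coordVec, Pi.single_apply]
  have h2 : T (0, t) = (T.comp (ContinuousLinearMap.inr ℝ (E d) (E d))) t := by simp
  rw [h2]
  conv_lhs => rw [hv]
  rw [map_sum]
  refine Finset.sum_congr rfl fun k _ => ?_
  rw [map_smul, Complex.real_smul]
  simp

theorem contDiff_toLp {V : Type*} [NormedAddCommGroup V] [NormedSpace ℝ V] {f : V → Fin (d + 1) → ℝ}
    (hf : ∀ k, ContDiff ℝ ∞ fun x => f x k) :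
    ContDiff ℝ ∞ fun x => (WithLp.toLp 2 (f x) : E d) := by
  rw [contDiff_euclidean]
  exact hf

namespace AdaptedFrame

variable {D : E d → Submodule ℝ (E d)} (F : AdaptedFrame D)

/-- The vector field `D_i`. -/
def goodField (i : Fin (d + 1)) : E d × E d → E d × E d := fun p => (coordVec i, F.LVec i p.1 p.2)

/-- The vector field `D_ξ`. -/
def transField : E d × E d → E d × E d := fun p => (0, F.BVec p.1)

theorem contDiff_goodField (i : Fin (d + 1)) : ContDiff ℝ ∞ (F.goodField i) :=
  contDiff_const.prodMk <| contDiff_toLp fun k => ContDiff.sum fun l _ =>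
    ((F.bddSmooth_L i k l).contDiff.comp contDiff_fst).mul
      ((EuclideanSpace.proj (𝕜 := ℝ) l).contDiff.comp contDiff_snd)

theorem contDiff_BVec : ContDiff ℝ ∞ F.BVec :=
  contDiff_toLp fun k => (F.bddSmooth_B k (Fin.last d)).contDiff

theorem contDiff_transField : ContDiff ℝ ∞ F.transField :=
  contDiff_const.prodMk (F.contDiff_BVec.comp contDiff_fst)

theorem LVec_eq (i : Fin (d + 1)) (x ξ : E d) :
    F.LVec i x ξ = ∑ l, ξ l • (WithLp.toLp 2 fun k => F.L i k l x : E d) := by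
  ext k
  simp [LVec, mul_comm]

theorem LVec_coordVec (i j k : Fin (d + 1)) (x : E d) : F.LVec i x (coordVec j) k = F.L i k j x := by
  simp [LVec, coordVec]

theorem LVec_linear (i : Fin (d + 1)) (x : E d) : ∃ T : E d →L[ℝ] E d, ∀ ξ, T ξ = F.LVec i x ξ := by
  refine ⟨∑ l, (EuclideanSpace.proj (𝕜 := ℝ) l).smulRight
    (WithLp.toLp 2 fun k => F.L i k l x : E d), fun ξ => ?_⟩
  rw [LVec_eq]
  simp

theorem A_mul_B (x : E d) : F.A x * F.B x = 1 := by
  obtain ⟨c, hc, h⟩ := F.det_bound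
  refine Matrix.mul_nonsing_inv _ (isUnit_iff_ne_zero.mpr fun h0 => ?_)
  have h2 := h x
  change c ≤ |(F.A x).det| at h2
  rw [h0, abs_zero] at h2
  linarith

/-- The matrix of `F.LVec i` is (∂_i B)A, and AB = 1, so applying it to the last column of B returns
the derivative of that column. This identity is the reason for the form of D_i. -/
theorem LVec_BVec (i : Fin (d + 1)) (x : E d) :
    F.LVec i x (F.BVec x) = fderiv ℝ F.BVec x (coordVec i) := by
  ext k
  have h1 : fderiv ℝ F.BVec x (coordVec i) k
      = fderiv ℝ (fun y => F.B y k (Fin.last d)) x (coordVec i) := by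
    have h := (EuclideanSpace.proj (𝕜 := ℝ) k).hasFDerivAt.comp x
      (F.contDiff_BVec.differentiable (by simp) x).hasFDerivAt
    have h' : fderiv ℝ (fun y => F.B y k (Fin.last d)) x = _ := h.fderiv
    rw [h']
    rfl
  rw [h1]
  simp only [LVec, L, BVec, Finset.sum_mul]
  rw [Finset.sum_comm]
  have h2 : ∀ p, ∑ l, F.A x p l * F.B x l (Fin.last d) = if p = Fin.last d then 1 else 0 :=
    fun p => by
      rw [← Matrix.mul_apply, A_mul_B, Matrix.one_apply]
  simp_rw [mul_assoc, ← Finset.mul_sum, h2]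
  simp

/-- D_i is linear in ξ along the fibres. Vertical directions are enough, since D_ξ and ∂_ξ, with
which D_i is to be commuted, have no x-component. -/
theorem fderiv_goodField_zero (i : Fin (d + 1)) (p : E d × E d) (t : E d) :
    fderiv ℝ (F.goodField i) p (0, t) = (0, F.LVec i p.1 t) := by
  obtain ⟨T, hT⟩ := F.LVec_linear i p.1
  have hd := ((F.contDiff_goodField i).differentiable (by simp) p).hasFDerivAt
  have hin : HasFDerivAt (fun ξ : E d => (p.1, ξ)) (ContinuousLinearMap.inr ℝ (E d) (E d)) p.2 :=
    hasFDerivAt_prodMk_right p.1 p.2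
  have h1 := (show HasFDerivAt (F.goodField i) _ (p.1, p.2) from hd).comp p.2 hin
  have h2 : HasFDerivAt (fun ξ : E d => ((coordVec i, T ξ) : E d × E d))
      ((0 : E d →L[ℝ] E d).prod T) p.2 :=
    (hasFDerivAt_const (coordVec i) p.2).prodMk T.hasFDerivAt
  have h3 : (F.goodField i ∘ fun ξ : E d => (p.1, ξ)) = fun ξ => (coordVec i, T ξ) := by
    funext ξ
    simp [goodField, hT]
  rw [h3] at h1
  have h4 := congrArg (fun S => S t) (h1.unique h2)
  simpa [hT] using h4

theorem fderiv_transField (p t : E d × E d) :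
    fderiv ℝ F.transField p t = (0, fderiv ℝ F.BVec p.1 t.1) := by
  have h := (hasFDerivAt_const (0 : E d) p).prodMk
    ((F.contDiff_BVec.differentiable (by simp) p.1).hasFDerivAt.comp p
      (hasFDerivAt_fst (𝕜 := ℝ) (p := p)))
  have h' : fderiv ℝ F.transField p = _ := h.fderiv
  rw [h']
  simp

variable {h : E d × E d → ℂ}

theorem fderiv_xiField (j : Fin (d + 1)) (p : E d × E d) :
    fderiv ℝ (xiField (d := d) j) p = 0 := by
  change fderiv ℝ (fun _ : E d × E d => ((0 : E d), (coordVec j : E d))) p = 0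
  simp

theorem lie_trans_xi (hh : ContDiff ℝ ∞ h) (j : Fin (d + 1)) :
    lie F.transField (lie (xiField j) h) = lie (xiField j) (lie F.transField h) := by
  funext p
  rw [lie_comm hh (F.contDiff_transField.differentiable (by simp))
    ((contDiff_xiField j).differentiable (by simp)), fderiv_transField, fderiv_xiField]
  simp [xiField, Prod.mk_zero_zero]

/-- The bracket is vertical, with component ∂_i B^N - L_i B^N, and this vanishes by `LVec_BVec`. -/
theorem lie_good_trans (hh : ContDiff ℝ ∞ h) (i : Fin (d + 1)) :
    lie (F.goodField i) (lie F.transField h) = lie F.transField (lie (F.goodField i) h) := by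
  funext p
  rw [lie_comm hh ((F.contDiff_goodField i).differentiable (by simp))
    (F.contDiff_transField.differentiable (by simp)), fderiv_transField,
    show F.transField p = (0, F.BVec p.1) from rfl, fderiv_goodField_zero, LVec_BVec]
  simp [goodField]

theorem lie_good_xi (hh : ContDiff ℝ ∞ h) (i j : Fin (d + 1)) :
    lie (F.goodField i) (lie (xiField j) h) = lie (xiField j) (lie (F.goodField i) h)
      + ∑ k, (fun p => ((-F.L i k j p.1 : ℝ) : ℂ)) * lie (xiField k) h := by
  funext p
  rw [lie_comm hh ((F.contDiff_goodField i).differentiable (by simp))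
    ((contDiff_xiField j).differentiable (by simp)),
    show xiField j p = (0, coordVec j) from rfl, fderiv_goodField_zero, fderiv_xiField]
  simp only [zero_apply, zero_sub, Prod.neg_mk, neg_zero, Pi.add_apply, Finset.sum_apply,
    Pi.mul_apply]
  rw [clm_zero_prod]
  simp [lie, xiField, LVec_coordVec]

/-- Iterated derivatives in `ξ`. -/
def xiList (α : List (Fin (d + 1))) (h : E d × E d → ℂ) : E d × E d → ℂ :=
  α.foldr (fun j => lie (xiField j)) h

theorem contDiff_xiList (hh : ContDiff ℝ ∞ h) (α : List (Fin (d + 1))) :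
    ContDiff ℝ ∞ (xiList α h) := by
  induction α with
  | nil => exact hh
  | cons j α ih => exact contDiff_lie (contDiff_xiField j) ih

theorem contDiff_transIter (hh : ContDiff ℝ ∞ h) (β : ℕ) :
    ContDiff ℝ ∞ ((lie F.transField)^[β] h) := by
  induction β with
  | zero => exact hh
  | succ β ih =>
    rw [Function.iterate_succ_apply']
    exact contDiff_lie F.contDiff_transField ih

/-- Iterated good derivatives `D^I`. -/
def goodList (I : List (Fin (d + 1))) (h : E d × E d → ℂ) : E d × E d → ℂ :=
  I.foldr (fun i => lie (F.goodField i)) h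

theorem contDiff_goodList (hh : ContDiff ℝ ∞ h) (I : List (Fin (d + 1))) :
    ContDiff ℝ ∞ (F.goodList I h) := by
  induction I with
  | nil => exact hh
  | cons j α ih => exact contDiff_lie (F.contDiff_goodField j) ih

theorem _root_.ContDiff.diff_top {V W : Type*} [NormedAddCommGroup V] [NormedSpace ℝ V]
    [NormedAddCommGroup W] [NormedSpace ℝ W] {f : V → W}
    (hf : ContDiff ℝ ∞ f) : Differentiable ℝ f := hf.differentiable (by simp)

/-- The bounds of `S^{m,n}` for the derivatives `∂_ξ^α D_ξ^β`. -/
def XiBounds (m n : ℝ) (h : E d × E d → ℂ) : Prop :=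
  ContDiff ℝ ∞ h ∧ ∀ (α : List (Fin (d + 1))) (β : ℕ), ∃ C : ℝ, ∀ x ξ : E d,
    ‖xiList α ((lie F.transField)^[β] h) (x, ξ)‖ ≤
      C * (1 + ‖ξ‖) ^ (m - (β : ℝ)) * F.wt x ξ ^ (n - (α.length : ℝ))

variable {F} {m n : ℝ} {g : E d × E d → ℂ}

theorem XiBounds.add (hh : F.XiBounds m n h) (hg : F.XiBounds m n g) : F.XiBounds m n (h + g) := by
  refine ⟨hh.1.add hg.1, fun α β => ?_⟩
  obtain ⟨C, hC⟩ := hh.2 α β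
  obtain ⟨C', hC'⟩ := hg.2 α β
  have h1 : (lie F.transField)^[β] (h + g)
      = (lie F.transField)^[β] h + (lie F.transField)^[β] g := by
    clear hC hC'
    induction β with
    | zero => rfl
    | succ β ih =>
      rw [Function.iterate_succ_apply', ih, lie_add (F.contDiff_transIter hh.1 β).diff_top
        (F.contDiff_transIter hg.1 β).diff_top, Function.iterate_succ_apply',
        Function.iterate_succ_apply']
  have h2 : ∀ {h g : E d × E d → ℂ}, ContDiff ℝ ∞ h → ContDiff ℝ ∞ g →
      xiList α (h + g) = xiList α h + xiList α g := by
    intro h g hh hg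
    clear hC hC'
    induction α with
    | nil => rfl
    | cons j α ih =>
      change lie _ (xiList α (h + g)) = _
      rw [ih, lie_add (contDiff_xiList hh α).diff_top (contDiff_xiList hg α).diff_top]
      rfl
  refine ⟨C + C', fun x ξ => ?_⟩
  rw [h1, h2 (F.contDiff_transIter hh.1 β) (F.contDiff_transIter hg.1 β), add_mul, add_mul]
  exact (norm_add_le _ _).trans (add_le_add (hC x ξ) (hC' x ξ))

theorem XiBounds.zero : F.XiBounds m n 0 := by
  refine ⟨contDiff_const, fun α β => ⟨0, fun x ξ => ?_⟩⟩
  have h0 : ∀ Z : E d × E d → E d × E d, lie Z (0 : E d × E d → ℂ) = 0 := fun Z => by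
    funext p
    simp [lie, show (0 : E d × E d → ℂ) = fun _ => 0 from rfl]
  have h1 : (lie F.transField)^[β] (0 : E d × E d → ℂ) = 0 := Function.iterate_fixed (h0 _) β
  have h2 : xiList α (0 : E d × E d → ℂ) = 0 := by
    induction α with
    | nil => rfl
    | cons j α ih =>
      change lie _ (xiList α 0) = _
      rw [ih, h0]
  rw [h1, h2]
  simp

theorem XiBounds.sum {τ : Type*} (s : Finset τ) {h : τ → E d × E d → ℂ}
    (hh : ∀ t ∈ s, F.XiBounds m n (h t)) : F.XiBounds m n (∑ t ∈ s, h t) := by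
  classical
  induction s using Finset.induction_on with
  | empty => simpa using XiBounds.zero
  | insert a s ha ih =>
    rw [Finset.sum_insert ha]
    exact (hh a (Finset.mem_insert_self _ _)).add
      (ih fun t ht => hh t (Finset.mem_insert_of_mem ht))

theorem lie_mul_left {f : E d → ℝ} (hf : BddSmooth f) (hh : ContDiff ℝ ∞ h)
    (Z : E d × E d → E d × E d) :
    lie Z ((fun p => (f p.1 : ℂ)) * h)
      = (fun p => ((fderiv ℝ f p.1 (Z p).1 : ℝ) : ℂ)) * h + (fun p => (f p.1 : ℂ)) * lie Z h := by
  have hf' := ofReal_differentiable hf.differentiable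
  rw [lie_mul (by exact hf'.comp differentiable_fst) hh.diff_top]
  congr 2
  funext p
  rw [lie, fderiv_comp_fst' (g := fun x => (f x : ℂ)) hf', fderiv_ofReal_comp
    (hf.differentiable _)]

/-- ∂_ξ and D_ξ do not move x, so they treat the factor f(x) as a constant. -/
theorem XiBounds.mul_left {f : E d → ℝ} (hf : BddSmooth f) (hh : F.XiBounds m n h) :
    F.XiBounds m n ((fun p => (f p.1 : ℂ)) * h) := by
  refine ⟨(ofReal_contDiff (hf.contDiff.comp contDiff_fst)).mul hh.1, fun α β => ?_⟩
  obtain ⟨C, hC⟩ := hh.2 α β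
  obtain ⟨C', hC'0, hC'⟩ := (hf 0).smoothBdd.2
  have h0 : ∀ {h : E d × E d → ℂ} {Z : E d × E d → E d × E d}, ContDiff ℝ ∞ h →
      (∀ p, (Z p).1 = 0) →
      lie Z ((fun p => (f p.1 : ℂ)) * h) = (fun p => (f p.1 : ℂ)) * lie Z h := by
    intro h Z hh hZ
    rw [lie_mul_left hf hh]
    funext p
    simp [hZ]
  have h1 : (lie F.transField)^[β] ((fun p => (f p.1 : ℂ)) * h)
      = (fun p => (f p.1 : ℂ)) * (lie F.transField)^[β] h := by
    clear hC
    induction β with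
    | zero => rfl
    | succ β ih =>
      rw [Function.iterate_succ_apply', ih, h0 (F.contDiff_transIter hh.1 β) (fun _ => rfl),
        Function.iterate_succ_apply']
  have h2 : ∀ {h : E d × E d → ℂ}, ContDiff ℝ ∞ h →
      xiList α ((fun p => (f p.1 : ℂ)) * h) = (fun p => (f p.1 : ℂ)) * xiList α h := by
    intro h hh
    clear hC
    induction α with
    | nil => rfl
    | cons j α ih =>
      change lie _ (xiList α _) = _
      rw [ih, h0 (contDiff_xiList hh α) (fun _ => rfl)]
      rfl
  refine ⟨C' * C, fun x ξ => ?_⟩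
  rw [h1, h2 (F.contDiff_transIter hh.1 β), Pi.mul_apply, norm_mul, mul_assoc, mul_assoc,
    ← mul_assoc C]
  refine mul_le_mul (by simpa using hC' () x) (hC x ξ) (norm_nonneg _) hC'0

theorem XiBounds.xi (hh : F.XiBounds m n h) (j : Fin (d + 1)) :
    F.XiBounds m (n - 1) (lie (xiField j) h) := by
  refine ⟨contDiff_lie (contDiff_xiField j) hh.1, fun α β => ?_⟩
  -- `foldr` applies the last entry of a list first, so the new derivative stands innermost among
  -- the ∂_ξ's; it still has to be commuted past the powers of D_ξ.
  obtain ⟨C, hC⟩ := hh.2 (α ++ [j]) β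
  refine ⟨C, fun x ξ => ?_⟩
  have h1 : (lie F.transField)^[β] (lie (xiField j) h)
      = lie (xiField j) ((lie F.transField)^[β] h) := by
    clear hC
    induction β with
    | zero => rfl
    | succ β ih =>
      rw [Function.iterate_succ_apply', ih, lie_trans_xi F (F.contDiff_transIter hh.1 β),
        Function.iterate_succ_apply']
  have h2 := hC x ξ
  rw [h1]
  simp only [xiList, List.foldr_append, List.foldr_cons, List.foldr_nil, List.length_append,
    List.length_singleton, Nat.cast_add, Nat.cast_one] at h2 ⊢
  rwa [show n - 1 - (α.length : ℝ) = n - (α.length + 1) by ring]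

theorem XiBounds.trans (hh : F.XiBounds m n h) : F.XiBounds (m - 1) n (lie F.transField h) := by
  refine ⟨contDiff_lie F.contDiff_transField hh.1, fun α β => ?_⟩
  obtain ⟨C, hC⟩ := hh.2 α (β + 1)
  refine ⟨C, fun x ξ => ?_⟩
  have h2 := hC x ξ
  rw [Function.iterate_succ_apply] at h2
  rwa [show m - 1 - (β : ℝ) = m - ((β + 1 : ℕ) : ℝ) by push_cast; ring]

variable (F) in
/-- The bounds of `S^{m,n}`. -/
def SymBounds (m n : ℝ) (h : E d × E d → ℂ) : Prop := ∀ I, F.XiBounds m n (F.goodList I h)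

theorem SymBounds.xiBounds (hh : F.SymBounds m n h) : F.XiBounds m n h := hh []

theorem SymBounds.contDiff (hh : F.SymBounds m n h) : ContDiff ℝ ∞ h := (hh []).1

theorem SymBounds.good (hh : F.SymBounds m n h) (i : Fin (d + 1)) :
    F.SymBounds m n (lie (F.goodField i) h) := fun I => by
  have := hh (I ++ [i])
  simpa only [goodList, List.foldr_append, List.foldr_cons, List.foldr_nil] using this

theorem SymBounds.trans (hh : F.SymBounds m n h) : F.SymBounds (m - 1) n (lie F.transField h) :=
  fun I => by
    have : F.goodList I (lie F.transField h) = lie F.transField (F.goodList I h) := by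
      induction I with
      | nil => rfl
      | cons i I ih =>
        change lie _ (F.goodList I _) = _
        rw [ih, lie_good_trans F (F.contDiff_goodList hh.contDiff I)]
        rfl
    rw [this]
    exact (hh I).trans

theorem goodList_add (hh : ContDiff ℝ ∞ h) (hg : ContDiff ℝ ∞ g) (I : List (Fin (d + 1))) :
    F.goodList I (h + g) = F.goodList I h + F.goodList I g := by
  induction I with
  | nil => rfl
  | cons i I ih =>
    change lie _ (F.goodList I _) = _
    rw [ih, lie_add (F.contDiff_goodList hh I).diff_top (F.contDiff_goodList hg I).diff_top]
    rfl

theorem goodList_sum {τ : Type*} (s : Finset τ) {h : τ → E d × E d → ℂ}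
    (hh : ∀ t ∈ s, ContDiff ℝ ∞ (h t)) (I : List (Fin (d + 1))) :
    F.goodList I (∑ t ∈ s, h t) = ∑ t ∈ s, F.goodList I (h t) := by
  induction I with
  | nil => rfl
  | cons i I ih =>
    change lie _ (F.goodList I _) = _
    rw [ih]
    funext p
    simp only [lie, Finset.sum_apply]
    rw [fderiv_sum fun t ht => (F.contDiff_goodList (hh t ht) I).diff_top p]
    simp only [FunLike.coe_sum, Finset.sum_apply]
    rfl

/-- This moves a ∂_ξ from the right of D^I to its left. The innermost D_i produces (∂_i f)∂_ξ h, f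
∂_ξ D_i h and terms f L ∂_ξ h. All have the same shape with a shorter word, a new coefficient or a
new symbol, which is why the coefficient is arbitrary and the induction runs from the end of the
list. -/
theorem SymBounds.mul_xi (I : List (Fin (d + 1))) {f : E d → ℝ} (hf : BddSmooth f)
    (hh : F.SymBounds m n h) (j : Fin (d + 1)) :
    F.XiBounds m (n - 1) (F.goodList I ((fun p => (f p.1 : ℂ)) * lie (xiField j) h)) := by
  induction I using List.reverseRecOn generalizing f h j with
  | nil => exact (hh.xiBounds.xi j).mul_left hf
  | append_singleton I i ih =>
    have hs : ∀ k {h : E d × E d → ℂ}, ContDiff ℝ ∞ h → ∀ {f : E d → ℝ}, BddSmooth f →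
        ContDiff ℝ ∞ ((fun p : E d × E d => (f p.1 : ℂ)) * lie (xiField k) h) :=
      fun k h hh f hf => (ofReal_contDiff (hf.contDiff.comp contDiff_fst)).mul
        (contDiff_lie (contDiff_xiField k) hh)
    have e : F.goodList (I ++ [i]) ((fun p => (f p.1 : ℂ)) * lie (xiField j) h)
        = F.goodList I (lie (F.goodField i) ((fun p => (f p.1 : ℂ)) * lie (xiField j) h)) := by
      simp only [goodList, List.foldr_append, List.foldr_cons, List.foldr_nil]
    have hb : ∀ k, BddSmooth fun x => f x * -F.L i k j x := fun k => by
      have := hf.mul ((BddSmooth.const (-1)).mul (F.bddSmooth_L i k j))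
      simpa using this
    have e2 : lie (F.goodField i) ((fun p => (f p.1 : ℂ)) * lie (xiField j) h)
        = (fun p => ((fderiv ℝ f p.1 (coordVec i) : ℝ) : ℂ)) * lie (xiField j) h
          + ((fun p => (f p.1 : ℂ)) * lie (xiField j) (lie (F.goodField i) h)
            + ∑ k, (fun p : E d × E d => ((f p.1 * -F.L i k j p.1 : ℝ) : ℂ))
              * lie (xiField k) h) := by
      rw [lie_mul_left hf (contDiff_lie (contDiff_xiField j) hh.contDiff),
        lie_good_xi F hh.contDiff, mul_add, Finset.mul_sum]
      congr 2
      refine Finset.sum_congr rfl fun k _ => ?_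
      funext p
      simp only [Pi.mul_apply]
      push_cast
      ring
    rw [e, e2]
    have s1 := hs j hh.contDiff (hf.fderiv i)
    have s2 := hs j (hh.good i).contDiff hf
    have s3 : ∀ k ∈ Finset.univ, ContDiff ℝ ∞
        ((fun p : E d × E d => ((f p.1 * -F.L i k j p.1 : ℝ) : ℂ)) * lie (xiField k) h) :=
      fun k _ => hs k hh.contDiff (hb k)
    have s4 := ContDiff.sum s3
    rw [← Finset.sum_fn] at s4
    have s5 : ContDiff ℝ ∞ (((fun p => (f p.1 : ℂ)) * lie (xiField j) (lie (F.goodField i) h))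
        + ∑ k, (fun p : E d × E d => ((f p.1 * -F.L i k j p.1 : ℝ) : ℂ)) * lie (xiField k) h) :=
      s2.add s4
    rw [goodList_add s1 s5, goodList_add s2 s4, goodList_sum _ s3]
    exact (ih (hf.fderiv i) hh j).add ((ih hf (hh.good i) j).add
      (XiBounds.sum _ fun k _ => ih (hb k) hh k))

theorem SymBounds.xi (hh : F.SymBounds m n h) (j : Fin (d + 1)) :
    F.SymBounds m (n - 1) (lie (xiField j) h) := fun I => by
  have := SymBounds.mul_xi I (BddSmooth.const 1) hh j
  convert this using 2
  funext p
  simp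

theorem fderiv_eq_lie_good_sub (h : E d × E d → ℂ) (i : Fin (d + 1)) (p : E d × E d) :
    fderiv ℝ h p (coordVec i, 0) = lie (F.goodField i) h p
      - ∑ k, (F.LVec i p.1 p.2 k : ℂ) * lie (xiField k) h p := by
  have e : (coordVec i, 0) = F.goodField i p - (0, F.LVec i p.1 p.2) := by
    simp [goodField]
  rw [e, map_sub, clm_zero_prod]
  rfl

/-- `SymBounds` is stable under D_i, ∂_ξ and D_ξ, which settles three kinds of letters. For the
plain ∂_y one writes ∂_i = D_i - ∑ (Lη)_k ∂_k; the sum has order (m+1, n-1), which is contained in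
the allowed order (m+1/2, n). -/
theorem SymBounds.ampLE (hh : F.SymBounds m n h) (k : ℕ) : F.AmpLE k m n 0 (fun _ v => h v.2) := by
  have h0 : ∀ {m n : ℝ} {h : E d × E d → ℂ}, F.SymBounds m n h →
      SmoothBdd (F.ampWt m n 0) (fun _ v => h v.2) := by
    intro m n h hh
    obtain ⟨C, hC⟩ := hh.xiBounds.2 [] 0
    refine ⟨fun _ => hh.contDiff.comp contDiff_snd, |C|, abs_nonneg C, fun i v => ?_⟩
    have := hC v.2.1 v.2.2
    simp only [xiList, List.foldr_nil, Function.iterate_zero, id, Nat.cast_zero, sub_zero,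
      List.length_nil, mul_assoc] at this
    simp only [ampWt, Real.rpow_zero, mul_one]
    exact this.trans (mul_le_mul_of_nonneg_right (le_abs_self C) (F.symWt_pos _ _ _ _).le)
  have ha : ∀ {m n : ℝ} {h : E d × E d → ℂ}, F.SymBounds m n h → ∀ Z,
      along Z (fun (_ : ℕ) (v : E d × E d × E d) => h v.2)
        = fun _ v => fderiv ℝ h v.2 (Z v).2 := by
    intro m n h hh Z
    funext _ v
    exact fderiv_comp_snd hh.contDiff.diff_top v _
  induction k generalizing m n h with
  | zero => exact h0 hh
  | succ k ih =>
    refine ampLE_succ (h0 hh) (fun i => ?_) (fun i => ?_) ?_ (fun i => ?_) <;> rw [ha hh]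
    · exact ih (hh.good i)
    · exact ih (hh.xi i)
    · exact ih hh.trans
    · have e : (fun (_ : ℕ) (v : E d × E d × E d) => fderiv ℝ h v.2 (F.field (.dY i) v).2)
          = (fun _ v => lie (F.goodField i) h v.2)
            - ∑ k, (∑ l, (fun _ v => (F.L i k l v.2.1 : ℂ)) * etaCoord l)
              * fun _ v => lie (xiField k) h v.2 := by
        funext _ v
        simp only [field]
        rw [fderiv_eq_lie_good_sub (F := F)]
        simp [LVec, etaCoord]
      rw [e]
      refine AmpLE.sub ((ih (hh.good i)).mono (by linarith) (by linarith) le_rfl)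
        (AmpLE.sum _ fun q _ => ?_)
      exact ((AmpLE.sum _ fun l _ => (F.ampLE_comp_mid (F.bddSmooth_L i q l) k).mul
        (F.ampLE_etaCoord l k)).mul (ih (hh.xi q))).mono (by linarith) (by linarith) (by norm_num)

end AdaptedFrame

end Symbols

/-! ### The coordinate definition of the symbol class in terms of vector fields. -/

section Link

variable {d : ℕ} {D : E d → Submodule ℝ (E d)} {F : AdaptedFrame D} {a : E d → E d → ℂ}

theorem partialXi_eq (ha : Differentiable ℝ fun p : E d × E d => a p.1 p.2) (j : Fin (d + 1))
    (p : E d × E d) :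
    partialXi j a p.1 p.2 = lie (xiField j) (fun p : E d × E d => a p.1 p.2) p := by
  have h := (ha (p.1, p.2)).hasFDerivAt.comp p.2 (hasFDerivAt_prodMk_right p.1 p.2)
  have h' : fderiv ℝ (fun η => a p.1 η) p.2 = _ := h.fderiv
  rw [partialXi, h']
  simp [lie, xiField]

theorem partialX_eq (ha : Differentiable ℝ fun p : E d × E d => a p.1 p.2) (i : Fin (d + 1))
    (p : E d × E d) :
    partialX i a p.1 p.2 = fderiv ℝ (fun p : E d × E d => a p.1 p.2) p (coordVec i, 0) := by
  have h := HasFDerivAt.comp (f := fun y : E d => (y, p.2)) p.1 (ha (p.1, p.2)).hasFDerivAt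
    (hasFDerivAt_prodMk_left p.1 p.2)
  have h' : fderiv ℝ (fun y => a y p.2) p.1 = _ := h.fderiv
  rw [partialX, h']
  simp

namespace AdaptedFrame

theorem goodXi_eq (ha : Differentiable ℝ fun p : E d × E d => a p.1 p.2) (p : E d × E d) :
    F.goodXi a p.1 p.2 = lie F.transField (fun p : E d × E d => a p.1 p.2) p := by
  simp only [goodXi, partialXi_eq ha]
  rw [lie, show F.transField p = (0, F.BVec p.1) from rfl, clm_zero_prod]
  rfl

theorem goodX_eq (ha : Differentiable ℝ fun p : E d × E d => a p.1 p.2) (i : Fin (d + 1))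
    (p : E d × E d) :
    F.goodX i a p.1 p.2 = lie (F.goodField i) (fun p : E d × E d => a p.1 p.2) p := by
  have e : F.goodField i p = (coordVec i, 0) + (0, F.LVec i p.1 p.2) := by simp [goodField]
  rw [goodX, partialX_eq ha, lie, e, map_add, clm_zero_prod]
  congr 1
  refine Finset.sum_congr rfl fun k _ => ?_
  rw [partialXi_eq ha, Finset.sum_comm]
  simp only [← Finset.sum_mul, ← Complex.ofReal_sum]
  rfl

theorem xiList_eq (ha : ContDiff ℝ ∞ fun p : E d × E d => a p.1 p.2) (α : List (Fin (d + 1))) :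
    (fun p : E d × E d => partialXiList α a p.1 p.2) = xiList α fun p => a p.1 p.2 := by
  induction α with
  | nil => rfl
  | cons j α ih =>
    funext p
    have h := contDiff_xiList ha α
    rw [← ih] at h
    change partialXi j (partialXiList α a) p.1 p.2 = lie _ (xiList α _) p
    rw [partialXi_eq h.diff_top, ih]

theorem transIter_eq (ha : ContDiff ℝ ∞ fun p : E d × E d => a p.1 p.2) (β : ℕ) :
    (fun p : E d × E d => F.goodXi^[β] a p.1 p.2) = (lie F.transField)^[β] fun p => a p.1 p.2 := by
  induction β with
  | zero => rfl
  | succ β ih =>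
    funext p
    have h := F.contDiff_transIter ha β
    rw [← ih] at h
    rw [Function.iterate_succ_apply', Function.iterate_succ_apply', goodXi_eq h.diff_top, ih]

theorem goodList_eq (ha : ContDiff ℝ ∞ fun p : E d × E d => a p.1 p.2) (I : List (Fin (d + 1))) :
    (fun p : E d × E d => F.goodXList I a p.1 p.2) = F.goodList I fun p => a p.1 p.2 := by
  induction I with
  | nil => rfl
  | cons i I ih =>
    funext p
    have h := F.contDiff_goodList ha I
    rw [← ih] at h
    change F.goodX i (F.goodXList I a) p.1 p.2 = lie _ (F.goodList I _) p
    rw [goodX_eq h.diff_top, ih]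

/-- The symbol class, described by derivatives along vector fields. -/
theorem mem_symbolClass_iff {m n : ℝ} :
    a ∈ F.symbolClass m n ↔ F.SymBounds m n fun p => a p.1 p.2 := by
  have key : ContDiff ℝ ∞ (fun p : E d × E d => a p.1 p.2) → ∀ α β I (p : E d × E d),
      partialXiList α (F.goodXi^[β] (F.goodXList I a)) p.1 p.2
        = xiList α ((lie F.transField)^[β] (F.goodList I fun p => a p.1 p.2)) p := by
    intro ha α β I p
    have h1 := F.contDiff_goodList ha I
    rw [← goodList_eq ha I] at h1
    have h2 := F.contDiff_transIter h1 β
    rw [← transIter_eq h1 β] at h2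
    rw [← goodList_eq ha I, ← transIter_eq h1 β, ← xiList_eq h2]
  constructor
  · rintro ⟨ha, h⟩ I
    refine ⟨F.contDiff_goodList ha I, fun α β => ?_⟩
    obtain ⟨C, hC⟩ := h α β I
    refine ⟨C, fun x ξ => ?_⟩
    rw [← key ha α β I (x, ξ)]
    exact hC x ξ
  · intro h
    refine ⟨h.contDiff, fun α β I => ?_⟩
    obtain ⟨C, hC⟩ := (h I).2 α β
    refine ⟨C, fun x ξ => ?_⟩
    have := hC x ξ
    rw [← key h.contDiff α β I (x, ξ)] at this
    exact this

end AdaptedFrame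

end Link

/-! ### Rescaled cutoffs, with bounds uniform in the scale. -/

section Cutoff

variable {d : ℕ} {D : E d → Submodule ℝ (E d)} {F : AdaptedFrame D}

/-- The scales `1 / (n + 1)`. -/
def scale (n : ℕ) : ℝ := 1 / ((n : ℝ) + 1)

theorem scale_pos (n : ℕ) : 0 < scale n := by
  rw [scale]
  positivity

theorem scale_le_one (n : ℕ) : scale n ≤ 1 := by
  rw [scale, div_le_one (by positivity)]
  linarith [(Nat.cast_nonneg n : (0 : ℝ) ≤ n)]

/-- Rescaled test functions `ε^r ψ(ε y, ε η)`, `ε = 1 / (n + 1)`. -/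
def scaled (ψ : E d × E d → ℂ) (r : ℕ) : ℕ → E d × E d × E d → ℂ :=
  fun n v => (scale n : ℂ) ^ r * ψ (scale n • v.2)

theorem hasCompactSupport_lie {V : Type*} [NormedAddCommGroup V] [NormedSpace ℝ V] {h : V → ℂ}
    (hh : HasCompactSupport h) (Z : V → V) : HasCompactSupport (lie Z h) := by
  refine (hh.fderiv ℝ).mono fun p hp => ?_
  intro h0
  apply hp
  simp [lie, h0]

theorem contDiff_scaled {ψ : E d × E d → ℂ} (hψ : ContDiff ℝ ∞ ψ) (r n : ℕ) :
    ContDiff ℝ ∞ (scaled ψ r n) :=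
  contDiff_const.mul (hψ.comp (contDiff_snd.const_smul (scale n)))

theorem along_scaled {ψ : E d × E d → ℂ} (hψ : ContDiff ℝ ∞ ψ) (r : ℕ)
    (X : E d × E d × E d → E d × E d × E d) :
    along X (scaled ψ r)
      = fun n v => (scale n : ℂ) ^ (r + 1) * fderiv ℝ ψ (scale n • v.2) (X v).2 := by
  funext n v
  have h1 : HasFDerivAt (fun v : E d × E d × E d => scale n • v.2)
      (scale n • ContinuousLinearMap.snd ℝ (E d) (E d × E d)) v :=
    (hasFDerivAt_snd (𝕜 := ℝ) (p := v)).const_smul (scale n)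
  have h2 := ((hψ.diff_top (scale n • v.2)).hasFDerivAt.comp v h1).const_mul ((scale n : ℂ) ^ r)
  have h3 : fderiv ℝ (scaled ψ r n) v = _ := h2.fderiv
  rw [along, h3]
  simp only [smul_apply, ContinuousLinearMap.comp_apply, ContinuousLinearMap.coe_snd',
    map_smul, Complex.real_smul, smul_eq_mul]
  ring

/-- On the support of the rescaled function ε(1+|η|) is bounded, so each factor ε counts as one
order in 1+|η|, uniformly in ε. -/
theorem smoothBdd_scaled {ψ : E d × E d → ℂ} (hψ : ContDiff ℝ ∞ ψ) (hs : HasCompactSupport ψ)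
    (r : ℕ) : SmoothBdd (F.ampWt (-(r : ℝ)) 0 0) (scaled ψ r) := by
  obtain ⟨C, hC⟩ := hψ.continuous.bounded_above_of_compact_support hs
  obtain ⟨R, hR⟩ := hs.isCompact.isBounded.subset_closedBall (0 : E d × E d)
  have hC0 : 0 ≤ C := (norm_nonneg _).trans (hC 0)
  refine ⟨contDiff_scaled hψ r, C * (1 + |R|) ^ r, by positivity, fun n v => ?_⟩
  have hp := one_add_norm_pos v.2.2
  have hs0 := scale_pos n
  simp only [AdaptedFrame.ampWt, AdaptedFrame.symWt, Real.rpow_zero, mul_one, scaled, norm_mul,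
    norm_pow, Complex.norm_real, Real.norm_eq_abs,
    abs_of_pos hs0]
  rw [Real.rpow_neg hp.le, Real.rpow_natCast, ← div_eq_mul_inv, le_div_iff₀ (by positivity)]
  by_cases h0 : ψ (scale n • v.2) = 0
  · rw [h0]
    simp
    positivity
  · have h1 : ‖scale n • v.2‖ ≤ R := by
      have := hR (subset_tsupport _ h0)
      simpa using this
    have h2 : scale n * (1 + ‖v.2.2‖) ≤ 1 + |R| := by
      rw [norm_smul, Real.norm_eq_abs, abs_of_pos hs0] at h1
      have h3 : scale n * ‖v.2.2‖ ≤ scale n * ‖v.2‖ :=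
        mul_le_mul_of_nonneg_left (norm_snd_le v.2) hs0.le
      have := scale_le_one n
      have := le_abs_self R
      rw [mul_add]
      linarith
    calc scale n ^ r * ‖ψ (scale n • v.2)‖ * (1 + ‖v.2.2‖) ^ r
        = ‖ψ (scale n • v.2)‖ * (scale n * (1 + ‖v.2.2‖)) ^ r := by rw [mul_pow]; ring
      _ ≤ C * (1 + |R|) ^ r := by
        gcongr
        exact hC _

/-- Each derivative yields another factor ε, hence one order. Only the part Lη·∂_η of a good field
has a growing coefficient; there ε is spent on η, and εη_l is absorbed into a new test function p ↦
p.2 l · ∂ψ, so the power r is unchanged. -/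
theorem AdaptedFrame.ampLE_scaled {ψ : E d × E d → ℂ} (hψ : ContDiff ℝ ∞ ψ)
    (hs : HasCompactSupport ψ) (r k : ℕ) : F.AmpLE k (-(r : ℝ)) 0 0 (scaled ψ r) := by
  induction k generalizing r ψ with
  | zero => exact smoothBdd_scaled hψ hs r
  | succ k ih =>
    have h1 : ∀ t : E d × E d, F.AmpLE k (-((r + 1 : ℕ) : ℝ)) 0 0
        (scaled (fun p => fderiv ℝ ψ p t) (r + 1)) := fun t =>
      ih (contDiff_lie (Z := fun _ => t) contDiff_const hψ) (hasCompactSupport_lie hs fun _ => t) _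
    have hL : ∀ (n : ℕ) (v : E d × E d × E d) (t : E d), fderiv ℝ ψ (scale n • v.2) (0, t)
        = ∑ q, (t q : ℂ) * fderiv ℝ ψ (scale n • v.2) (0, coordVec q) :=
      fun n v t => clm_zero_prod _ _
    refine ampLE_succ (smoothBdd_scaled hψ hs r) (fun i => ?_) (fun i => ?_) ?_ (fun i => ?_) <;>
      rw [along_scaled hψ]
    · have e : (fun n (v : E d × E d × E d) => (scale n : ℂ) ^ (r + 1)
          * fderiv ℝ ψ (scale n • v.2) (F.field (.good i) v).2)
          = scaled (fun p => fderiv ℝ ψ p (coordVec i, 0)) (r + 1)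
            + ∑ q, ∑ l, (fun _ v => (F.L i q l v.2.1 : ℂ))
              * scaled (fun p => (p.2 l : ℂ) * fderiv ℝ ψ p (0, coordVec q)) r := by
        funext n v
        have e1 : (F.field (.good i) v).2 = (coordVec i, 0) + (0, F.LVec i v.2.1 v.2.2) := by
          simp [field]
        rw [e1, map_add, hL]
        simp only [Pi.add_apply, Finset.sum_apply, Pi.mul_apply, scaled, mul_add, LVec,
          Finset.mul_sum, Finset.sum_mul, Complex.ofReal_sum, Complex.ofReal_mul]
        congr 1
        refine Finset.sum_congr rfl fun q _ => Finset.sum_congr rfl fun l _ => ?_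
        simp only [Prod.smul_snd, PiLp.smul_apply, smul_eq_mul, Complex.ofReal_mul]
        ring
      rw [e]
      refine ((h1 _).mono (by push_cast; linarith) (by push_cast; linarith) le_rfl).add
        (AmpLE.sum _ fun q _ => AmpLE.sum _ fun l _ =>
          ((F.ampLE_comp_mid (F.bddSmooth_L i q l) k).mul (ih ?_ ?_ r)).of_eq
            (by ring) (by ring) (by ring))
      · exact (ofReal_contDiff ((EuclideanSpace.proj (𝕜 := ℝ) l).contDiff.comp contDiff_snd)).mul
          (contDiff_lie (Z := fun _ => (0, coordVec q)) contDiff_const hψ)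
      · exact (hasCompactSupport_lie hs fun _ => (0, coordVec q)).mul_left
    · exact (h1 _).mono (by push_cast; linarith) (by push_cast; linarith) le_rfl
    · have e : (fun n (v : E d × E d × E d) => (scale n : ℂ) ^ (r + 1)
          * fderiv ℝ ψ (scale n • v.2) (F.field .trans v).2)
          = ∑ q, (fun _ v => (F.B v.2.1 q (Fin.last d) : ℂ))
              * scaled (fun p => fderiv ℝ ψ p (0, coordVec q)) (r + 1) := by
        funext n v
        simp only [field]
        rw [hL]
        simp only [Finset.sum_apply, Pi.mul_apply, scaled, BVec, Finset.mul_sum]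
        refine Finset.sum_congr rfl fun q _ => ?_
        ring
      rw [e]
      exact AmpLE.sum _ fun q _ => ((F.ampLE_comp_mid (F.bddSmooth_B q (Fin.last d)) k).mul
        (h1 _)).mono (by push_cast; linarith) (by push_cast; linarith) (by norm_num)
    · exact (h1 _).mono (by push_cast; linarith) (by push_cast; linarith) le_rfl

end Cutoff

/-! ### Sequences of compactly supported amplitudes that stabilise locally. -/

section Tame

open Filter Topology

variable {d : ℕ}

/-- Sequences of smooth amplitudes, each of compact support in `(y, η)`, that are eventually locally
constant in the index. -/
structure Tame (c : ℕ → E d × E d × E d → ℂ) : Prop where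
  contDiff : ∀ n, ContDiff ℝ ∞ (c n)
  supp : ∀ n, ∃ R : ℝ, ∀ v : E d × E d × E d, R < ‖v.2‖ → c n v = 0
  stable : ∀ v, ∃ g : E d × E d × E d → ℂ, ∀ᶠ n in atTop, c n =ᶠ[𝓝 v] g

variable {c c' : ℕ → E d × E d × E d → ℂ}

theorem Tame.add (h : Tame c) (h' : Tame c') : Tame (c + c') where
  contDiff n := (h.contDiff n).add (h'.contDiff n)
  supp n := by
    obtain ⟨R, hR⟩ := h.supp n
    obtain ⟨R', hR'⟩ := h'.supp n
    refine ⟨max R R', fun v hv => ?_⟩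
    simp [hR v ((le_max_left _ _).trans_lt hv), hR' v ((le_max_right _ _).trans_lt hv)]
  stable v := by
    obtain ⟨g, hg⟩ := h.stable v
    obtain ⟨g', hg'⟩ := h'.stable v
    exact ⟨g + g', by filter_upwards [hg, hg'] with n h1 h2 using h1.add h2⟩

theorem Tame.mul_left {b : E d × E d × E d → ℂ} (hb : ContDiff ℝ ∞ b) (h : Tame c) :
    Tame ((fun _ => b) * c) where
  contDiff n := hb.mul (h.contDiff n)
  supp n := by
    obtain ⟨R, hR⟩ := h.supp n
    exact ⟨R, fun v hv => by simp [hR v hv]⟩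
  stable v := by
    obtain ⟨g, hg⟩ := h.stable v
    exact ⟨b * g, by filter_upwards [hg] with n h1 using (EventuallyEq.refl _ b).mul h1⟩

theorem Tame.along {X : E d × E d × E d → E d × E d × E d} (hX : ContDiff ℝ ∞ X) (h : Tame c) :
    Tame (along X c) where
  contDiff n := ((h.contDiff n).fderiv_right (by simp)).clm_apply hX
  supp n := by
    obtain ⟨R, hR⟩ := h.supp n
    refine ⟨R, fun v hv => ?_⟩
    have h0 : c n =ᶠ[𝓝 v] fun _ => 0 := by
      filter_upwards [(isOpen_lt continuous_const (continuous_snd.norm)).mem_nhds hv] with w hw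
        using hR w hw
    rw [MixedSymbol.along, h0.fderiv_eq]
    simp
  stable v := by
    obtain ⟨g, hg⟩ := h.stable v
    refine ⟨fun w => fderiv ℝ g w (X w), ?_⟩
    filter_upwards [hg] with n h1
    filter_upwards [h1.fderiv (𝕜 := ℝ)] with w hw
    rw [MixedSymbol.along, hw]

theorem Tame.zero : Tame (0 : ℕ → E d × E d × E d → ℂ) where
  contDiff _ := contDiff_const
  supp _ := ⟨0, fun _ _ => rfl⟩
  stable _ := ⟨0, Eventually.of_forall fun _ => EventuallyEq.rfl⟩

theorem Tame.sum {τ : Type*} (s : Finset τ) {c : τ → ℕ → E d × E d × E d → ℂ}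
    (h : ∀ t ∈ s, Tame (c t)) : Tame (∑ t ∈ s, c t) := by
  classical
  induction s using Finset.induction_on with
  | empty => simpa using Tame.zero
  | insert a s ha ih =>
    rw [Finset.sum_insert ha]
    exact (h a (Finset.mem_insert_self _ _)).add (ih fun t ht => h t (Finset.mem_insert_of_mem ht))

/-- A test function that is equal to one near the origin. -/
def bump : ContDiffBump (0 : E d × E d) := ⟨1, 2, one_pos, one_lt_two⟩

/-- The cut-off amplitudes of the adjoint of the operator with symbol `h`. -/
def cutoffAmp (h : E d × E d → ℂ) : ℕ → E d × E d × E d → ℂ :=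
  (fun _ v => conj (h v.2)) * scaled (fun p => ((bump (d := d) p : ℝ) : ℂ)) 0

theorem contDiff_bump : ContDiff ℝ ∞ fun p : E d × E d => ((bump (d := d) p : ℝ) : ℂ) :=
  AdaptedFrame.ofReal_contDiff bump.contDiff

theorem hasCompactSupport_bump :
    HasCompactSupport fun p : E d × E d => ((bump (d := d) p : ℝ) : ℂ) :=
  (bump (d := d)).hasCompactSupport.comp_left Complex.ofReal_zero

theorem tendsto_scale : Tendsto scale atTop (𝓝 0) := tendsto_one_div_add_atTop_nhds_zero_nat

theorem scaled_bump_eventually (v : E d × E d × E d) : ∀ᶠ n in atTop,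
    scaled (fun p : E d × E d => ((bump (d := d) p : ℝ) : ℂ)) 0 n =ᶠ[𝓝 v] fun _ => 1 := by
  have h1 : Tendsto (fun n => scale n * (‖v.2‖ + 1)) atTop (𝓝 0) := by
    simpa using tendsto_scale.mul_const (‖v.2‖ + 1)
  filter_upwards [h1.eventually (gt_mem_nhds one_pos)] with n hn
  have h2 : ∀ᶠ w : E d × E d × E d in 𝓝 v, ‖w.2‖ < ‖v.2‖ + 1 :=
    (continuous_snd.norm.tendsto v).eventually (gt_mem_nhds (lt_add_one _))
  filter_upwards [h2] with w hw
  have : bump (d := d) (scale n • w.2) = 1 := by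
    refine ContDiffBump.one_of_mem_closedBall _ ?_
    rw [mem_closedBall_zero_iff, norm_smul, Real.norm_eq_abs, abs_of_pos (scale_pos n)]
    exact (mul_le_mul_of_nonneg_left hw.le (scale_pos n).le).trans hn.le
  simp [scaled, this]

theorem tame_cutoffAmp {h : E d × E d → ℂ} (hh : ContDiff ℝ ∞ h) : Tame (cutoffAmp h) where
  contDiff n := (Complex.conjCLE.contDiff.comp (hh.comp contDiff_snd)).mul
    (contDiff_scaled contDiff_bump 0 n)
  supp n := by
    refine ⟨2 / scale n, fun v hv => ?_⟩
    have : bump (d := d) (scale n • v.2) = 0 := by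
      refine ContDiffBump.zero_of_le_dist _ ?_
      rw [dist_zero_right, norm_smul, Real.norm_eq_abs, abs_of_pos (scale_pos n)]
      rw [div_lt_iff₀' (scale_pos n)] at hv
      exact hv.le
    simp [cutoffAmp, scaled, this]
  stable v := by
    refine ⟨fun v => conj (h v.2) * 1, ?_⟩
    filter_upwards [scaled_bump_eventually v] with n hn
    filter_upwards [hn] with w hw
    simp only [cutoffAmp, Pi.mul_apply, hw]

theorem AdaptedFrame.amp_cutoffAmp {D : E d → Submodule ℝ (E d)} {F : AdaptedFrame D} {m n : ℝ}
    {h : E d × E d → ℂ} (hh : F.SymBounds m n h) : F.Amp m n 0 (cutoffAmp h) := fun k =>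
  (AmpLE.mul (Cls.conj (hh.ampLE k)) (F.ampLE_scaled contDiff_bump hasCompactSupport_bump 0 k)).of_eq
    (by simp) (by ring) (by ring)

end Tame

/-! ### Differentiation under the integral sign for compactly supported integrands. -/

section ParametricIntegral

open Filter Topology

theorem fderiv_eq_zero_of_supp {P Q : Type*} [NormedAddCommGroup P] [NormedSpace ℝ P]
    [NormedAddCommGroup Q] [NormedSpace ℝ Q] {f : P × Q → ℂ} {R : ℝ}
    (h : ∀ p q, R < ‖q‖ → f (p, q) = 0) (p : P) (q : Q) (hq : R < ‖q‖) :
    fderiv ℝ f (p, q) = 0 := by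
  have h0 : f =ᶠ[𝓝 (p, q)] fun _ => 0 := by
    filter_upwards [(isOpen_lt continuous_const (continuous_snd.norm)).mem_nhds
      (show (p, q) ∈ {w : P × Q | R < ‖w.2‖} from hq)] with w hw using h w.1 w.2 hw
  rw [h0.fderiv_eq]
  simp

variable {P Q : Type*} [NormedAddCommGroup P] [NormedSpace ℝ P] [FiniteDimensional ℝ P]
  [NormedAddCommGroup Q] [NormedSpace ℝ Q] [FiniteDimensional ℝ Q] [MeasurableSpace Q]
  [BorelSpace Q] {μ : Measure Q} [μ.IsAddHaarMeasure] {f : P × Q → ℂ} {R : ℝ}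

theorem integrable_of_continuous_of_bounded_supp {W : Type*} [NormedAddCommGroup W] {g : Q → W}
    (hg : Continuous g) (h : ∀ q, R < ‖q‖ → g q = 0) : Integrable g μ := by
  refine hg.integrable_of_hasCompactSupport
    (HasCompactSupport.intro (isCompact_closedBall (0 : Q) R) fun q hq => h q ?_)
  rwa [mem_closedBall_zero_iff, not_le] at hq

theorem hasFDerivAt_integral_of_supp (hf : ContDiff ℝ ∞ f) (h : ∀ p q, R < ‖q‖ → f (p, q) = 0)
    (p : P) : HasFDerivAt (fun p => ∫ q, f (p, q) ∂μ)
      (∫ q, (fderiv ℝ f (p, q)).comp (ContinuousLinearMap.inl ℝ P Q) ∂μ) p := by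
  have hc : Continuous fun w : P × Q => (fderiv ℝ f w).comp (ContinuousLinearMap.inl ℝ P Q) :=
    (hf.continuous_fderiv (by simp)).clm_comp continuous_const
  have hz : ∀ p q, R < ‖q‖ → (fderiv ℝ f (p, q)).comp (ContinuousLinearMap.inl ℝ P Q) = 0 := by
    intro p q hq
    rw [fderiv_eq_zero_of_supp h p q hq]
    simp
  obtain ⟨C, hC⟩ := ((isCompact_closedBall p 1).prod
    (isCompact_closedBall (0 : Q) R)).exists_bound_of_continuousOn hc.continuousOn
  refine hasFDerivAt_integral_of_dominated_of_fderiv_le (Metric.ball_mem_nhds p one_pos)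
    (F' := fun p q => (fderiv ℝ f (p, q)).comp (ContinuousLinearMap.inl ℝ P Q))
    (bound := (Metric.closedBall (0 : Q) R).indicator fun _ => C)
    (Eventually.of_forall fun p' => ?_) ?_ ?_ (Eventually.of_forall fun q p' hp' => ?_) ?_
    (Eventually.of_forall fun q p' _ => ?_)
  · exact (hf.continuous.comp (Continuous.prodMk_right p')).aestronglyMeasurable
  · exact integrable_of_continuous_of_bounded_supp
      (hf.continuous.comp (Continuous.prodMk_right p)) (h p)
  · exact (hc.comp (Continuous.prodMk_right p)).aestronglyMeasurable
  · by_cases hq : q ∈ Metric.closedBall (0 : Q) R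
    · rw [Set.indicator_of_mem hq]
      exact hC (p', q) ⟨Metric.ball_subset_closedBall hp', hq⟩
    · rw [Set.indicator_of_notMem hq, hz p' q (by simpa using hq), norm_zero]
  · exact (integrable_indicator_iff measurableSet_closedBall).mpr
      (integrableOn_const (isCompact_closedBall (0 : Q) R).measure_lt_top.ne)
  · exact HasFDerivAt.comp (f := fun p : P => (p, q)) p' (hf.diff_top (p', q)).hasFDerivAt
      (hasFDerivAt_prodMk_left p' q)

theorem integral_fderiv_eq_zero {g : Q → ℂ} (hg : ContDiff ℝ ∞ g) (h : ∀ q, R < ‖q‖ → g q = 0)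
    (w : Q) : ∫ q, fderiv ℝ g q w ∂μ = 0 := by
  have hcs : HasCompactSupport g :=
    HasCompactSupport.intro (isCompact_closedBall (0 : Q) R) fun q hq => h q (by simpa using hq)
  have hd : Continuous fun q => fderiv ℝ g q w :=
    (hg.continuous_fderiv (by simp)).clm_apply continuous_const
  have := integral_mul_fderiv_eq_neg_fderiv_mul_of_integrable (μ := μ) (f := fun _ : Q => (1 : ℂ))
    (g := g) (v := w) (by simp)
    (by simpa using hd.integrable_of_hasCompactSupport (hcs.fderiv_apply ℝ w))
    (by simpa using hg.continuous.integrable_of_hasCompactSupport hcs)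
    (fun _ _ => differentiableAt_const _) fun q _ => hg.diff_top q
  simpa using this

/-- The direction w in the integration variable is free, because the integral of a derivative of a
compactly supported function vanishes. It will be chosen so that the phase is not differentiated. -/
theorem fderiv_integral_of_supp (hf : ContDiff ℝ ∞ f) (h : ∀ p q, R < ‖q‖ → f (p, q) = 0)
    (p v : P) (w : Q) :
    fderiv ℝ (fun p => ∫ q, f (p, q) ∂μ) p v = ∫ q, fderiv ℝ f (p, q) (v, w) ∂μ := by
  have hc : ∀ t : P × Q, Continuous fun q : Q => fderiv ℝ f (p, q) t := fun t =>
    ((hf.continuous_fderiv (by simp)).clm_apply continuous_const).comp (Continuous.prodMk_right p)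
  have hi : ∀ t : P × Q, Integrable (fun q : Q => fderiv ℝ f (p, q) t) μ := fun t =>
    integrable_of_continuous_of_bounded_supp (R := R) (hc t) fun q hq => by
      rw [fderiv_eq_zero_of_supp h p q hq]
      rfl
  have hi' : Integrable (fun q => (fderiv ℝ f (p, q)).comp (ContinuousLinearMap.inl ℝ P Q)) μ :=
    integrable_of_continuous_of_bounded_supp (R := R)
      (((hf.continuous_fderiv (by simp)).clm_comp continuous_const).comp
        (Continuous.prodMk_right p)) fun q hq => by
      rw [fderiv_eq_zero_of_supp h p q hq]
      simp
  have h0 : ∫ q, fderiv ℝ f (p, q) (0, w) ∂μ = 0 := by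
    have := integral_fderiv_eq_zero (μ := μ) (hf.comp (contDiff_prodMk_right p)) (h p) w
    rw [← this]
    congr 1
    funext q
    have h1 := HasFDerivAt.comp (f := fun q : Q => (p, q)) q (hf.diff_top (p, q)).hasFDerivAt
      (hasFDerivAt_prodMk_right p q)
    have h2 : fderiv ℝ (f ∘ fun q : Q => (p, q)) q = _ := h1.fderiv
    rw [h2]
    simp
  rw [(hasFDerivAt_integral_of_supp hf h p).fderiv, ContinuousLinearMap.integral_apply hi']
  have h3 : ∀ q, fderiv ℝ f (p, q) (v, w)
      = fderiv ℝ f (p, q) (v, 0) + fderiv ℝ f (p, q) (0, w) := fun q => by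
    rw [← map_add]
    simp
  simp_rw [h3]
  rw [integral_add (hi _) (hi _), h0, add_zero]
  simp

end ParametricIntegral

/-! ### The oscillatory integral and the effect on it of derivatives and of multiplication by ξ. -/

section Oscillatory

variable {d : ℕ}

instance : (volume : Measure (E d × E d)).IsAddHaarMeasure :=
  inferInstanceAs ((volume : Measure (E d)).prod (volume : Measure (E d))).IsAddHaarMeasure

/-- The phase factor `e^{2π i (x - y)·(η - ξ)}` at the points `(x, ξ)` and `(y, η)`. -/
def phase (w : (E d × E d) × E d × E d) : ℂ :=
  Complex.exp (2 * Real.pi * Complex.I * (inner ℝ (w.1.1 - w.2.1) (w.2.2 - w.1.2) : ℝ))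

theorem norm_phase (w : (E d × E d) × E d × E d) : ‖phase w‖ = 1 := by
  rw [phase, show (2 * Real.pi * Complex.I * (inner ℝ (w.1.1 - w.2.1) (w.2.2 - w.1.2) : ℝ) : ℂ)
    = ((2 * Real.pi * inner ℝ (w.1.1 - w.2.1) (w.2.2 - w.1.2) : ℝ) : ℂ) * Complex.I by
      push_cast; ring, Complex.norm_exp_ofReal_mul_I]

theorem contDiff_phase : ContDiff ℝ ∞ (phase (d := d)) := by
  refine Complex.contDiff_exp.comp (contDiff_const.mul (Complex.ofRealCLM.contDiff.comp ?_))
  exact ContDiff.inner ℝ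
    ((contDiff_fst.comp contDiff_fst).sub (contDiff_fst.comp contDiff_snd))
    ((contDiff_snd.comp contDiff_snd).sub (contDiff_snd.comp contDiff_fst))

theorem fderiv_phase (w t : (E d × E d) × E d × E d) :
    fderiv ℝ phase w t = 2 * Real.pi * Complex.I *
      ((inner ℝ (t.1.1 - t.2.1) (w.2.2 - w.1.2) + inner ℝ (w.1.1 - w.2.1) (t.2.2 - t.1.2) : ℝ) : ℂ)
        * phase w := by
  have h1 : HasFDerivAt (fun w : (E d × E d) × E d × E d => w.1.1 - w.2.1) _ w :=
    (((ContinuousLinearMap.fst ℝ (E d) (E d)).comp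
      (ContinuousLinearMap.fst ℝ (E d × E d) (E d × E d))) -
    ((ContinuousLinearMap.fst ℝ (E d) (E d)).comp
      (ContinuousLinearMap.snd ℝ (E d × E d) (E d × E d)))).hasFDerivAt
  have h2 : HasFDerivAt (fun w : (E d × E d) × E d × E d => w.2.2 - w.1.2) _ w :=
    (((ContinuousLinearMap.snd ℝ (E d) (E d)).comp
      (ContinuousLinearMap.snd ℝ (E d × E d) (E d × E d))) -
    ((ContinuousLinearMap.snd ℝ (E d) (E d)).comp
      (ContinuousLinearMap.fst ℝ (E d × E d) (E d × E d)))).hasFDerivAt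
  have h3 := ((Complex.ofRealCLM.hasFDerivAt.comp w (h1.inner ℝ h2)).const_mul
    (2 * Real.pi * Complex.I : ℂ)).cexp
  have h4 : fderiv ℝ phase w = _ := h3.fderiv
  rw [h4]
  simp [phase]
  ring

/-- The oscillatory integral `∫∫ g(y, η) e^{2π i (x - y)·(η - ξ)} dy dη` at `p = (x, ξ)`. -/
def oscInt (g : E d × E d → ℂ) (p : E d × E d) : ℂ := ∫ q, g q * phase (p, q)

theorem continuous_phase (p : E d × E d) : Continuous fun q => phase (p, q) :=
  contDiff_phase.continuous.comp (Continuous.prodMk_right p)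

variable {g : E d × E d → ℂ} {p : E d × E d}

theorem integrable_mul_phase (hg : Continuous g) (hs : HasCompactSupport g) :
    Integrable fun q => g q * phase (p, q) :=
  (hg.mul (continuous_phase p)).integrable_of_hasCompactSupport hs.mul_right

theorem integral_mul_fderiv_phase (hg : ContDiff ℝ ∞ g) (hs : HasCompactSupport g)
    (t : E d × E d) :
    ∫ q, g q * fderiv ℝ phase (p, q) (0, t) = -oscInt (fun q => fderiv ℝ g q t) p := by
  have h2 : ∀ q, fderiv ℝ (fun q => phase (p, q)) q t = fderiv ℝ phase (p, q) (0, t) := fun q => by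
    have h1 := HasFDerivAt.comp (f := fun q : E d × E d => (p, q)) q
      (contDiff_phase.diff_top (p, q)).hasFDerivAt (hasFDerivAt_prodMk_right p q)
    have h2 : fderiv ℝ (fun q => phase (p, q)) q = _ := h1.fderiv
    rw [h2]
    simp
  have hp : ContDiff ℝ ∞ fun q => phase (p, q) := contDiff_phase.comp (contDiff_prodMk_right p)
  have hd : Continuous fun q => fderiv ℝ g q t :=
    (hg.continuous_fderiv (by simp)).clm_apply continuous_const
  have hd' : Continuous fun q => fderiv ℝ (fun q => phase (p, q)) q t :=
    (hp.continuous_fderiv (by simp)).clm_apply continuous_const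
  have := integral_mul_fderiv_eq_neg_fderiv_mul_of_integrable (μ := volume) (f := g)
    (g := fun q => phase (p, q)) (v := t) (integrable_mul_phase hd (hs.fderiv_apply ℝ t))
    ((hg.continuous.mul hd').integrable_of_hasCompactSupport hs.mul_right)
    (integrable_mul_phase hg.continuous hs) (fun q _ => hg.diff_top q) fun q _ => hp.diff_top q
  simp_rw [h2] at this
  exact this

theorem coord_eq_inner (v : E d) (k : Fin (d + 1)) : inner ℝ (coordVec k) v = v k := by
  simp [coordVec, EuclideanSpace.inner_single_left]

/-- Multiplication by `(η - ξ)_k` under the oscillatory integral. -/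
theorem oscInt_eta_sub (hg : ContDiff ℝ ∞ g) (hs : HasCompactSupport g) (k : Fin (d + 1)) :
    oscInt (fun q => ((q.2 k - p.2 k : ℝ) : ℂ) * g q) p
      = (2 * Real.pi * Complex.I)⁻¹ * oscInt (fun q => fderiv ℝ g q (coordVec k, 0)) p := by
  have h := integral_mul_fderiv_phase (p := p) hg hs (coordVec k, 0)
  have hne : (2 * Real.pi * Complex.I : ℂ) ≠ 0 := by simp [Real.pi_ne_zero]
  rw [eq_inv_mul_iff_mul_eq₀ hne, ← neg_inj, ← h, oscInt, ← integral_const_mul, ← integral_neg]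
  congr 1
  funext q
  rw [fderiv_phase]
  simp only [Prod.fst_zero, Prod.snd_zero, zero_sub, sub_zero, inner_zero_right, add_zero,
    inner_neg_left, coord_eq_inner, PiLp.sub_apply]
  push_cast
  ring

/-- Multiplication by `(x - y)_k` under the oscillatory integral. -/
theorem oscInt_sub_y (hg : ContDiff ℝ ∞ g) (hs : HasCompactSupport g) (k : Fin (d + 1)) :
    oscInt (fun q => ((p.1 k - q.1 k : ℝ) : ℂ) * g q) p
      = -((2 * Real.pi * Complex.I)⁻¹ * oscInt (fun q => fderiv ℝ g q (0, coordVec k)) p) := by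
  have h := integral_mul_fderiv_phase (p := p) hg hs (0, coordVec k)
  have hne : (2 * Real.pi * Complex.I : ℂ) ≠ 0 := by simp [Real.pi_ne_zero]
  rw [← mul_neg, eq_inv_mul_iff_mul_eq₀ hne, ← h, oscInt, ← integral_const_mul]
  congr 1
  funext q
  rw [fderiv_phase]
  simp only [Prod.fst_zero, Prod.snd_zero, sub_zero, inner_zero_left, zero_add,
    real_inner_comm, coord_eq_inner, PiLp.sub_apply]
  push_cast
  ring

theorem oscInt_add {g' : E d × E d → ℂ} (hg : Continuous g) (hs : HasCompactSupport g)
    (hg' : Continuous g') (hs' : HasCompactSupport g') :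
    oscInt (g + g') p = oscInt g p + oscInt g' p := by
  simp only [oscInt, Pi.add_apply, add_mul]
  exact integral_add (integrable_mul_phase hg hs) (integrable_mul_phase hg' hs')

theorem oscInt_sum {τ : Type*} (s : Finset τ) {g : τ → E d × E d → ℂ}
    (hg : ∀ t ∈ s, Continuous (g t)) (hs : ∀ t ∈ s, HasCompactSupport (g t)) :
    oscInt (∑ t ∈ s, g t) p = ∑ t ∈ s, oscInt (g t) p := by
  simp only [oscInt, Finset.sum_apply, Finset.sum_mul]
  exact integral_finsetSum _ fun t ht => integrable_mul_phase (hg t ht) (hs t ht)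

theorem oscInt_const_mul (z : ℂ) : oscInt (fun q => z * g q) p = z * oscInt g p := by
  simp only [oscInt, mul_assoc]
  exact integral_const_mul _ _

/-- Smooth amplitudes of compact support in `(y, η)`. -/
def TestAmp (c : E d × E d × E d → ℂ) : Prop :=
  ContDiff ℝ ∞ c ∧ ∃ R : ℝ, ∀ v : E d × E d × E d, R < ‖v.2‖ → c v = 0

theorem Tame.testAmp {c : ℕ → E d × E d × E d → ℂ} (h : Tame c) (n : ℕ) : TestAmp (c n) :=
  ⟨h.contDiff n, h.supp n⟩

/-- The oscillatory integral of an amplitude. -/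
def ampInt (c : E d × E d × E d → ℂ) (p : E d × E d) : ℂ := oscInt (fun q => c (p.1, q)) p

variable {c c' : E d × E d × E d → ℂ}

theorem TestAmp.slice (h : TestAmp c) (x : E d) :
    ContDiff ℝ ∞ (fun q => c (x, q)) ∧ HasCompactSupport fun q => c (x, q) := by
  obtain ⟨h1, R, hR⟩ := h
  exact ⟨h1.comp (contDiff_prodMk_right x), HasCompactSupport.intro
    (isCompact_closedBall (0 : E d × E d) R) fun q hq => hR (x, q) (by simpa using hq)⟩

theorem ampInt_add (h : TestAmp c) (h' : TestAmp c') :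
    ampInt (c + c') p = ampInt c p + ampInt c' p :=
  oscInt_add (h.slice _).1.continuous (h.slice _).2 (h'.slice _).1.continuous (h'.slice _).2

theorem ampInt_sum {τ : Type*} (s : Finset τ) {c : τ → E d × E d × E d → ℂ}
    (h : ∀ t ∈ s, TestAmp (c t)) : ampInt (∑ t ∈ s, c t) p = ∑ t ∈ s, ampInt (c t) p := by
  have := oscInt_sum (p := p) s (g := fun t q => c t (p.1, q))
    (fun t ht => ((h t ht).slice _).1.continuous) fun t ht => ((h t ht).slice _).2
  refine Eq.trans ?_ this
  rw [ampInt]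
  congr 1
  funext q
  simp

theorem ampInt_mul_fst (b : E d → ℂ) : ampInt (fun v => b v.1 * c v) p = b p.1 * ampInt c p :=
  oscInt_const_mul (g := fun q => c (p.1, q)) (b p.1)

theorem fderiv_slice (h : ContDiff ℝ ∞ c) (x : E d) (q t : E d × E d) :
    fderiv ℝ (fun q => c (x, q)) q t = fderiv ℝ c (x, q) (0, t) := by
  have h1 := HasFDerivAt.comp (f := fun q : E d × E d => (x, q)) q
    (h.diff_top (x, q)).hasFDerivAt (hasFDerivAt_prodMk_right x q)
  have h2 : fderiv ℝ (fun q => c (x, q)) q = _ := h1.fderiv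
  rw [h2]
  simp

/-- Multiplication of the oscillatory integral by `ξ_l`. -/
theorem mul_ampInt (h : TestAmp c) (l : Fin (d + 1)) :
    (p.2 l : ℂ) * ampInt c p = ampInt (fun v => (v.2.2 l : ℂ) * c v) p
      - (2 * Real.pi * Complex.I)⁻¹ * ampInt (fun v => fderiv ℝ c v (0, coordVec l, 0)) p := by
  have h1 := oscInt_eta_sub (p := p) (h.slice p.1).1 (h.slice p.1).2 l
  simp only [fderiv_slice h.1] at h1
  have h2 : ContDiff ℝ ∞ fun q : E d × E d => (q.2 l : ℂ) :=
    AdaptedFrame.ofReal_contDiff ((EuclideanSpace.proj (𝕜 := ℝ) l).contDiff.comp contDiff_snd)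
  have h3 : oscInt (fun q => ((q.2 l - p.2 l : ℝ) : ℂ) * c (p.1, q)) p
      = oscInt (fun q => (q.2 l : ℂ) * c (p.1, q)) p - (p.2 l : ℂ) * oscInt (fun q => c (p.1, q)) p := by
    simp only [oscInt]
    rw [← integral_const_mul, ← integral_sub]
    · congr 1
      funext q
      push_cast
      ring
    · exact integrable_mul_phase (h2.continuous.mul (h.slice p.1).1.continuous)
        (h.slice p.1).2.mul_left
    · exact (integrable_mul_phase (h.slice p.1).1.continuous (h.slice p.1).2).const_mul _
  simp only [ampInt]
  rw [← h1, h3]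
  ring

/-- In `fderiv_integral_of_supp` the integration variable (y,η) is moved by the same vector as
(x,ξ). The phase, a function of x - y and η - ξ, is then constant, and only the amplitude is
differentiated. -/
theorem hasFDerivAt_ampInt (h : TestAmp c) (p : E d × E d) : DifferentiableAt ℝ (ampInt c) p ∧
    ∀ t : E d × E d, fderiv ℝ (ampInt c) p t
      = ampInt (fun v => fderiv ℝ c v (t.1, t.1, t.2)) p := by
  obtain ⟨h1, R, hR⟩ := h
  have hm : ContDiff ℝ ∞ fun w : (E d × E d) × E d × E d => c (w.1.1, w.2) :=
    h1.comp ((contDiff_fst.comp contDiff_fst).prodMk contDiff_snd)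
  have hF := hm.mul contDiff_phase
  have hz : ∀ p q : E d × E d, R < ‖q‖ → c (p.1, q) * phase (p, q) = 0 := fun p q hq => by
    rw [hR (p.1, q) hq, zero_mul]
  refine ⟨(hasFDerivAt_integral_of_supp hF hz p).differentiableAt, fun t => ?_⟩
  refine (fderiv_integral_of_supp hF hz p t t).trans ?_
  rw [ampInt, oscInt]
  congr 1
  funext q
  rw [fderiv_fun_mul (hm.diff_top _) (contDiff_phase.diff_top _)]
  simp only [add_apply, smul_apply, smul_eq_mul]
  rw [fderiv_phase]
  simp only [sub_self, inner_zero_left, inner_zero_right, add_zero, Complex.ofReal_zero, mul_zero,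
    zero_mul, zero_add]
  have h5 := HasFDerivAt.comp (f := fun w : (E d × E d) × E d × E d => (w.1.1, w.2)) (p, q)
    (h1.diff_top (p.1, q)).hasFDerivAt
    (((ContinuousLinearMap.fst ℝ (E d) (E d)).comp
      (ContinuousLinearMap.fst ℝ (E d × E d) (E d × E d))).prod
      (ContinuousLinearMap.snd ℝ (E d × E d) (E d × E d))).hasFDerivAt
  have h6 : fderiv ℝ (fun w : (E d × E d) × E d × E d => c (w.1.1, w.2)) (p, q) = _ := h5.fderiv
  rw [h6, mul_comm]
  simp

end Oscillatory

/-! ### The operators on amplitudes induced by ∂_x, ∂_ξ, D_i, D_ξ and by multiplication by ξ. -/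

section AmplitudeOperators

variable {d : ℕ}

namespace AdaptedFrame

variable {D : E d → Submodule ℝ (E d)} (F : AdaptedFrame D)

theorem contDiff_field (j : Letter d) : ContDiff ℝ ∞ (F.field j) := by
  cases j with
  | good i =>
    refine contDiff_const.prodMk (contDiff_const.prodMk ?_)
    have := (F.contDiff_goodField i).snd
    exact this.comp contDiff_snd
  | dEta j => exact contDiff_const
  | trans =>
    exact contDiff_const.prodMk (contDiff_const.prodMk
      (F.contDiff_BVec.comp (contDiff_fst.comp contDiff_snd)))
  | dY j => exact contDiff_const

/-- The operator on amplitudes that corresponds to `∂/∂x^i`. -/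
def opX (i : Fin (d + 1)) (c : ℕ → E d × E d × E d → ℂ) : ℕ → E d × E d × E d → ℂ :=
  along (fun _ => (coordVec i, coordVec i, 0)) c

/-- The operator on amplitudes that corresponds to `∂/∂ξ_j`. -/
def opXi (j : Fin (d + 1)) (c : ℕ → E d × E d × E d → ℂ) : ℕ → E d × E d × E d → ℂ :=
  along (F.field (.dEta j)) c

/-- The operator on amplitudes that corresponds to `D_ξ`. -/
def opTrans (c : ℕ → E d × E d × E d → ℂ) : ℕ → E d × E d × E d → ℂ :=
  ∑ k, (fun _ v => (F.B v.1 k (Fin.last d) : ℂ)) * F.opXi k c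

/-- The operator on amplitudes that corresponds to multiplication by `ξ_l`. -/
def opMul (l : Fin (d + 1)) (c : ℕ → E d × E d × E d → ℂ) : ℕ → E d × E d × E d → ℂ :=
  etaCoord l * c + (fun _ _ => -(2 * Real.pi * Complex.I)⁻¹) * along (F.field (.dY l)) c

/-- The operator on amplitudes that corresponds to `D_i`. -/
def opGood (i : Fin (d + 1)) (c : ℕ → E d × E d × E d → ℂ) : ℕ → E d × E d × E d → ℂ :=
  opX i c + ∑ k, ∑ l, (fun _ v => (F.L i k l v.1 : ℂ)) * F.opMul l (F.opXi k c)

variable {F} {c : ℕ → E d × E d × E d → ℂ} {m n p : ℝ}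

theorem contDiff_fstCoeff {f : E d → ℝ} (hf : BddSmooth f) :
    ContDiff ℝ ∞ fun v : E d × E d × E d => (f v.1 : ℂ) :=
  ofReal_contDiff (hf.contDiff.comp contDiff_fst)

theorem tame_opX (h : Tame c) (i : Fin (d + 1)) : Tame (opX i c) := h.along contDiff_const

theorem tame_opXi (h : Tame c) (j : Fin (d + 1)) : Tame (F.opXi j c) :=
  h.along (F.contDiff_field _)

theorem tame_opTrans (h : Tame c) : Tame (F.opTrans c) :=
  Tame.sum _ fun k _ => (tame_opXi h k).mul_left (contDiff_fstCoeff (F.bddSmooth_B _ _))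

theorem tame_opMul (h : Tame c) (l : Fin (d + 1)) : Tame (F.opMul l c) :=
  (h.mul_left (etaCoord_contDiff l 0)).add
    ((h.along (F.contDiff_field (.dY l))).mul_left contDiff_const)

theorem tame_opGood (h : Tame c) (i : Fin (d + 1)) : Tame (F.opGood i c) :=
  (tame_opX h i).add (Tame.sum _ fun k _ => Tame.sum _ fun l _ =>
    (tame_opMul (tame_opXi h k) l).mul_left (contDiff_fstCoeff (F.bddSmooth_L _ _ _)))

theorem along_good_eq (c : ℕ → E d × E d × E d → ℂ) (i : Fin (d + 1)) :
    along (F.field (.good i)) c = opX i c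
      + ∑ k, ∑ l, (fun _ v => (F.L i k l v.2.1 : ℂ)) * (etaCoord l * F.opXi k c) := by
  funext n v
  have e : F.field (.good i) v = (coordVec i, coordVec i, 0) + (0, 0, F.LVec i v.2.1 v.2.2) := by
    simp [field]
  have e2 : ∀ t : E d, fderiv ℝ (c n) v (0, 0, t)
      = ∑ k, (t k : ℂ) * fderiv ℝ (c n) v (0, 0, coordVec k) := fun t =>
    clm_zero_prod ((fderiv ℝ (c n) v).comp (ContinuousLinearMap.inr ℝ (E d) (E d × E d))) t
  rw [along, e, map_add, e2]
  simp only [Pi.add_apply, Finset.sum_apply, Pi.mul_apply, opX, opXi, along, field, LVec,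
    Complex.ofReal_sum, Complex.ofReal_mul, Finset.sum_mul, etaCoord, mul_assoc]

theorem along_trans_eq (c : ℕ → E d × E d × E d → ℂ) :
    along (F.field .trans) c
      = ∑ k, (fun _ v => (F.B v.2.1 k (Fin.last d) : ℂ)) * F.opXi k c := by
  funext n v
  have e2 : ∀ t : E d, fderiv ℝ (c n) v (0, 0, t)
      = ∑ k, (t k : ℂ) * fderiv ℝ (c n) v (0, 0, coordVec k) := fun t =>
    clm_zero_prod ((fderiv ℝ (c n) v).comp (ContinuousLinearMap.inr ℝ (E d) (E d × E d))) t
  rw [along, field, e2]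
  simp only [Finset.sum_apply, Pi.mul_apply, opXi, along, field, BVec]

theorem amp_opXi (h : F.Amp m n p c) (j : Fin (d + 1)) : F.Amp m (n - 1) p (F.opXi j c) := h.dEta j

/-- The loss of a whole order is harmless: this is used only for convergence and smoothness of the
limit, not for the symbol bounds. -/
theorem amp_opX (h : F.Amp m n p c) (i : Fin (d + 1)) : F.Amp (m + 1) n p (opX i c) := fun k => by
  have e : opX i c = along (F.field (.good i)) c
      - ∑ k, ∑ l, (fun _ v => (F.L i k l v.2.1 : ℂ)) * (etaCoord l * F.opXi k c) := by
    rw [along_good_eq, add_sub_cancel_right]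
  rw [e]
  refine ((h.good i k).mono (by linarith) (by linarith) le_rfl).sub
    (AmpLE.sum _ fun q _ => AmpLE.sum _ fun l _ => ?_)
  exact ((F.ampLE_comp_mid (F.bddSmooth_L i q l) k).mul
    ((F.ampLE_etaCoord l k).mul (amp_opXi h q k))).mono (by linarith) (by linarith) (by linarith)

/-- With coefficients at y the full order is gained by definition of the class. The correction
(B(x)-B(y))∂_η has order (m-1/2, n-1), contained in (m-1, n). -/
theorem amp_opTrans (h : F.Amp m n p c) : F.Amp (m - 1) n (p + 1) (F.opTrans c) := fun k => by
  have e : F.opTrans c = along (F.field .trans) c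
      + ∑ k, ((fun _ v => (F.B v.1 k (Fin.last d) : ℂ))
        - fun _ v => (F.B v.2.1 k (Fin.last d) : ℂ)) * F.opXi k c := by
    rw [along_trans_eq, ← Finset.sum_add_distrib]
    exact Finset.sum_congr rfl fun q _ => by ring
  rw [e]
  refine ((h.trans k).mono le_rfl le_rfl (by linarith)).add (AmpLE.sum _ fun q _ => ?_)
  exact ((F.ampLE_diff (F.bddSmooth_B q (Fin.last d)) k).mul (amp_opXi h q k)).mono
    (by linarith) (by linarith) (by linarith)

/-- Two errors separate this operator from the good field at y: (L(x)-L(y))η∂_η, and the term ∂_y∂_η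
created by exchanging ξ for η. Both have order (m+1/2, n-1), contained in (m,n). -/
theorem amp_opGood (h : F.Amp m n p c) (i : Fin (d + 1)) :
    F.Amp m n (p + 1) (F.opGood i c) := fun k => by
  have e : F.opGood i c = along (F.field (.good i)) c
      + (∑ k, ∑ l, ((fun _ v => (F.L i k l v.1 : ℂ)) - fun _ v => (F.L i k l v.2.1 : ℂ))
          * (etaCoord l * F.opXi k c)
        + ∑ k, ∑ l, (fun _ v => (F.L i k l v.1 : ℂ)) * ((fun _ _ => -(2 * Real.pi * Complex.I)⁻¹)
          * along (F.field (.dY l)) (F.opXi k c))) := by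
    rw [along_good_eq, opGood, add_assoc, ← Finset.sum_add_distrib, ← Finset.sum_add_distrib]
    congr 1
    refine Finset.sum_congr rfl fun q _ => ?_
    rw [← Finset.sum_add_distrib, ← Finset.sum_add_distrib]
    refine Finset.sum_congr rfl fun l _ => ?_
    rw [opMul]
    ring
  rw [e]
  refine ((h.good i k).mono le_rfl le_rfl (by linarith)).add
    (AmpLE.add (AmpLE.sum _ fun q _ => AmpLE.sum _ fun l _ => ?_)
      (AmpLE.sum _ fun q _ => AmpLE.sum _ fun l _ => ?_))
  · exact ((F.ampLE_diff (F.bddSmooth_L i q l) k).mul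
      ((F.ampLE_etaCoord l k).mul (amp_opXi h q k))).mono (by linarith) (by linarith) (by linarith)
  · exact ((F.ampLE_comp_fst (F.bddSmooth_L i q l) k).mul
      ((AmpLE.const _).mul ((amp_opXi h q).dY l k))).mono
        (by linarith) (by linarith) (by linarith)

theorem lie_xi_ampInt (h : Tame c) (j : Fin (d + 1)) (n : ℕ) :
    lie (xiField j) (ampInt (c n)) = ampInt (F.opXi j c n) := by
  funext p
  exact (hasFDerivAt_ampInt (h.testAmp n) p).2 (0, coordVec j)

theorem fderiv_ampInt_x (h : Tame c) (i : Fin (d + 1)) (n : ℕ) (p : E d × E d) :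
    fderiv ℝ (ampInt (c n)) p (coordVec i, 0) = ampInt (opX i c n) p :=
  (hasFDerivAt_ampInt (h.testAmp n) p).2 (coordVec i, 0)

theorem ampInt_fstCoeff_mul (f : E d → ℝ) (n : ℕ) (p : E d × E d) :
    ampInt (((fun _ v => (f v.1 : ℂ)) * c : ℕ → E d × E d × E d → ℂ) n) p
      = (f p.1 : ℂ) * ampInt (c n) p :=
  ampInt_mul_fst fun x => (f x : ℂ)

theorem mul_ampInt_eq (h : Tame c) (l : Fin (d + 1)) (n : ℕ) (p : E d × E d) :
    (p.2 l : ℂ) * ampInt (c n) p = ampInt (F.opMul l c n) p := by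
  have h1 := (h.mul_left (etaCoord_contDiff l 0)).testAmp n
  have h2 := ((h.along (F.contDiff_field (.dY l))).mul_left
    (contDiff_const (c := -(2 * Real.pi * Complex.I)⁻¹))).testAmp n
  rw [mul_ampInt (h.testAmp n), sub_eq_add_neg, ← neg_mul]
  refine Eq.trans ?_ (ampInt_add h1 h2).symm
  congr 1
  exact (oscInt_const_mul _).symm

theorem lie_trans_ampInt (h : Tame c) (n : ℕ) :
    lie F.transField (ampInt (c n)) = ampInt (F.opTrans c n) := by
  funext p
  rw [lie, show F.transField p = (0, F.BVec p.1) from rfl, clm_zero_prod, opTrans,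
    Finset.sum_apply, ampInt_sum _ fun k _ =>
      ((tame_opXi h k).mul_left (contDiff_fstCoeff (F.bddSmooth_B _ _))).testAmp n]
  refine Finset.sum_congr rfl fun k _ => ?_
  rw [ampInt_fstCoeff_mul (f := fun x => F.B x k (Fin.last d)), ← lie_xi_ampInt h]
  rfl

theorem lie_good_ampInt (h : Tame c) (i : Fin (d + 1)) (n : ℕ) :
    lie (F.goodField i) (ampInt (c n)) = ampInt (F.opGood i c n) := by
  funext p
  have e : F.goodField i p = (coordVec i, 0) + (0, F.LVec i p.1 p.2) := by simp [goodField]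
  have ht : ∀ k l, Tame ((fun _ v => (F.L i k l v.1 : ℂ)) * F.opMul l (F.opXi k c) :
      ℕ → E d × E d × E d → ℂ) :=
    fun k l => (tame_opMul (tame_opXi h k) l).mul_left (contDiff_fstCoeff (F.bddSmooth_L _ _ _))
  have e2 : ampInt (F.opGood i c n) p = ampInt (opX i c n) p
      + ampInt ((∑ k, ∑ l, (fun _ v => (F.L i k l v.1 : ℂ)) * F.opMul l (F.opXi k c) :
        ℕ → E d × E d × E d → ℂ) n) p :=
    ampInt_add ((tame_opX h i).testAmp n)
      ((Tame.sum _ fun k _ => Tame.sum _ fun l _ => ht k l).testAmp n)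
  rw [lie, e, map_add, clm_zero_prod, fderiv_ampInt_x h, e2, Finset.sum_apply, ampInt_sum _
    fun k _ => (Tame.sum _ fun l _ => ht k l).testAmp n]
  congr 1
  refine Finset.sum_congr rfl fun k _ => ?_
  rw [Finset.sum_apply, ampInt_sum _ fun l _ => (ht k l).testAmp n]
  simp only [LVec, Complex.ofReal_sum, Complex.ofReal_mul, Finset.sum_mul]
  refine Finset.sum_congr rfl fun l _ => ?_
  rw [ampInt_fstCoeff_mul (f := F.L i k l), ← mul_ampInt_eq (tame_opXi h k), ← lie_xi_ampInt h]
  simp only [lie, xiField]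
  ring

end AdaptedFrame

end AmplitudeOperators

/-! ### Calculus in (y, η) at the isotropic scale λ = (1+|η|)^{1/2}, with a smooth substitute Λ for
λ. -/

section LocalClass

open Filter Topology

variable {d : ℕ}

/-- The weight `(1 + |η|)^{1/2}`. -/
def lam (η : E d) : ℝ := Real.sqrt (1 + ‖η‖)

theorem one_le_lam (η : E d) : 1 ≤ lam η := by
  rw [lam, Real.one_le_sqrt]
  linarith [norm_nonneg η]

theorem lam_pos (η : E d) : 0 < lam η := one_pos.trans_le (one_le_lam η)

theorem lam_sq (η : E d) : lam η ^ 2 = 1 + ‖η‖ := Real.sq_sqrt (by positivity)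

/-- The weight `1 + |η - ξ| / (1 + |η|)^{1/2}`. -/
def freqWt (ξ η : E d) : ℝ := 1 + ‖η - ξ‖ / lam η

theorem one_le_freqWt (ξ η : E d) : 1 ≤ freqWt ξ η := by
  have : 0 ≤ ‖η - ξ‖ / lam η := div_nonneg (norm_nonneg _) (lam_pos η).le
  rw [freqWt]
  linarith

/-- Indices of the families of functions of `(y, η)`: a natural number and a point `(x, ξ)`. -/
abbrev LocIdx (d : ℕ) : Type := ℕ × (E d × E d)

/-- The monomials in the weights. -/
def locWt (a p q : ℝ) : LocIdx d → E d × E d → ℝ := fun i v =>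
  lam v.2 ^ a * sepWt i.2.1 v.1 v.2 ^ p * freqWt i.2.2 v.2 ^ q

/-- The coordinate vector fields in `y` and `η`. -/
def locField : Fin (d + 1) ⊕ Fin (d + 1) → E d × E d → E d × E d
  | .inl k, _ => (coordVec k, 0)
  | .inr k, _ => (0, coordVec k)

/-- The multipliers of the coordinate vector fields. -/
def locMult : Fin (d + 1) ⊕ Fin (d + 1) → LocIdx d → E d × E d → ℝ
  | .inl _ => locWt 1 0 0
  | .inr _ => locWt (-1) 0 0

theorem locWt_pos (a p q : ℝ) (i : LocIdx d) (v : E d × E d) : 0 < locWt a p q i v :=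
  mul_pos (mul_pos (Real.rpow_pos_of_pos (lam_pos _) _)
    (Real.rpow_pos_of_pos (one_pos.trans_le (one_le_sepWt _ _ _)) _))
    (Real.rpow_pos_of_pos (one_pos.trans_le (one_le_freqWt _ _)) _)

theorem locWt_mul (a p q a' p' q' : ℝ) :
    (locWt a p q : LocIdx d → E d × E d → ℝ) * locWt a' p' q'
      = locWt (a + a') (p + p') (q + q') := by
  funext i v
  simp only [locWt, Pi.mul_apply]
  rw [Real.rpow_add (lam_pos _), Real.rpow_add (one_pos.trans_le (one_le_sepWt _ _ _)),
    Real.rpow_add (one_pos.trans_le (one_le_freqWt _ _))]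
  ring

theorem locWt_zero : (locWt 0 0 0 : LocIdx d → E d × E d → ℝ) = 1 := by
  funext i v
  simp [locWt]

theorem locWt_inv (a p q : ℝ) :
    (locWt a p q : LocIdx d → E d × E d → ℝ)⁻¹ = locWt (-a) (-p) (-q) := by
  funext i v
  simp only [locWt, Pi.inv_apply, mul_inv]
  rw [Real.rpow_neg (lam_pos _).le, Real.rpow_neg (zero_le_one.trans (one_le_sepWt _ _ _)),
    Real.rpow_neg (zero_le_one.trans (one_le_freqWt _ _))]

theorem locWt_le {a p q a' p' q' : ℝ} (h1 : a ≤ a') (h2 : p ≤ p') (h3 : q ≤ q') (i : LocIdx d)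
    (v : E d × E d) : locWt a p q i v ≤ locWt a' p' q' i v := by
  have hs := one_le_sepWt i.2.1 v.1 v.2
  have hf := one_le_freqWt i.2.2 v.2
  refine mul_le_mul (mul_le_mul (Real.rpow_le_rpow_of_exponent_le (one_le_lam _) h1)
    (Real.rpow_le_rpow_of_exponent_le hs h2) (by positivity)
    (Real.rpow_nonneg (lam_pos _).le _)) (Real.rpow_le_rpow_of_exponent_le hf h3) (by positivity) ?_
  exact mul_nonneg (Real.rpow_nonneg (lam_pos _).le _) (by positivity)

theorem locMult_nonneg (j : Fin (d + 1) ⊕ Fin (d + 1)) (i : LocIdx d) (v : E d × E d) :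
    0 ≤ locMult j i v := by
  cases j <;> exact (locWt_pos _ _ _ i v).le

variable {w w' : LocIdx d → E d × E d → ℝ} {k : ℕ} {g g' : LocIdx d → E d × E d → ℂ}
  {a p q a' p' q' : ℝ}

/-- Families of functions of `(y, η)` with derivatives bounded by `w`, up to word length `k`. -/
def LocLE (k : ℕ) (w : LocIdx d → E d × E d → ℝ) (g : LocIdx d → E d × E d → ℂ) : Prop :=
  Cls locField locMult k w g

theorem LocLE.mono (h : LocLE k w g) (hw : ∀ i v, w i v ≤ w' i v) : LocLE k w' g :=
  Cls.mono locMult_nonneg h zero_le_one (by simpa using hw)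

theorem LocLE.mono_wt (h : LocLE k (locWt a p q) g) (h1 : a ≤ a') (h2 : p ≤ p') (h3 : q ≤ q') :
    LocLE k (locWt a' p' q') g := h.mono (locWt_le h1 h2 h3)

theorem LocLE.mul (h : LocLE k w g) (h' : LocLE k w' g') : LocLE k (w * w') (g * g') := Cls.mul h h'

theorem LocLE.mul_wt (h : LocLE k (locWt a p q) g) (h' : LocLE k (locWt a' p' q') g') :
    LocLE k (locWt (a + a') (p + p') (q + q')) (g * g') := by
  rw [← locWt_mul]
  exact Cls.mul h h'

theorem LocLE.const (z : ℂ) : LocLE k (locWt 0 0 0) (fun _ (_ : E d × E d) => z) := by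
  rw [locWt_zero]
  exact Cls.const locMult_nonneg z

theorem LocLE.zero : LocLE k (locWt a p q) (0 : LocIdx d → E d × E d → ℂ) :=
  Cls.zero locMult_nonneg fun i v => (locWt_pos _ _ _ i v).le

theorem LocLE.congr (h : LocLE k w g) (e : g' = g) : LocLE k w g' := e ▸ h

theorem locLE_succ (h0 : SmoothBdd (locWt a p q) g)
    (h1 : ∀ j, LocLE k (locWt (a + 1) p q) (along (locField (.inl j)) g))
    (h2 : ∀ j, LocLE k (locWt (a - 1) p q) (along (locField (.inr j)) g)) :
    LocLE (k + 1) (locWt a p q) g := by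
  refine ⟨h0, fun j => ?_⟩
  cases j with
  | inl j =>
    simp only [locMult, locWt_mul, add_zero]
    exact h1 j
  | inr j =>
    simp only [locMult, locWt_mul, add_zero, ← sub_eq_add_neg]
    exact h2 j

theorem contDiff_coord_fst (l : Fin (d + 1)) : ContDiff ℝ ∞ fun v : E d × E d => v.1 l :=
  (EuclideanSpace.proj (𝕜 := ℝ) l).contDiff.comp contDiff_fst

theorem contDiff_coord_snd (l : Fin (d + 1)) : ContDiff ℝ ∞ fun v : E d × E d => v.2 l :=
  (EuclideanSpace.proj (𝕜 := ℝ) l).contDiff.comp contDiff_snd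

theorem fderiv_coord_fst (l : Fin (d + 1)) (v t : E d × E d) :
    fderiv ℝ (fun v : E d × E d => v.1 l) v t = t.1 l := by
  have h := ((EuclideanSpace.proj (𝕜 := ℝ) l).comp
    (ContinuousLinearMap.fst ℝ (E d) (E d))).hasFDerivAt (x := v)
  have h' : fderiv ℝ (fun v : E d × E d => v.1 l) v = _ := h.fderiv
  rw [h']
  rfl

theorem fderiv_coord_snd (l : Fin (d + 1)) (v t : E d × E d) :
    fderiv ℝ (fun v : E d × E d => v.2 l) v t = t.2 l := by
  have h := ((EuclideanSpace.proj (𝕜 := ℝ) l).comp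
    (ContinuousLinearMap.snd ℝ (E d) (E d))).hasFDerivAt (x := v)
  have h' : fderiv ℝ (fun v : E d × E d => v.2 l) v = _ := h.fderiv
  rw [h']
  rfl

/-- The functions `(x - y)_l`. -/
def xyF (l : Fin (d + 1)) : LocIdx d → E d × E d → ℂ := fun i v => ((i.2.1 l - v.1 l : ℝ) : ℂ)

/-- The functions `(η - ξ)_l`. -/
def freqF (l : Fin (d + 1)) : LocIdx d → E d × E d → ℂ := fun i v => ((v.2 l - i.2.2 l : ℝ) : ℂ)

/-- The functions `η_l`. -/
def etaF (l : Fin (d + 1)) : LocIdx d → E d × E d → ℂ := fun _ v => (v.2 l : ℂ)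

theorem locLE_xyF (l : Fin (d + 1)) (k : ℕ) : LocLE k (locWt (-1) 1 0) (xyF (d := d) l) := by
  have hc : ∀ i : LocIdx d, ContDiff ℝ ∞ fun v : E d × E d => i.2.1 l - v.1 l := fun i =>
    contDiff_const.sub (contDiff_coord_fst l)
  have h0 : SmoothBdd (locWt (-1) 1 0) (xyF (d := d) l) := by
    refine ⟨fun i => AdaptedFrame.ofReal_contDiff (hc i), 1, zero_le_one, fun i v => ?_⟩
    have h1 := PiLp.norm_apply_le (i.2.1 - v.1) l
    have hl := lam_pos v.2
    rw [xyF, Complex.norm_real, one_mul, locWt, Real.rpow_neg_one, Real.rpow_one, Real.rpow_zero,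
      mul_one, inv_mul_eq_div, le_div_iff₀ hl, sepWt, mul_comm]
    have h2 := mul_le_mul_of_nonneg_left h1 hl.le
    rw [PiLp.sub_apply] at h2
    exact h2.trans (by rw [lam]; linarith)
  have ha : ∀ X : E d × E d → E d × E d, along X (xyF l)
      = fun (_ : LocIdx d) v => ((-(X v).1 l : ℝ) : ℂ) := by
    intro X
    funext i v
    change fderiv ℝ (fun v : E d × E d => ((i.2.1 l - v.1 l : ℝ) : ℂ)) v (X v) = _
    rw [fderiv_ofReal_comp ((hc i).diff_top v), fderiv_const_sub, neg_apply,
      fderiv_coord_fst]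
  cases k with
  | zero => exact h0
  | succ k =>
    refine locLE_succ h0 (fun j => ?_) (fun j => ?_) <;> rw [ha] <;> simp only [locField]
    · exact (LocLE.const _).mono_wt (by norm_num) zero_le_one le_rfl
    · exact LocLE.zero.congr (by funext i v; simp)

theorem locLE_freqF (l : Fin (d + 1)) (k : ℕ) : LocLE k (locWt 1 0 1) (freqF (d := d) l) := by
  have hc : ∀ i : LocIdx d, ContDiff ℝ ∞ fun v : E d × E d => v.2 l - i.2.2 l := fun i =>
    (contDiff_coord_snd l).sub contDiff_const
  have h0 : SmoothBdd (locWt 1 0 1) (freqF (d := d) l) := by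
    refine ⟨fun i => AdaptedFrame.ofReal_contDiff (hc i), 1, zero_le_one, fun i v => ?_⟩
    have h1 := PiLp.norm_apply_le (v.2 - i.2.2) l
    have hl := lam_pos v.2
    rw [PiLp.sub_apply] at h1
    rw [freqF, Complex.norm_real, one_mul, locWt, Real.rpow_one, Real.rpow_one, Real.rpow_zero,
      mul_one, freqWt, mul_add, mul_div_cancel₀ _ hl.ne']
    linarith
  have ha : ∀ X : E d × E d → E d × E d, along X (freqF l)
      = fun (_ : LocIdx d) v => (((X v).2 l : ℝ) : ℂ) := by
    intro X
    funext i v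
    change fderiv ℝ (fun v : E d × E d => ((v.2 l - i.2.2 l : ℝ) : ℂ)) v (X v) = _
    rw [fderiv_ofReal_comp ((hc i).diff_top v), fderiv_sub_const, fderiv_coord_snd]
  cases k with
  | zero => exact h0
  | succ k =>
    refine locLE_succ h0 (fun j => ?_) (fun j => ?_) <;> rw [ha] <;> simp only [locField]
    · exact LocLE.zero.congr (by funext i v; simp)
    · exact (LocLE.const _).mono_wt (by norm_num) le_rfl zero_le_one

theorem locLE_etaF (l : Fin (d + 1)) (k : ℕ) : LocLE k (locWt 2 0 0) (etaF (d := d) l) := by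
  have h0 : SmoothBdd (locWt 2 0 0) (etaF (d := d) l) := by
    refine ⟨fun i => AdaptedFrame.ofReal_contDiff (contDiff_coord_snd l), 1, zero_le_one,
      fun i v => ?_⟩
    have h1 := PiLp.norm_apply_le v.2 l
    rw [etaF, Complex.norm_real, one_mul, locWt, Real.rpow_zero, Real.rpow_zero, mul_one, mul_one,
      Real.rpow_two, lam_sq]
    linarith
  have ha : ∀ X : E d × E d → E d × E d, along X (etaF l)
      = fun (_ : LocIdx d) v => (((X v).2 l : ℝ) : ℂ) := by
    intro X
    funext i v
    change fderiv ℝ (fun v : E d × E d => ((v.2 l : ℝ) : ℂ)) v (X v) = _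
    rw [fderiv_ofReal_comp ((contDiff_coord_snd l).diff_top v), fderiv_coord_snd]
  cases k with
  | zero => exact h0
  | succ k =>
    refine locLE_succ h0 (fun j => ?_) (fun j => ?_) <;> rw [ha] <;> simp only [locField]
    · exact LocLE.zero.congr (by funext i v; simp)
    · exact (LocLE.const _).mono_wt (by norm_num) le_rfl le_rfl

/-- A smooth function comparable to `(1 + |η|)^{1/2}`. -/
def Lam (η : E d) : ℝ := (1 + ‖η‖ ^ 2) ^ (1 / 4 : ℝ)

theorem one_add_sq_pos (η : E d) : 0 < 1 + ‖η‖ ^ 2 := by positivity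

theorem Lam_pos (η : E d) : 0 < Lam η := Real.rpow_pos_of_pos (one_add_sq_pos η) _

theorem Lam_pow (η : E d) : Lam η ^ 4 = 1 + ‖η‖ ^ 2 := by
  rw [Lam, ← Real.rpow_natCast, ← Real.rpow_mul (one_add_sq_pos η).le]
  norm_num

theorem Lam_le_lam (η : E d) : Lam η ≤ lam η := by
  rw [← pow_le_pow_iff_left₀ (Lam_pos η).le (lam_pos η).le (n := 4) (by norm_num), Lam_pow,
    show lam η ^ 4 = (lam η ^ 2) ^ 2 by ring, lam_sq]
  nlinarith [norm_nonneg η]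

theorem lam_le_Lam (η : E d) : lam η ≤ 2 * Lam η := by
  rw [← pow_le_pow_iff_left₀ (lam_pos η).le (by linarith [Lam_pos η]) (n := 4) (by norm_num),
    mul_pow, Lam_pow, show lam η ^ 4 = (lam η ^ 2) ^ 2 by ring, lam_sq]
  nlinarith [sq_nonneg (‖η‖ - 1), norm_nonneg η, sq_nonneg ‖η‖]

theorem contDiff_Lam : ContDiff ℝ ∞ (Lam (d := d)) :=
  (contDiff_const.add (contDiff_norm_sq ℝ)).rpow_const_of_ne fun η => (one_add_sq_pos η).ne'

theorem fderiv_Lam (η t : E d) :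
    fderiv ℝ Lam η t = 1 / 2 * inner ℝ η t * ((Lam η)⁻¹ * (Lam η)⁻¹ * (Lam η)⁻¹) := by
  have h1 : HasFDerivAt (fun η : E d => 1 + ‖η‖ ^ 2) (2 • innerSL ℝ η) η :=
    (hasStrictFDerivAt_norm_sq η).hasFDerivAt.const_add 1
  have h2 := h1.rpow_const (p := 1 / 4) (Or.inl (one_add_sq_pos η).ne')
  have h3 : fderiv ℝ Lam η = _ := h2.fderiv
  have h4 : (1 + ‖η‖ ^ 2) ^ ((1 : ℝ) / 4 - 1) = (Lam η)⁻¹ * (Lam η)⁻¹ * (Lam η)⁻¹ := by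
    rw [← mul_inv, ← mul_inv, show Lam η * Lam η * Lam η = Lam η ^ 3 by ring, Lam,
      ← Real.rpow_natCast _ 3, ← Real.rpow_mul (one_add_sq_pos η).le,
      ← Real.rpow_neg (one_add_sq_pos η).le]
    norm_num
  rw [h3, h4]
  simp
  ring

/-- The smooth scale as a family of functions of `(y, η)`. -/
def lamF : LocIdx d → E d × E d → ℂ := fun _ v => (Lam v.2 : ℂ)

/-- Stated at a fixed word length because the induction for Λ itself needs it: ∂_jΛ = (1/2) η_j Λ⁻³.
-/
theorem lamF_inv_of (h : LocLE k (locWt 1 0 0) (lamF (d := d))) :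
    LocLE k (locWt (-1) 0 0) (lamF (d := d))⁻¹ := by
  have := Cls.inv (c := 1 / 2) (by norm_num) (fun i v => locWt_pos _ _ _ i v) locMult_nonneg h
    fun i v => by
      have := lam_le_Lam v.2
      simp only [locWt, Real.rpow_one, Real.rpow_zero, mul_one, lamF, Complex.norm_real,
        Real.norm_eq_abs, abs_of_pos (Lam_pos v.2)]
      linarith
  rw [locWt_inv, neg_zero] at this
  exact this

theorem locLE_lamF (k : ℕ) : LocLE k (locWt 1 0 0) (lamF (d := d)) := by
  have h0 : SmoothBdd (locWt 1 0 0) (lamF (d := d)) := by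
    refine ⟨fun i => AdaptedFrame.ofReal_contDiff (contDiff_Lam.comp contDiff_snd), 1, zero_le_one,
      fun i v => ?_⟩
    have := Lam_le_lam v.2
    simpa only [locWt, Real.rpow_one, Real.rpow_zero, mul_one, one_mul, lamF, Complex.norm_real,
        Real.norm_eq_abs, abs_of_pos (Lam_pos v.2)] using this
  have ha : ∀ X : E d × E d → E d × E d, along X lamF
      = fun (_ : LocIdx d) v => ((fderiv ℝ Lam v.2 (X v).2 : ℝ) : ℂ) := by
    intro X
    funext i v
    have := AdaptedFrame.fderiv_comp_snd (g := fun η : E d => (Lam η : ℂ))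
      (AdaptedFrame.ofReal_differentiable contDiff_Lam.diff_top) v (X v)
    refine this.trans ?_
    rw [fderiv_ofReal_comp (contDiff_Lam.diff_top _)]
  induction k with
  | zero => exact h0
  | succ k ih =>
    refine locLE_succ h0 (fun j => ?_) (fun j => ?_) <;> rw [ha] <;> simp only [locField]
    · exact LocLE.zero.congr (by funext i v; simp)
    · have e : (fun (_ : LocIdx d) (v : E d × E d) => ((fderiv ℝ Lam v.2 (coordVec j) : ℝ) : ℂ))
          = (fun _ _ => (1 / 2 : ℂ)) * etaF j * (lamF⁻¹ * lamF⁻¹ * lamF⁻¹) := by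
        funext i v
        rw [fderiv_Lam, real_inner_comm, coord_eq_inner]
        simp [etaF, lamF]
      rw [e]
      have hi := lamF_inv_of ih
      exact (((LocLE.const _).mul_wt (locLE_etaF j k)).mul_wt
        ((hi.mul_wt hi).mul_wt hi)).mono_wt (by norm_num) (by norm_num) (by norm_num)

theorem locLE_lamF_inv (k : ℕ) : LocLE k (locWt (-1) 0 0) (lamF (d := d))⁻¹ :=
  lamF_inv_of (locLE_lamF k)

theorem LocLE.add (h : LocLE k w g) (h' : LocLE k w g') : LocLE k w (g + g') := Cls.add h h'

theorem LocLE.sum {τ : Type*} (hw : ∀ i v, 0 ≤ w i v) (s : Finset τ)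
    {g : τ → LocIdx d → E d × E d → ℂ}
    (h : ∀ t ∈ s, LocLE k w (g t)) : LocLE k w (∑ t ∈ s, g t) :=
  Cls.sum locMult_nonneg hw s h

/-- The rescaled differences `Λ(η) (x - y)_l`. -/
def sepF (l : Fin (d + 1)) : LocIdx d → E d × E d → ℂ := lamF * xyF l

/-- The rescaled differences `(η - ξ)_l / Λ(η)`. -/
def relF (l : Fin (d + 1)) : LocIdx d → E d × E d → ℂ := lamF⁻¹ * freqF l

/-- The function `1 + Λ(η)² |x - y|²`. -/
def sepSq : LocIdx d → E d × E d → ℂ := (fun _ _ => 1) + ∑ l, sepF l * sepF l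

/-- The function `1 + |η - ξ|² / Λ(η)²`. -/
def relSq : LocIdx d → E d × E d → ℂ := (fun _ _ => 1) + ∑ l, relF l * relF l

theorem locLE_sepF (l : Fin (d + 1)) (k : ℕ) : LocLE k (locWt 0 1 0) (sepF (d := d) l) :=
  ((locLE_lamF k).mul_wt (locLE_xyF l k)).mono_wt (by norm_num) (by norm_num) (by norm_num)

theorem locLE_relF (l : Fin (d + 1)) (k : ℕ) : LocLE k (locWt 0 0 1) (relF (d := d) l) :=
  ((locLE_lamF_inv k).mul_wt (locLE_freqF l k)).mono_wt (by norm_num) (by norm_num) (by norm_num)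

theorem sepSq_eq (i : LocIdx d) (v : E d × E d) :
    sepSq i v = ((1 + Lam v.2 ^ 2 * ‖i.2.1 - v.1‖ ^ 2 : ℝ) : ℂ) := by
  simp only [sepSq, sepF, lamF, xyF, Pi.add_apply, Finset.sum_apply, Pi.mul_apply,
    EuclideanSpace.real_norm_sq_eq, Finset.mul_sum, PiLp.sub_apply]
  push_cast
  congr 1
  exact Finset.sum_congr rfl fun l _ => by ring

theorem relSq_eq (i : LocIdx d) (v : E d × E d) :
    relSq i v = ((1 + ((Lam v.2)⁻¹) ^ 2 * ‖v.2 - i.2.2‖ ^ 2 : ℝ) : ℂ) := by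
  simp only [relSq, relF, lamF, freqF, Pi.add_apply, Finset.sum_apply, Pi.mul_apply, Pi.inv_apply,
    EuclideanSpace.real_norm_sq_eq, Finset.mul_sum, PiLp.sub_apply]
  push_cast
  congr 1
  exact Finset.sum_congr rfl fun l _ => by ring

theorem sepSq_ne_zero (i : LocIdx d) (v : E d × E d) : sepSq i v ≠ 0 := by
  rw [sepSq_eq, Complex.ofReal_ne_zero]
  positivity

theorem relSq_ne_zero (i : LocIdx d) (v : E d × E d) : relSq i v ≠ 0 := by
  rw [relSq_eq, Complex.ofReal_ne_zero]
  positivity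

theorem locLE_sepSq_inv (k : ℕ) : LocLE k (locWt 0 (-2) 0) (sepSq (d := d))⁻¹ := by
  have h : LocLE k (locWt 0 2 0) (sepSq (d := d)) := by
    refine ((LocLE.const 1).mono_wt le_rfl (by norm_num) le_rfl).add
      (LocLE.sum (fun i v => (locWt_pos _ _ _ i v).le) _ fun l _ => ?_)
    exact ((locLE_sepF l k).mul_wt (locLE_sepF l k)).mono_wt (by norm_num) (by norm_num)
      (by norm_num)
  -- The constant: (1 + λ|x-y|)² ≤ 2 + 2λ²|x-y|² and λ ≤ 2Λ give at most 8(1 + Λ²|x-y|²).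
  have := Cls.inv (c := 1 / 8) (by norm_num) (fun i v => locWt_pos _ _ _ i v) locMult_nonneg h
    fun i v => by
      have h1 := lam_le_Lam v.2
      have h0 := lam_pos v.2
      have h2 : 0 ≤ ‖i.2.1 - v.1‖ := norm_nonneg _
      have h3 : (lam v.2 * ‖i.2.1 - v.1‖) ^ 2 ≤ (2 * Lam v.2 * ‖i.2.1 - v.1‖) ^ 2 := by gcongr
      rw [sepSq_eq, Complex.norm_real, Real.norm_eq_abs, abs_of_nonneg (by positivity), locWt,
        Real.rpow_zero, Real.rpow_zero, mul_one, one_mul,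
        Real.rpow_two, sepWt]
      rw [lam] at h3
      nlinarith [sq_nonneg (Real.sqrt (1 + ‖v.2‖) * ‖i.2.1 - v.1‖ - 1)]
  rw [locWt_inv, neg_zero] at this
  exact this

theorem locLE_relSq_inv (k : ℕ) : LocLE k (locWt 0 0 (-2)) (relSq (d := d))⁻¹ := by
  have h : LocLE k (locWt 0 0 2) (relSq (d := d)) := by
    refine ((LocLE.const 1).mono_wt le_rfl le_rfl (by norm_num)).add
      (LocLE.sum (fun i v => (locWt_pos _ _ _ i v).le) _ fun l _ => ?_)
    exact ((locLE_relF l k).mul_wt (locLE_relF l k)).mono_wt (by norm_num) (by norm_num)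
      (by norm_num)
  -- Here λ⁻¹ ≤ Λ⁻¹ has no constant, so only (1+t)² ≤ 2(1+t²) enters.
  have := Cls.inv (c := 1 / 2) (by norm_num) (fun i v => locWt_pos _ _ _ i v) locMult_nonneg h
    fun i v => by
      have h1 := inv_anti₀ (Lam_pos v.2) (Lam_le_lam v.2)
      have h0 := inv_pos.mpr (lam_pos v.2)
      have h2 : 0 ≤ ‖v.2 - i.2.2‖ := norm_nonneg _
      have h3 : ((lam v.2)⁻¹ * ‖v.2 - i.2.2‖) ^ 2 ≤ ((Lam v.2)⁻¹ * ‖v.2 - i.2.2‖) ^ 2 := by gcongr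
      rw [relSq_eq, Complex.norm_real, Real.norm_eq_abs, abs_of_nonneg (by positivity), locWt,
        Real.rpow_zero, Real.rpow_zero, mul_one, one_mul,
        Real.rpow_two, freqWt, div_eq_inv_mul ‖v.2 - i.2.2‖]
      nlinarith [sq_nonneg ((lam v.2)⁻¹ * ‖v.2 - i.2.2‖ - 1)]
  rw [locWt_inv, neg_zero] at this
  exact this

end LocalClass

/-! ### Integration by parts in y and in η. -/

section Steps

open Filter Topology

variable {d : ℕ}

/-- Families of smooth functions of compact support. -/
def LocTest (g : LocIdx d → E d × E d → ℂ) : Prop :=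
  ∀ i, ContDiff ℝ ∞ (g i) ∧ HasCompactSupport (g i)

variable {g g' : LocIdx d → E d × E d → ℂ} {w : LocIdx d → E d × E d → ℝ}

theorem LocTest.mul_left {b : LocIdx d → E d × E d → ℂ} (hb : ∀ i, ContDiff ℝ ∞ (b i))
    (h : LocTest g) : LocTest (b * g) := fun i => ⟨(hb i).mul (h i).1, (h i).2.mul_left⟩

theorem LocTest.along (h : LocTest g) (j : Fin (d + 1) ⊕ Fin (d + 1)) :
    LocTest (along (locField j) g) := fun i => by
  refine ⟨((h i).1.fderiv_right (by simp)).clm_apply ?_, hasCompactSupport_lie (h i).2 _⟩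
  cases j <;> exact contDiff_const

theorem LocTest.add (h : LocTest g) (h' : LocTest g') : LocTest (g + g') := fun i =>
  ⟨(h i).1.add (h' i).1, (h i).2.add (h' i).2⟩

theorem LocTest.sum {τ : Type*} (s : Finset τ) {g : τ → LocIdx d → E d × E d → ℂ}
    (h : ∀ t ∈ s, LocTest (g t)) : LocTest (∑ t ∈ s, g t) := by
  classical
  induction s using Finset.induction_on with
  | empty =>
    rw [Finset.sum_empty]
    exact fun i => ⟨contDiff_const, HasCompactSupport.zero⟩
  | insert a s ha ih =>
    rw [Finset.sum_insert ha]
    exact (h a (Finset.mem_insert_self _ _)).add (ih fun t ht => h t (Finset.mem_insert_of_mem ht))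

/-- The coefficients of the integration by parts in `η`. -/
def coefA (k : Fin (d + 1)) : LocIdx d → E d × E d → ℂ := lamF * sepF k * sepSq⁻¹

/-- The coefficients of the integration by parts in `y`. -/
def coefB (k : Fin (d + 1)) : LocIdx d → E d × E d → ℂ := lamF⁻¹ * relF k * relSq⁻¹

/-- One integration by parts in `η`. -/
def stepA (g : LocIdx d → E d × E d → ℂ) : LocIdx d → E d × E d → ℂ :=
  sepSq⁻¹ * g + ∑ k, (fun _ _ => -(2 * Real.pi * Complex.I)⁻¹) *
    along (locField (.inr k)) (coefA k * g)

/-- One integration by parts in `y`. -/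
def stepB (g : LocIdx d → E d × E d → ℂ) : LocIdx d → E d × E d → ℂ :=
  relSq⁻¹ * g + ∑ k, (fun _ _ => (2 * Real.pi * Complex.I)⁻¹) *
    along (locField (.inl k)) (coefB k * g)

theorem locLE_coefA (j : Fin (d + 1)) (k : ℕ) : LocLE k (locWt 1 (-1) 0) (coefA (d := d) j) :=
  (((locLE_lamF k).mul_wt (locLE_sepF j k)).mul_wt (locLE_sepSq_inv k)).mono_wt
    (by norm_num) (by norm_num) (by norm_num)

theorem locLE_coefB (j : Fin (d + 1)) (k : ℕ) : LocLE k (locWt (-1) 0 (-1)) (coefB (d := d) j) :=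
  (((locLE_lamF_inv k).mul_wt (locLE_relF j k)).mul_wt (locLE_relSq_inv k)).mono_wt
    (by norm_num) (by norm_num) (by norm_num)

/-- The coefficient is of size λ, the derivative ∂_η gains λ⁻¹, and one power of the separation
weight remains as a gain. The weight w of g plays no part in this balance. -/
theorem locLE_stepA (hw : ∀ i v, 0 ≤ w i v) (h : ∀ k, LocLE k w g) (k : ℕ) :
    LocLE k (locWt 0 (-1) 0 * w) (stepA g) := by
  have hw' : ∀ i v, 0 ≤ (locWt 0 (-1) 0 * w : LocIdx d → E d × E d → ℝ) i v := fun i v =>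
    mul_nonneg (locWt_pos _ _ _ i v).le (hw i v)
  refine LocLE.add ?_ (LocLE.sum hw' _ fun j _ => ?_)
  · exact ((locLE_sepSq_inv k).mono_wt le_rfl (by norm_num) le_rfl).mul (h k)
  · have h1 : LocLE k (locWt 1 (-1) 0 * w * locWt (-1) 0 0) _ :=
      ((locLE_coefA j (k + 1)).mul (h (k + 1))).along (.inr j)
    have h2 := (LocLE.const (-(2 * Real.pi * Complex.I)⁻¹)).mul h1
    rw [show locWt 0 0 0 * (locWt 1 (-1) 0 * w * locWt (-1) 0 0)
      = locWt 0 0 0 * (locWt 1 (-1) 0 * locWt (-1) 0 0) * w by ring, locWt_mul, locWt_mul,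
      show (0 : ℝ) + (1 + -1) = 0 by norm_num, show (0 : ℝ) + (-1 + 0) = -1 by norm_num,
      show (0 : ℝ) + (0 + 0) = 0 by norm_num] at h2
    exact h2

theorem locLE_stepB (hw : ∀ i v, 0 ≤ w i v) (h : ∀ k, LocLE k w g) (k : ℕ) :
    LocLE k (locWt 0 0 (-1) * w) (stepB g) := by
  have hw' : ∀ i v, 0 ≤ (locWt 0 0 (-1) * w : LocIdx d → E d × E d → ℝ) i v := fun i v =>
    mul_nonneg (locWt_pos _ _ _ i v).le (hw i v)
  refine LocLE.add ?_ (LocLE.sum hw' _ fun j _ => ?_)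
  · exact ((locLE_relSq_inv k).mono_wt le_rfl le_rfl (by norm_num)).mul (h k)
  · have h1 : LocLE k (locWt (-1) 0 (-1) * w * locWt 1 0 0) _ :=
      ((locLE_coefB j (k + 1)).mul (h (k + 1))).along (.inl j)
    have h2 := (LocLE.const ((2 * Real.pi * Complex.I)⁻¹)).mul h1
    rw [show locWt 0 0 0 * (locWt (-1) 0 (-1) * w * locWt 1 0 0)
      = locWt 0 0 0 * (locWt (-1) 0 (-1) * locWt 1 0 0) * w by ring, locWt_mul, locWt_mul,
      show (0 : ℝ) + (-1 + 1) = 0 by norm_num, show (0 : ℝ) + (-1 + 0) = -1 by norm_num,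
      show (0 : ℝ) + (0 + 0) = 0 by norm_num] at h2
    exact h2

theorem locTest_stepA (h : LocTest g) : LocTest (stepA g) :=
  (h.mul_left fun i => (locLE_sepSq_inv 0).contDiff i).add (LocTest.sum _ fun j _ =>
    ((h.mul_left fun i => (locLE_coefA j 0).contDiff i).along _).mul_left fun _ => contDiff_const)

theorem locTest_stepB (h : LocTest g) : LocTest (stepB g) :=
  (h.mul_left fun i => (locLE_relSq_inv 0).contDiff i).add (LocTest.sum _ fun j _ =>
    ((h.mul_left fun i => (locLE_coefB j 0).contDiff i).along _).mul_left fun _ => contDiff_const)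

/-- Insert 1 = (1 + ∑ Λ²(x-y)_k²)/`sepSq` and write each summand as (x-y)_k times `coefA k`; under
the integral (x-y)_k acts as an η-derivative of the amplitude. The summand 1 avoids a singularity at
y = x. -/
theorem oscInt_stepA (h : LocTest g) (i : LocIdx d) :
    oscInt (stepA g i) i.2 = oscInt (g i) i.2 := by
  have t0 := h.mul_left fun i => (locLE_sepSq_inv (d := d) 0).contDiff i
  have t1 : ∀ k, LocTest (coefA k * g) := fun k =>
    h.mul_left fun i => (locLE_coefA k 0).contDiff i
  have t2 : ∀ k, LocTest ((fun _ _ => -(2 * Real.pi * Complex.I)⁻¹) *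
      along (locField (.inr k)) (coefA k * g)) := fun k =>
    ((t1 k).along _).mul_left fun _ => contDiff_const
  have t3 : ∀ k, LocTest (xyF k * (coefA k * g)) := fun k =>
    (t1 k).mul_left fun i => (locLE_xyF k 0).contDiff i
  have e : g = sepSq⁻¹ * g + ∑ k, xyF k * (coefA k * g) := by
    funext i v
    have h1 : (1 : ℂ) + ∑ k, sepF k i v * sepF k i v = sepSq i v := by simp [sepSq]
    have h2 := sepSq_ne_zero i v
    simp only [Pi.add_apply, Pi.mul_apply, Pi.inv_apply, Finset.sum_apply, coefA]
    have h3 : ∀ k, xyF k i v * (lamF i v * sepF k i v * (sepSq i v)⁻¹ * g i v)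
        = sepF k i v * sepF k i v * ((sepSq i v)⁻¹ * g i v) := fun k => by
      simp only [sepF, Pi.mul_apply]
      ring
    simp_rw [h3]
    rw [← Finset.sum_mul, ← one_add_mul, h1, mul_inv_cancel_left₀ h2]
  have a1 := oscInt_add (p := i.2) (t0 i).1.continuous (t0 i).2
    (LocTest.sum Finset.univ (fun k _ => t2 k) i).1.continuous
    (LocTest.sum Finset.univ (fun k _ => t2 k) i).2
  have a2 := oscInt_add (p := i.2) (t0 i).1.continuous (t0 i).2
    (LocTest.sum Finset.univ (fun k _ => t3 k) i).1.continuous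
    (LocTest.sum Finset.univ (fun k _ => t3 k) i).2
  conv_rhs => rw [e]
  refine a1.trans (Eq.trans ?_ a2.symm)
  congr 1
  rw [Finset.sum_apply, Finset.sum_apply,
    oscInt_sum _ (fun k _ => (t2 k i).1.continuous) fun k _ => (t2 k i).2,
    oscInt_sum _ (fun k _ => (t3 k i).1.continuous) fun k _ => (t3 k i).2]
  refine Finset.sum_congr rfl fun k _ => ?_
  refine Eq.trans ?_ (oscInt_sub_y (p := i.2) (t1 k i).1 (t1 k i).2 k).symm
  rw [← neg_mul]
  exact oscInt_const_mul _

/-- Same device with 1 = (1 + ∑ Λ⁻²(η-ξ)_k²)/`relSq`, the factor (η-ξ)_k turning into a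
y-derivative. -/
theorem oscInt_stepB (h : LocTest g) (i : LocIdx d) :
    oscInt (stepB g i) i.2 = oscInt (g i) i.2 := by
  have t0 := h.mul_left fun i => (locLE_relSq_inv (d := d) 0).contDiff i
  have t1 : ∀ k, LocTest (coefB k * g) := fun k =>
    h.mul_left fun i => (locLE_coefB k 0).contDiff i
  have t2 : ∀ k, LocTest ((fun _ _ => (2 * Real.pi * Complex.I)⁻¹) *
      along (locField (.inl k)) (coefB k * g)) := fun k =>
    ((t1 k).along _).mul_left fun _ => contDiff_const
  have t3 : ∀ k, LocTest (freqF k * (coefB k * g)) := fun k =>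
    (t1 k).mul_left fun i => (locLE_freqF k 0).contDiff i
  have e : g = relSq⁻¹ * g + ∑ k, freqF k * (coefB k * g) := by
    funext i v
    have h1 : (1 : ℂ) + ∑ k, relF k i v * relF k i v = relSq i v := by simp [relSq]
    have h2 := relSq_ne_zero i v
    simp only [Pi.add_apply, Pi.mul_apply, Pi.inv_apply, Finset.sum_apply, coefB]
    have h3 : ∀ k, freqF k i v * ((lamF i v)⁻¹ * relF k i v * (relSq i v)⁻¹ * g i v)
        = relF k i v * relF k i v * ((relSq i v)⁻¹ * g i v) := fun k => by
      simp only [relF, Pi.mul_apply, Pi.inv_apply]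
      ring
    simp_rw [h3]
    rw [← Finset.sum_mul, ← one_add_mul, h1, mul_inv_cancel_left₀ h2]
  have a1 := oscInt_add (p := i.2) (t0 i).1.continuous (t0 i).2
    (LocTest.sum Finset.univ (fun k _ => t2 k) i).1.continuous
    (LocTest.sum Finset.univ (fun k _ => t2 k) i).2
  have a2 := oscInt_add (p := i.2) (t0 i).1.continuous (t0 i).2
    (LocTest.sum Finset.univ (fun k _ => t3 k) i).1.continuous
    (LocTest.sum Finset.univ (fun k _ => t3 k) i).2
  conv_rhs => rw [e]
  refine a1.trans (Eq.trans ?_ a2.symm)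
  congr 1
  rw [Finset.sum_apply, Finset.sum_apply,
    oscInt_sum _ (fun k _ => (t2 k i).1.continuous) fun k _ => (t2 k i).2,
    oscInt_sum _ (fun k _ => (t3 k i).1.continuous) fun k _ => (t3 k i).2]
  refine Finset.sum_congr rfl fun k _ => ?_
  refine Eq.trans ?_ (oscInt_eta_sub (p := i.2) (t1 k i).1 (t1 k i).2 k).symm
  exact oscInt_const_mul _

/-- Families that are eventually locally constant in the first index. -/
def LocStable (g : LocIdx d → E d × E d → ℂ) : Prop :=
  ∀ p v, ∃ h : E d × E d → ℂ, ∀ᶠ n in atTop, g (n, p) =ᶠ[𝓝 v] h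

theorem eventuallyEq_along {V : Type*} [NormedAddCommGroup V] [NormedSpace ℝ V] {v : V}
    {h h' : V → ℂ} (e : h =ᶠ[𝓝 v] h') (X : V → V) : lie X h =ᶠ[𝓝 v] lie X h' := by
  filter_upwards [e.fderiv (𝕜 := ℝ)] with q hq
  rw [lie, hq, lie]

/-- The coefficients of the steps do not involve the cutoff index, so local stabilisation survives;
it will provide the pointwise limit of the integrands. -/
theorem locStable_step {b : LocIdx d → E d × E d → ℂ} {a : Fin (d + 1) → LocIdx d → E d × E d → ℂ}
    (hb : ∀ n p, b (n, p) = b (0, p)) (ha : ∀ k n p, a k (n, p) = a k (0, p)) (z : ℂ)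
    (X : Fin (d + 1) → E d × E d → E d × E d) (h : LocStable g) :
    LocStable (b * g + ∑ k, (fun _ _ => z) * along (X k) (a k * g)) := by
  intro p v
  obtain ⟨f, hf⟩ := h p v
  refine ⟨b (0, p) * f + ∑ k, (fun _ => z) * lie (X k) (a k (0, p) * f), ?_⟩
  filter_upwards [hf] with n hn
  have h1 : ∀ c : E d × E d → ℂ, c * g (n, p) =ᶠ[𝓝 v] c * f := fun c =>
    (EventuallyEq.refl _ c).mul hn
  have h2 : ∀ᶠ q in 𝓝 v, ∀ k, lie (X k) (a k (0, p) * g (n, p)) q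
      = lie (X k) (a k (0, p) * f) q :=
    eventually_all.mpr fun k => eventuallyEq_along (h1 _) _
  filter_upwards [h1 (b (0, p)), h2] with q h3 h4
  simp only [Pi.add_apply, Finset.sum_apply, Pi.mul_apply] at h3 ⊢
  rw [hb, h3]
  congr 1
  refine Finset.sum_congr rfl fun k _ => ?_
  rw [← h4 k, ← ha k n p]
  rfl

theorem coefA_eq (k : Fin (d + 1)) (n : ℕ) (p : E d × E d) : coefA k (n, p) = coefA k (0, p) := by
  funext v
  simp only [coefA, sepF, Pi.mul_apply, Pi.inv_apply, sepSq_eq]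
  rfl

theorem coefB_eq (k : Fin (d + 1)) (n : ℕ) (p : E d × E d) : coefB k (n, p) = coefB k (0, p) := by
  funext v
  simp only [coefB, relF, Pi.mul_apply, Pi.inv_apply, relSq_eq]
  rfl

theorem sepSq_inv_eq (n : ℕ) (p : E d × E d) : sepSq⁻¹ (n, p) = sepSq⁻¹ (0, p) := by
  funext v
  simp only [Pi.inv_apply, sepSq_eq]

theorem relSq_inv_eq (n : ℕ) (p : E d × E d) : relSq⁻¹ (n, p) = relSq⁻¹ (0, p) := by
  funext v
  simp only [Pi.inv_apply, relSq_eq]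

theorem locStable_stepA (h : LocStable g) : LocStable (stepA g) :=
  locStable_step sepSq_inv_eq coefA_eq _ _ h

theorem locStable_stepB (h : LocStable g) : LocStable (stepB g) :=
  locStable_step relSq_inv_eq coefB_eq _ _ h

theorem exists_iterated_steps (K : ℕ) (hw : ∀ i v, 0 ≤ w i v) (h : ∀ k, LocLE k w g)
    (ht : LocTest g) (hs : LocStable g) : ∃ G : LocIdx d → E d × E d → ℂ,
      SmoothBdd (locWt 0 (-K) (-K) * w) G ∧ LocStable G ∧
        ∀ i, oscInt (G i) i.2 = oscInt (g i) i.2 := by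
  -- The induction must carry bounds for all word lengths, since every step uses up derivatives.
  suffices ∃ G : LocIdx d → E d × E d → ℂ, (∀ k, LocLE k (locWt 0 (-K) (-K) * w) G) ∧ LocTest G ∧
      LocStable G ∧ ∀ i, oscInt (G i) i.2 = oscInt (g i) i.2 by
    obtain ⟨G, h1, h2, h3, h4⟩ := this
    exact ⟨G, (h1 0).smoothBdd, h3, h4⟩
  induction K with
  | zero =>
    refine ⟨g, ?_, ht, hs, fun i => rfl⟩
    simpa [locWt_zero] using h
  | succ K ih =>
    obtain ⟨G, h1, h2, h3, h4⟩ := ih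
    have hw1 : ∀ i v, 0 ≤ (locWt 0 (-K) (-K) * w : LocIdx d → E d × E d → ℝ) i v := fun i v =>
      mul_nonneg (locWt_pos _ _ _ i v).le (hw i v)
    have hA := locLE_stepA hw1 h1
    have hw2 : ∀ i v, 0 ≤ (locWt 0 (-1) 0 * (locWt 0 (-K) (-K) * w) : LocIdx d → E d × E d → ℝ) i v := fun i v =>
      mul_nonneg (locWt_pos _ _ _ i v).le (hw1 i v)
    have hB := locLE_stepB hw2 hA
    refine ⟨stepB (stepA G), fun k => ?_, locTest_stepB (locTest_stepA h2),
      locStable_stepB (locStable_stepA h3), fun i => ?_⟩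
    · have := hB k
      rw [← mul_assoc, ← mul_assoc, locWt_mul, locWt_mul] at this
      convert this using 3 <;> push_cast <;> ring
    · rw [oscInt_stepB (locTest_stepA h2), oscInt_stepA h2, h4]

end Steps

/-! ### Temperate weights and the uniform bound on oscillatory integrals. -/

section BaseEstimate

open Filter Topology

variable {d : ℕ}

theorem norm_sub_le_lam_mul (ξ η : E d) : ‖η - ξ‖ = lam η * (freqWt ξ η - 1) := by
  rw [freqWt, add_sub_cancel_left, mul_div_cancel₀ _ (lam_pos η).ne']

/-- Slow variation of λ: λ² is 1-Lipschitz, and |η-ξ| is λ(η) times the excess of the frequency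
weight over 1. -/
theorem lam_le_lam_mul_freqWt (ξ η : E d) : lam ξ ≤ lam η * freqWt ξ η := by
  have h1 := one_le_lam η
  have h2 := one_le_freqWt ξ η
  have h3 : lam ξ ^ 2 ≤ lam η ^ 2 + ‖η - ξ‖ := by
    rw [lam_sq, lam_sq]
    have := norm_le_norm_add_norm_sub η ξ
    linarith
  rw [norm_sub_le_lam_mul] at h3
  refine le_of_sq_le_sq ?_ (by positivity)
  nlinarith [mul_nonneg (sub_nonneg.2 h1) (sub_nonneg.2 h2),
    mul_nonneg (mul_nonneg (lam_pos η).le (sub_nonneg.2 h1)) (sub_nonneg.2 h2),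
    mul_nonneg (sq_nonneg (lam η)) (sub_nonneg.2 h2),
    mul_nonneg (sq_nonneg (lam η)) (mul_nonneg (zero_le_one.trans h2) (sub_nonneg.2 h2))]

theorem lam_le_mul_freqWt (ξ η : E d) : lam η ≤ lam ξ * freqWt ξ η := by
  have h1 := one_le_lam η
  have h1' := one_le_lam ξ
  have h2 := one_le_freqWt ξ η
  have h3 : lam η ^ 2 ≤ lam ξ ^ 2 + ‖η - ξ‖ := by
    rw [lam_sq, lam_sq]
    have := norm_le_norm_add_norm_sub' η ξ
    linarith
  rw [norm_sub_le_lam_mul] at h3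
  have h4 : lam η ≤ lam ξ + (freqWt ξ η - 1) := by
    by_contra! h
    nlinarith
  nlinarith [mul_nonneg (sub_nonneg.2 h1') (sub_nonneg.2 h2)]

/-- The weight `1 + (1 + |ξ|)^{1/2} |x - y|` at the frozen frequency. -/
def sepWt₀ (x ξ y : E d) : ℝ := 1 + lam ξ * ‖x - y‖

/-- The weight `1 + |η - ξ| / (1 + |ξ|)^{1/2}` at the frozen frequency. -/
def freqWt₀ (ξ η : E d) : ℝ := 1 + ‖η - ξ‖ / lam ξ

/-- The scale is frozen at ξ so that the dominating kernel becomes a product of a function of y and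
a function of η. -/
theorem sepWt₀_le (x ξ y η : E d) : sepWt₀ x ξ y ≤ sepWt x y η * freqWt ξ η := by
  have h1 := mul_le_mul_of_nonneg_right (lam_le_lam_mul_freqWt ξ η) (norm_nonneg (x - y))
  have h2 := one_le_freqWt ξ η
  rw [sepWt₀, sepWt, ← lam]
  nlinarith

theorem freqWt₀_le (ξ η : E d) : freqWt₀ ξ η ≤ freqWt ξ η ^ 2 := by
  have h1 := lam_le_mul_freqWt ξ η
  have h2 := one_le_freqWt ξ η
  have h3 := lam_pos ξ
  rw [freqWt₀, norm_sub_le_lam_mul, mul_div_right_comm]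
  have h4 : lam η / lam ξ ≤ freqWt ξ η := by rwa [div_le_iff₀ h3, mul_comm]
  have := mul_le_mul_of_nonneg_right h4 (sub_nonneg.2 h2)
  nlinarith

theorem one_le_sepWt₀ (x ξ y : E d) : 1 ≤ sepWt₀ x ξ y := by
  have := mul_nonneg (lam_pos ξ).le (norm_nonneg (x - y))
  rw [sepWt₀]
  linarith

theorem one_le_freqWt₀ (ξ η : E d) : 1 ≤ freqWt₀ ξ η := by
  have := div_nonneg (norm_nonneg (η - ξ)) (lam_pos ξ).le
  rw [freqWt₀]
  linarith

theorem rpow_le_of_comparable {a b c : ℝ} (ha : 0 < a) (hb : 0 < b) (hc : 1 ≤ c) (h1 : a ≤ c * b)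
    (h2 : b ≤ c * a) (n : ℝ) : a ^ n ≤ c ^ |n| * b ^ n := by
  have hc0 : 0 < c := one_pos.trans_le hc
  rcases le_total 0 n with hn | hn
  · rw [abs_of_nonneg hn, ← Real.mul_rpow hc0.le hb.le]
    exact Real.rpow_le_rpow ha.le h1 hn
  · rw [abs_of_nonpos hn, Real.rpow_neg hc0.le, inv_mul_eq_div, ← Real.div_rpow hb.le hc0.le]
    refine Real.rpow_le_rpow_of_nonpos (by positivity) ?_ hn
    rwa [div_le_iff₀' hc0]

/-- The integrable kernel that dominates oscillatory integrals. -/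
def decay (T : ℝ) (p q : E d × E d) : ℝ := sepWt₀ p.1 p.2 q.1 ^ (-T) * freqWt₀ p.2 q.2 ^ (-T)

/-- Rescaling y by λ(ξ) and η by λ(ξ)⁻¹ gives Jacobians that cancel. The value is thus independent
of the base point, so no order is lost in the estimate. -/
theorem decay_factors (T : ℝ) (hT : (d + 1 : ℝ) < T) (p : E d × E d) :
    Integrable (decay T p) ∧
      ∫ q, decay T p q = (∫ z : E d, (1 + ‖z‖) ^ (-T)) * ∫ z : E d, (1 + ‖z‖) ^ (-T) := by
  have hfin : (Module.finrank ℝ (E d) : ℝ) < T := by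
    rw [finrank_euclideanSpace_fin]
    push_cast
    exact hT
  have hI : Integrable fun z : E d => (1 + ‖z‖) ^ (-T) := integrable_one_add_norm hfin
  have hl := lam_pos p.2
  set φ : E d → ℝ := fun z => (1 + ‖z‖) ^ (-T) with hφ
  have e1 : (fun y => sepWt₀ p.1 p.2 y ^ (-T)) = fun y => (fun z => φ (lam p.2 • z)) (p.1 - y) := by
    funext y
    simp [hφ, sepWt₀, norm_smul, abs_of_pos hl]
  have e2 : (fun η => freqWt₀ p.2 η ^ (-T)) = fun η => (fun z => φ ((lam p.2)⁻¹ • z)) (η - p.2) := by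
    funext η
    simp [hφ, freqWt₀, norm_smul, abs_of_pos hl, div_eq_inv_mul]
  have i1 : Integrable fun y => sepWt₀ p.1 p.2 y ^ (-T) := by
    rw [e1]
    exact (hI.comp_smul hl.ne').comp_sub_left p.1
  have i2 : Integrable fun η => freqWt₀ p.2 η ^ (-T) := by
    rw [e2]
    exact (hI.comp_smul (inv_ne_zero hl.ne')).comp_sub_right p.2
  refine ⟨i1.mul_prod i2, ?_⟩
  have h := integral_prod_mul (μ := (volume : Measure (E d))) (ν := (volume : Measure (E d)))
    (fun y => sepWt₀ p.1 p.2 y ^ (-T)) (fun η => freqWt₀ p.2 η ^ (-T))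
  refine h.trans ?_
  rw [e1, e2, integral_sub_left_eq_self (fun z => φ (lam p.2 • z)) volume p.1,
    integral_sub_right_eq_self (fun z => φ ((lam p.2)⁻¹ • z)) p.2, Measure.integral_comp_smul,
    Measure.integral_comp_smul, smul_eq_mul, smul_eq_mul, inv_pow, inv_inv,
    abs_of_pos (inv_pos.mpr (pow_pos hl _)), abs_of_pos (pow_pos hl _)]
  field_simp

namespace AdaptedFrame

variable {D : E d → Submodule ℝ (E d)} (F : AdaptedFrame D)

theorem lam_le_wt (y η : E d) : lam η ≤ F.wt y η := by
  refine le_of_sq_le_sq ?_ (F.wt_pos y η).le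
  rw [lam_sq]
  exact F.one_add_norm_le_wt_sq y η

/-- The seminorm ρ changes by at most C(|η-ξ| + |x-y||ξ|), or the same with η in the last factor.
Here |η-ξ| ≤ λ(η)·`freqWt`, and |x-y||ξ| ≤ λ(ξ)·(λ(ξ)|x-y|); in each case one factor λ is bounded by
`F.wt` and the rest by the separation and frequency weights. -/
theorem exists_wt_comparable : ∃ C : ℝ, 1 ≤ C ∧ ∀ x ξ y η,
    F.wt y η ≤ C * (sepWt x y η * freqWt ξ η) ^ 2 * F.wt x ξ ∧
      F.wt x ξ ≤ C * (sepWt x y η * freqWt ξ η) ^ 2 * F.wt y η := by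
  obtain ⟨C, hC, h⟩ := F.exists_rho_le
  refine ⟨2 + 2 * C, by linarith, fun x ξ y η => ?_⟩
  have hr := one_le_sepWt x y η
  have hs := one_le_freqWt ξ η
  set r := sepWt x y η with hr'
  set s := freqWt ξ η with hs'
  have hrs : r * s ≤ (r * s) ^ 2 := by
    have : 1 ≤ r * s := one_le_mul_of_one_le_of_one_le hr hs
    nlinarith
  have hs2 : s ^ 2 ≤ (r * s) ^ 2 := by gcongr; nlinarith
  have hr1 : r ≤ r * s := by nlinarith
  have hs1 : s ≤ r * s := by nlinarith
  have l1 := lam_le_lam_mul_freqWt ξ η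
  have l2 := lam_le_mul_freqWt ξ η
  have n1 : ‖η - ξ‖ ≤ lam η * s := by
    rw [norm_sub_le_lam_mul]
    nlinarith [lam_pos η]
  have w1 := F.lam_le_wt x ξ
  have w2 := F.lam_le_wt y η
  have p1 := F.wt_pos x ξ
  have p2 := F.wt_pos y η
  have q1 := Real.sqrt_nonneg ‖ξ‖
  have q2 := Real.sqrt_nonneg ‖η‖
  have s1 : Real.sqrt ‖η‖ ≤ lam η := Real.sqrt_le_sqrt (by linarith)
  have s2 : Real.sqrt ‖ξ‖ ≤ lam ξ := Real.sqrt_le_sqrt (by linarith)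
  have hx := lam_pos ξ
  have hy := lam_pos η
  constructor
  · have h1 := h y x η ξ
    have a1 : ‖η - ξ‖ ≤ F.wt x ξ * (r * s) ^ 2 :=
      calc ‖η - ξ‖ ≤ lam η * s := n1
        _ ≤ (lam ξ * s) * s := by gcongr
        _ = lam ξ * s ^ 2 := by ring
        _ ≤ _ := by gcongr
    have a2 : ‖y - x‖ * ‖ξ‖ ≤ F.wt x ξ * (r * s) ^ 2 :=
      calc ‖y - x‖ * ‖ξ‖ ≤ ‖x - y‖ * lam ξ ^ 2 := by
            rw [norm_sub_rev, lam_sq]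
            gcongr
            linarith
        _ = lam ξ * (lam ξ * ‖x - y‖) := by ring
        _ ≤ lam ξ * (r * s) := by
            have := sepWt₀_le x ξ y η
            rw [sepWt₀] at this
            exact mul_le_mul_of_nonneg_left (by linarith) hx.le
        _ ≤ _ := by gcongr
    have a3 : Real.sqrt ‖η‖ ≤ F.wt x ξ * (r * s) ^ 2 :=
      calc Real.sqrt ‖η‖ ≤ lam η := s1
        _ ≤ lam ξ * s := l2
        _ ≤ _ := by gcongr; exact hs1.trans hrs
    have a4 : 1 + F.rho x ξ ≤ F.wt x ξ * (r * s) ^ 2 :=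
      calc 1 + F.rho x ξ ≤ F.wt x ξ := by rw [wt]; linarith
        _ ≤ _ := by
          have : 1 ≤ r * s := one_le_mul_of_one_le_of_one_le hr hs
          nlinarith [one_le_pow₀ this (n := 2)]
    have a5 := mul_le_mul_of_nonneg_left (add_le_add a1 a2) hC
    calc F.wt y η = 1 + F.rho y η + Real.sqrt ‖η‖ := rfl
      _ ≤ (1 + F.rho x ξ) + C * (‖η - ξ‖ + ‖y - x‖ * ‖ξ‖) + Real.sqrt ‖η‖ := by linarith
      _ ≤ _ := by linarith
  · have h1 := h x y ξ η
    have a1 : ‖ξ - η‖ ≤ F.wt y η * (r * s) ^ 2 :=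
      calc ‖ξ - η‖ = ‖η - ξ‖ := norm_sub_rev _ _
        _ ≤ lam η * s := n1
        _ ≤ _ := by gcongr; exact hs1.trans hrs
    have a2 : ‖x - y‖ * ‖η‖ ≤ F.wt y η * (r * s) ^ 2 :=
      calc ‖x - y‖ * ‖η‖ ≤ ‖x - y‖ * lam η ^ 2 := by
            rw [lam_sq]
            gcongr
            linarith
        _ = lam η * (lam η * ‖x - y‖) := by ring
        _ ≤ lam η * r := by
            rw [hr', sepWt, ← lam]
            gcongr
            linarith
        _ ≤ _ := by gcongr; exact hr1.trans hrs
    have a3 : Real.sqrt ‖ξ‖ ≤ F.wt y η * (r * s) ^ 2 :=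
      calc Real.sqrt ‖ξ‖ ≤ lam ξ := s2
        _ ≤ lam η * s := l1
        _ ≤ _ := by gcongr; exact hs1.trans hrs
    have a4 : 1 + F.rho y η ≤ F.wt y η * (r * s) ^ 2 :=
      calc 1 + F.rho y η ≤ F.wt y η := by rw [wt]; linarith
        _ ≤ _ := by
          have : 1 ≤ r * s := one_le_mul_of_one_le_of_one_le hr hs
          nlinarith [one_le_pow₀ this (n := 2)]
    have a5 := mul_le_mul_of_nonneg_left (add_le_add a1 a2) hC
    calc F.wt x ξ = 1 + F.rho x ξ + Real.sqrt ‖ξ‖ := rfl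
      _ ≤ (1 + F.rho y η) + C * (‖ξ - η‖ + ‖x - y‖ * ‖η‖) + Real.sqrt ‖ξ‖ := by linarith
      _ ≤ _ := by linarith

/-- The symbol weights are temperate with respect to the separation and frequency weights. -/
theorem exists_symWt_temperate (m n : ℝ) : ∃ C M : ℝ, 0 ≤ C ∧ ∀ x ξ y η,
    F.symWt m n y η ≤ C * (sepWt x y η * freqWt ξ η) ^ M * F.symWt m n x ξ := by
  obtain ⟨C, hC, h⟩ := F.exists_wt_comparable
  -- Both 1+|η| and `F.wt` change by a factor t², up to the constant C for the latter. The
  -- comparison has to be two-sided because m and n may be negative.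
  refine ⟨C ^ |n|, 2 * |m| + 2 * |n|, by positivity, fun x ξ y η => ?_⟩
  have hr := one_le_sepWt x y η
  have hs := one_le_freqWt ξ η
  have ht : 1 ≤ sepWt x y η * freqWt ξ η := one_le_mul_of_one_le_of_one_le hr hs
  have hst : freqWt ξ η ≤ sepWt x y η * freqWt ξ η := by nlinarith
  set t := sepWt x y η * freqWt ξ η with ht'
  have ht0 : 0 < t := one_pos.trans_le ht
  have l1 := lam_le_lam_mul_freqWt ξ η
  have l2 := lam_le_mul_freqWt ξ η
  have b1 : (1 + ‖η‖) ^ m ≤ (t ^ 2) ^ |m| * (1 + ‖ξ‖) ^ m := by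
    refine rpow_le_of_comparable (one_add_norm_pos η) (one_add_norm_pos ξ) (one_le_pow₀ ht) ?_ ?_ m
    · rw [← lam_sq, ← lam_sq, ← mul_pow]
      have := lam_pos η
      have := lam_pos ξ
      gcongr
      nlinarith
    · rw [← lam_sq, ← lam_sq, ← mul_pow]
      have := lam_pos η
      have := lam_pos ξ
      gcongr
      nlinarith
  have b2 : F.wt y η ^ n ≤ (C * t ^ 2) ^ |n| * F.wt x ξ ^ n :=
    rpow_le_of_comparable (F.wt_pos _ _) (F.wt_pos _ _)
      (one_le_mul_of_one_le_of_one_le hC (one_le_pow₀ ht)) (h x ξ y η).1 (h x ξ y η).2 n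
  have p1 : ∀ a : ℝ, (t ^ 2) ^ |a| = t ^ (2 * |a|) := fun a => by
    rw [← Real.rpow_natCast, ← Real.rpow_mul ht0.le]
    norm_num
  rw [Real.mul_rpow (by positivity) (by positivity), p1] at b2
  rw [p1] at b1
  rw [symWt, symWt, Real.rpow_add ht0]
  calc (1 + ‖η‖) ^ m * F.wt y η ^ n
      ≤ (t ^ (2 * |m|) * (1 + ‖ξ‖) ^ m) * (C ^ |n| * t ^ (2 * |n|) * F.wt x ξ ^ n) :=
        mul_le_mul b1 b2 (Real.rpow_nonneg (F.wt_pos _ _).le _) (by positivity)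
    _ = _ := by ring

/-- The weight of an amplitude as a function of `(y, η)`. -/
def baseWt (m n p : ℝ) : LocIdx d → E d × E d → ℝ := fun i v =>
  F.symWt m n v.1 v.2 * sepWt i.2.1 v.1 v.2 ^ p

/-- An amplitude as a family of functions of `(y, η)`. -/
def toLoc (c : ℕ → E d × E d × E d → ℂ) : LocIdx d → E d × E d → ℂ := fun i v => c i.1 (i.2.1, v)

variable {F} {c : ℕ → E d × E d × E d → ℂ} {m n p : ℝ}

/-- From here on the anisotropy is dropped: ∂_η gains `F.wt`⁻¹ ≤ λ⁻¹, and ∂_y costs (1+|η|)^{1/2} =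
λ. -/
theorem locLE_toLoc {k : ℕ} (h : F.AmpLE k m n p c) : LocLE k (F.baseWt m n p) (toLoc c) := by
  have key : ∀ {m n p : ℝ} {c : ℕ → E d × E d × E d → ℂ}, SmoothBdd (F.ampWt m n p) c →
      SmoothBdd (F.baseWt m n p) (toLoc c) := by
    rintro m n p c ⟨h1, C, hC, h2⟩
    exact ⟨fun i => (h1 i.1).comp (contDiff_prodMk_right i.2.1), C, hC,
      fun i v => h2 i.1 (i.2.1, v)⟩
  induction k generalizing m n p c with
  | zero => exact key h
  | succ k ih =>
    refine ⟨key h.smoothBdd, fun j => ?_⟩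
    have hs : ∀ n, ContDiff ℝ ∞ (c n) := h.smoothBdd.1
    cases j with
    | inl j =>
      have h1 := Cls.along h (.dY j)
      simp only [mult, ampWt_mul, add_zero] at h1
      have h2 := ih h1
      have e : along (locField (.inl j)) (toLoc c) = toLoc (along (F.field (.dY j)) c) := by
        funext i v
        exact fderiv_slice (hs i.1) i.2.1 v (coordVec j, 0)
      rw [e]
      refine h2.mono fun i v => le_of_eq ?_
      simp only [baseWt, symWt, locMult, locWt, Pi.mul_apply, Real.rpow_zero, Real.rpow_one,
        mul_one, lam, Real.sqrt_eq_rpow]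
      rw [Real.rpow_add (one_add_norm_pos _)]
      ring
    | inr j =>
      have h1 := Cls.along h (.dEta j)
      simp only [mult, ampWt_mul, add_zero] at h1
      have h2 := ih h1
      have e : along (locField (.inr j)) (toLoc c) = toLoc (along (F.field (.dEta j)) c) := by
        funext i v
        exact fderiv_slice (hs i.1) i.2.1 v (0, coordVec j)
      rw [e]
      refine h2.mono fun i v => ?_
      have hw := F.wt_pos v.1 v.2
      have hr : 0 < sepWt i.2.1 v.1 v.2 := one_pos.trans_le (one_le_sepWt _ _ _)
      have := inv_anti₀ (lam_pos v.2) (F.lam_le_wt v.1 v.2)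
      simp only [baseWt, symWt, locMult, locWt, Pi.mul_apply, Real.rpow_zero, Real.rpow_neg_one,
        mul_one]
      rw [Real.rpow_add hw, Real.rpow_neg_one]
      have h0 : 0 ≤ (1 + ‖v.2‖) ^ m * F.wt v.1 v.2 ^ n * sepWt i.2.1 v.1 v.2 ^ p := by positivity
      calc _ = (1 + ‖v.2‖) ^ m * F.wt v.1 v.2 ^ n * sepWt i.2.1 v.1 v.2 ^ p * (F.wt v.1 v.2)⁻¹ := by
            ring
        _ ≤ _ := mul_le_mul_of_nonneg_left this h0

theorem locTest_toLoc (h : Tame c) : LocTest (toLoc c) := fun i => (h.testAmp i.1).slice i.2.1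

theorem locStable_toLoc (h : Tame c) : LocStable (toLoc c) := fun p v => by
  obtain ⟨g, hg⟩ := h.stable (p.1, v)
  refine ⟨fun q => g (p.1, q), ?_⟩
  filter_upwards [hg] with n hn
  exact (Continuous.prodMk_right p.1).continuousAt.eventually hn

/-- The oscillatory integral of an amplitude is that of a family dominated by `decay`. -/
theorem exists_dominated (ht : Tame c) (h : F.Amp m n p c) : ∃ G : LocIdx d → E d × E d → ℂ,
    ∃ C : ℝ, 0 ≤ C ∧ (∀ i, Continuous (G i)) ∧
      (∀ i v, ‖G i v‖ ≤ C * F.symWt m n i.2.1 i.2.2 * decay (d + 2) i.2 v) ∧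
      LocStable G ∧ ∀ N P, ampInt (c N) P = oscInt (G (N, P)) P := by
  obtain ⟨C', M, hC', htemp⟩ := F.exists_symWt_temperate m n
  -- M pays for moving the symbol weight to (x,ξ) and |p| for the separation weight of the
  -- amplitude. The kernel with exponent d + 2 costs three times d + 2, because the product of the
  -- two frozen weights is at most (rs)·s² ≤ (rs)³.
  obtain ⟨K, hK⟩ := exists_nat_ge (M + |p| + 3 * (d + 2))
  have hw : ∀ i v, 0 ≤ F.baseWt m n p i v := fun i v => mul_nonneg (F.symWt_pos _ _ _ _).le
    (Real.rpow_nonneg (zero_le_one.trans (one_le_sepWt _ _ _)) _)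
  obtain ⟨G, ⟨h1, C, hC, h2⟩, h3, h4⟩ := exists_iterated_steps K hw (fun k => locLE_toLoc (h k))
    (locTest_toLoc ht) (locStable_toLoc ht)
  refine ⟨G, C * C', by positivity, fun i => (h1 i).continuous, fun i v => ?_, h3,
    fun N P => (h4 (N, P)).symm⟩
  refine (h2 i v).trans ?_
  rw [mul_assoc, mul_assoc]
  refine mul_le_mul_of_nonneg_left ?_ hC
  have hr := one_le_sepWt i.2.1 v.1 v.2
  have hs := one_le_freqWt i.2.2 v.2
  have ht1 := htemp i.2.1 i.2.2 v.1 v.2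
  have hr0 := sepWt₀_le i.2.1 i.2.2 v.1 v.2
  have hs0 := freqWt₀_le i.2.2 v.2
  have hr1 := one_le_sepWt₀ i.2.1 i.2.2 v.1
  have hs1 := one_le_freqWt₀ i.2.2 v.2
  simp only [Pi.mul_apply, locWt, baseWt, decay, Real.rpow_zero, one_mul]
  set r := sepWt i.2.1 v.1 v.2
  set s := freqWt i.2.2 v.2
  have hrp : 0 < r := one_pos.trans_le hr
  have hsp : 0 < s := one_pos.trans_le hs
  have hsym := (F.symWt_pos m n i.2.1 i.2.2).le
  have hd : (r * s) ^ (-(3 * ((d : ℝ) + 2))) ≤ sepWt₀ i.2.1 i.2.2 v.1 ^ (-((d : ℝ) + 2))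
      * freqWt₀ i.2.2 v.2 ^ (-((d : ℝ) + 2)) := by
    rw [← Real.mul_rpow (by positivity) (by positivity),
      show (-(3 * ((d : ℝ) + 2))) = ((3 : ℕ) : ℝ) * (-((d : ℝ) + 2)) by push_cast; ring,
      Real.rpow_mul (by positivity), Real.rpow_natCast]
    refine Real.rpow_le_rpow_of_nonpos (by positivity) ?_ (by linarith [(Nat.cast_nonneg d : (0 : ℝ) ≤ d)])
    calc _ ≤ (r * s) * s ^ 2 := mul_le_mul hr0 hs0 (by positivity) (by positivity)
      _ ≤ (r * s) * (r * s) ^ 2 := by gcongr; nlinarith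
      _ = _ := by ring
  have he : r ^ (-(K : ℝ)) * s ^ (-(K : ℝ)) * ((r * s) ^ M * r ^ p)
      ≤ (r * s) ^ (-(3 * ((d : ℝ) + 2))) := by
    rw [Real.mul_rpow hrp.le hsp.le, Real.mul_rpow hrp.le hsp.le]
    have e : r ^ (-(K : ℝ)) * s ^ (-(K : ℝ)) * (r ^ M * s ^ M * r ^ p)
        = r ^ (-K + M + p : ℝ) * s ^ (-K + M : ℝ) := by
      rw [Real.rpow_add hrp, Real.rpow_add hrp, Real.rpow_add hsp]
      ring
    rw [e]
    have := le_abs_self p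
    have := abs_nonneg p
    exact mul_le_mul (Real.rpow_le_rpow_of_exponent_le hr (by linarith))
      (Real.rpow_le_rpow_of_exponent_le hs (by linarith)) (by positivity) (by positivity)
  calc r ^ (-(K : ℝ)) * s ^ (-(K : ℝ)) * (F.symWt m n v.1 v.2 * r ^ p)
      ≤ r ^ (-(K : ℝ)) * s ^ (-(K : ℝ)) * ((C' * (r * s) ^ M * F.symWt m n i.2.1 i.2.2) * r ^ p) := by
        gcongr
    _ = C' * (F.symWt m n i.2.1 i.2.2
        * (r ^ (-(K : ℝ)) * s ^ (-(K : ℝ)) * ((r * s) ^ M * r ^ p))) := by ring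
    _ ≤ _ := mul_le_mul_of_nonneg_left (mul_le_mul_of_nonneg_left (he.trans hd) hsym) hC'

theorem exists_ampInt_le (ht : Tame c) (h : F.Amp m n p c) :
    ∃ C : ℝ, 0 ≤ C ∧ ∀ N P, ‖ampInt (c N) P‖ ≤ C * F.symWt m n P.1 P.2 := by
  obtain ⟨G, C, hC, hG, hb, -, he⟩ := exists_dominated ht h
  set I := (∫ z : E d, (1 + ‖z‖) ^ (-((d : ℝ) + 2))) * ∫ z : E d, (1 + ‖z‖) ^ (-((d : ℝ) + 2))
  have hI : 0 ≤ I := mul_self_nonneg _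
  refine ⟨C * I, by positivity, fun N P => ?_⟩
  obtain ⟨hi, hv⟩ := decay_factors (d := d) (d + 2) (by linarith) P
  rw [he N P, oscInt]
  refine (norm_integral_le_of_norm_le (hi.const_mul (C * F.symWt m n P.1 P.2))
    (Eventually.of_forall fun q => ?_)).trans ?_
  · rw [norm_mul, norm_phase, mul_one]
    exact hb (N, P) q
  · rw [integral_const_mul, hv]
    exact le_of_eq (by ring)

/-- After the integrations by parts the integrands have an integrable bound independent of the
cutoff and are eventually constant at each point, so dominated convergence applies. -/
theorem exists_tendsto_ampInt (ht : Tame c) (h : F.Amp m n p c) (P : E d × E d) :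
    ∃ z, Tendsto (fun N => ampInt (c N) P) atTop (𝓝 z) := by
  obtain ⟨G, C, hC, hG, hb, hs, he⟩ := exists_dominated ht h
  obtain ⟨hi, hv⟩ := decay_factors (d := d) (d + 2) (by linarith) P
  choose f hf using hs P
  refine ⟨∫ q, f q q * phase (P, q), ?_⟩
  simp only [he, oscInt]
  refine tendsto_integral_of_dominated_convergence
    (fun q => C * F.symWt m n P.1 P.2 * decay (d + 2) P q)
    (fun N => ((hG (N, P)).mul (continuous_phase P)).aestronglyMeasurable) (hi.const_mul _)
    (fun N => Eventually.of_forall fun q => ?_) (Eventually.of_forall fun q => ?_)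
  · rw [norm_mul, norm_phase, mul_one]
    exact hb (N, P) q
  · refine tendsto_const_nhds.congr' ?_
    filter_upwards [hf q] with N hN
    rw [hN.eq_of_nhds]

end AdaptedFrame

end BaseEstimate

/-! ### Removing the cutoff: smoothness and symbol bounds of the limit. -/

section Limit

open Filter Topology

variable {d : ℕ}

/-- The linear form on `ℝ^N × ℝ^N` with prescribed values on the coordinate vectors. -/
def linForm (u v : Fin (d + 1) → ℂ) : E d × E d →L[ℝ] ℂ :=
  ∑ i, ((EuclideanSpace.proj (𝕜 := ℝ) i).comp (ContinuousLinearMap.fst ℝ (E d) (E d))).smulRight (u i)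
    + ∑ j, ((EuclideanSpace.proj (𝕜 := ℝ) j).comp
        (ContinuousLinearMap.snd ℝ (E d) (E d))).smulRight (v j)

theorem linForm_apply (u v : Fin (d + 1) → ℂ) (t : E d × E d) :
    linForm u v t = ∑ i, (t.1 i : ℂ) * u i + ∑ j, (t.2 j : ℂ) * v j := by
  simp [linForm]

theorem eq_linForm (T : E d × E d →L[ℝ] ℂ) :
    T = linForm (fun i => T (coordVec i, 0)) fun j => T (0, coordVec j) := by
  ext t
  · have h : ∀ t : E d, t = ∑ j, t j • (coordVec j : E d) := fun t => by
      ext i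
      simp [coordVec, Pi.single_apply]
    have h2 : T (t, 0) = (T.comp (ContinuousLinearMap.inl ℝ (E d) (E d))) t := by simp
    simp only [ContinuousLinearMap.comp_apply, ContinuousLinearMap.inl_apply, linForm_apply]
    rw [h2]
    conv_lhs => rw [h t]
    simp
  · simp only [ContinuousLinearMap.comp_apply, ContinuousLinearMap.inr_apply, linForm_apply]
    rw [clm_zero_prod]
    simp

theorem linForm_sub (u v u' v' : Fin (d + 1) → ℂ) :
    linForm u v - linForm u' v' = linForm (u - u') (v - v') := by
  ext t <;> simp [linForm_apply, mul_sub]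

theorem norm_linForm_le (u v : Fin (d + 1) → ℂ) :
    ‖linForm u v‖ ≤ ∑ i, ‖u i‖ + ∑ j, ‖v j‖ := by
  refine ContinuousLinearMap.opNorm_le_bound _ (by positivity) fun t => ?_
  have h : ∀ (t : E d) (i : Fin (d + 1)), ‖(t i : ℂ)‖ ≤ ‖t‖ := fun t i => by
    rw [Complex.norm_real]
    exact PiLp.norm_apply_le t i
  rw [linForm_apply, add_mul, Finset.sum_mul, Finset.sum_mul]
  refine (norm_add_le _ _).trans (add_le_add ?_ ?_) <;>
  · refine (norm_sum_le _ _).trans (Finset.sum_le_sum fun i _ => ?_)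
    rw [norm_mul, mul_comm]
    gcongr
    first | exact (h _ i).trans (norm_fst_le t) | exact (h _ i).trans (norm_snd_le t)

theorem tendsto_linForm {u v : ℕ → Fin (d + 1) → ℂ} {u' v' : Fin (d + 1) → ℂ}
    (hu : ∀ i, Tendsto (fun N => u N i) atTop (𝓝 (u' i)))
    (hv : ∀ i, Tendsto (fun N => v N i) atTop (𝓝 (v' i))) :
    Tendsto (fun N => linForm (u N) (v N)) atTop (𝓝 (linForm u' v')) := by
  rw [tendsto_iff_norm_sub_tendsto_zero]
  refine squeeze_zero (fun _ => norm_nonneg _)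
    (fun N => (congrArg norm (linForm_sub _ _ _ _)).trans_le (norm_linForm_le _ _)) ?_
  have h1 := tendsto_finsetSum Finset.univ fun i _ => tendsto_iff_norm_sub_tendsto_zero.mp (hu i)
  have h2 := tendsto_finsetSum Finset.univ fun i _ => tendsto_iff_norm_sub_tendsto_zero.mp (hv i)
  simpa using h1.add h2

theorem contDiff_linForm {V : Type*} [NormedAddCommGroup V] [NormedSpace ℝ V] {k : ℕ∞}
    {u v : V → Fin (d + 1) → ℂ} (hu : ∀ i, ContDiff ℝ k fun p => u p i)
    (hv : ∀ i, ContDiff ℝ k fun p => v p i) : ContDiff ℝ k fun p => linForm (u p) (v p) := by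
  unfold linForm
  exact (ContDiff.sum fun i _ => contDiff_const.smulRight (hu i)).add
    (ContDiff.sum fun i _ => contDiff_const.smulRight (hv i))

/-- A pointwise limit of functions whose derivatives are locally uniformly Lipschitz at a point
and converge there. -/
theorem hasFDerivAt_of_tendsto {V : Type*} [NormedAddCommGroup V] [NormedSpace ℝ V]
    {f : ℕ → V → ℂ} {g : V → ℂ} {p : V} {G : V →L[ℝ] ℂ} {K : ℝ}
    (hd : ∀ n, Differentiable ℝ (f n)) (hf : ∀ q, Tendsto (fun n => f n q) atTop (𝓝 (g q)))
    (hG : Tendsto (fun n => fderiv ℝ (f n) p) atTop (𝓝 G))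
    (hK : ∀ n, ∀ q ∈ Metric.closedBall p 1, ‖fderiv ℝ (f n) q - fderiv ℝ (f n) p‖ ≤ K * ‖q - p‖)
    (hK0 : 0 ≤ K) : HasFDerivAt g G p := by
  have key : ∀ q ∈ Metric.closedBall p 1, ‖g q - g p - G (q - p)‖ ≤ K * ‖q - p‖ ^ 2 := by
    intro q hq
    have h1 : ∀ n, ‖f n q - f n p - fderiv ℝ (f n) p (q - p)‖ ≤ K * ‖q - p‖ ^ 2 := by
      intro n
      rw [pow_two, ← mul_assoc]
      -- On the ball of radius ‖q - p‖ the derivative deviates from its value at p by at most K‖q -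
      -- p‖, so the Taylor remainder is quadratic uniformly in n and the bound passes to the limit.
      refine (convex_closedBall p ‖q - p‖).norm_image_sub_le_of_norm_fderiv_le'
        (fun x _ => hd n x) (fun x hx => ?_) (Metric.mem_closedBall_self (norm_nonneg _))
        (by rw [Metric.mem_closedBall, dist_eq_norm])
      rw [Metric.mem_closedBall, dist_eq_norm] at hx
      rw [Metric.mem_closedBall, dist_eq_norm] at hq
      refine (hK n x (by rw [Metric.mem_closedBall, dist_eq_norm]; exact hx.trans hq)).trans ?_
      gcongr
    have h2 : Tendsto (fun n => fderiv ℝ (f n) p (q - p)) atTop (𝓝 (G (q - p))) :=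
      (ContinuousLinearMap.apply ℝ ℂ (q - p)).continuous.tendsto _ |>.comp hG
    exact le_of_tendsto (((hf q).sub (hf p)).sub h2).norm (Eventually.of_forall h1)
  refine HasFDerivAt.of_isLittleO (Asymptotics.IsBigO.trans_isLittleO
    (g := fun q => ‖q - p‖ ^ 2) ?_ ?_)
  · refine Asymptotics.IsBigO.of_bound K ?_
    filter_upwards [Metric.closedBall_mem_nhds p one_pos] with q hq
    simpa using key q hq
  · rw [← Asymptotics.isLittleO_norm_right]
    have h : Tendsto (fun q => ‖q - p‖) (𝓝 p) (𝓝 0) := by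
      have : Continuous fun q : V => ‖q - p‖ := by fun_prop
      simpa using this.tendsto p
    simpa [pow_two] using
      ((Asymptotics.isLittleO_one_iff ℝ).mpr h).mul_isBigO (Asymptotics.isBigO_refl (fun q => ‖q - p‖) (𝓝 p))

/-- The limit of the oscillatory integrals of a sequence of amplitudes. -/
def limInt (c : ℕ → E d × E d × E d → ℂ) (P : E d × E d) : ℂ :=
  limUnder atTop fun N => ampInt (c N) P

namespace AdaptedFrame

variable {D : E d → Submodule ℝ (E d)} {F : AdaptedFrame D} {c : ℕ → E d × E d × E d → ℂ}
  {m n p : ℝ}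

variable (F m n) in
theorem exists_symWt_le_pow : ∃ (C : ℝ) (K : ℕ), 0 ≤ C ∧
    ∀ y η, F.symWt m n y η ≤ C * (1 + ‖η‖) ^ K := by
  obtain ⟨K, hK⟩ := exists_nat_ge (|m| + |n|)
  have h1 := le_abs_self m
  have h2 := le_abs_self n
  have h3 := abs_nonneg n
  obtain ⟨C, hC, h⟩ := F.exists_symWt_le (m := m) (n := n) (m' := K) (n' := 0)
    (by linarith) (by linarith)
  refine ⟨C, K, hC, fun y η => ?_⟩
  have := h y η
  rwa [symWt, symWt, Real.rpow_natCast, Real.rpow_zero, mul_one] at this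

theorem tendsto_limInt (ht : Tame c) (h : F.Amp m n p c) (P : E d × E d) :
    Tendsto (fun N => ampInt (c N) P) atTop (𝓝 (limInt c P)) :=
  tendsto_nhds_limUnder (exists_tendsto_ampInt ht h P)

theorem exists_limInt_le (ht : Tame c) (h : F.Amp m n p c) :
    ∃ C : ℝ, 0 ≤ C ∧ ∀ P, ‖limInt c P‖ ≤ C * F.symWt m n P.1 P.2 := by
  obtain ⟨C, hC, hb⟩ := exists_ampInt_le ht h
  exact ⟨C, hC, fun P => le_of_tendsto (tendsto_limInt ht h P).norm
    (Eventually.of_forall fun N => hb N P)⟩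

theorem exists_ampInt_ball_le (ht : Tame c) (h : F.Amp m n p c) (P : E d × E d) :
    ∃ C : ℝ, 0 ≤ C ∧ ∀ N, ∀ Q ∈ Metric.closedBall P 1, ‖ampInt (c N) Q‖ ≤ C := by
  obtain ⟨C, hC, hb⟩ := exists_ampInt_le ht h
  obtain ⟨C', K, hC', hb'⟩ := F.exists_symWt_le_pow m n
  refine ⟨C * (C' * (2 + ‖P‖) ^ K), by positivity, fun N Q hQ => (hb N Q).trans ?_⟩
  gcongr
  refine (hb' _ _).trans ?_
  have h1 : ‖Q.2‖ ≤ 1 + ‖P‖ := by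
    rw [Metric.mem_closedBall, dist_eq_norm] at hQ
    have := norm_snd_le Q
    have := norm_sub_norm_le Q P
    linarith
  gcongr C' * ?_ ^ _
  linarith

theorem fderiv_ampInt_eq (ht : Tame c) (N : ℕ) (P : E d × E d) :
    fderiv ℝ (ampInt (c N)) P
      = linForm (fun i => ampInt (opX i c N) P) fun j => ampInt (F.opXi j c N) P := by
  have h1 : ∀ i, fderiv ℝ (ampInt (c N)) P (coordVec i, 0) = ampInt (opX i c N) P :=
    fun i => fderiv_ampInt_x ht i N P
  have h2 : ∀ j, fderiv ℝ (ampInt (c N)) P (0, coordVec j) = ampInt (F.opXi j c N) P := fun j => by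
    rw [← lie_xi_ampInt ht]
    rfl
  simp_rw [← h1, ← h2]
  exact eq_linForm _

/-- The first derivatives are themselves integrals of admissible amplitudes, hence bounded on the
ball uniformly in the cutoff. Applied to the derived amplitudes this gives the hypothesis of
`hasFDerivAt_of_tendsto`. -/
theorem exists_ampInt_lipschitz (ht : Tame c) (h : F.Amp m n p c) (P : E d × E d) :
    ∃ C : ℝ, 0 ≤ C ∧ ∀ N, ∀ Q ∈ Metric.closedBall P 1,
      ‖ampInt (c N) Q - ampInt (c N) P‖ ≤ C * ‖Q - P‖ := by
  choose C hC hb using fun i => exists_ampInt_ball_le (tame_opX ht i) (amp_opX h i) P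
  choose C' hC' hb' using fun j => exists_ampInt_ball_le (tame_opXi ht j) (amp_opXi h j) P
  refine ⟨∑ i, C i + ∑ j, C' j, add_nonneg (Finset.sum_nonneg fun i _ => hC i)
    (Finset.sum_nonneg fun i _ => hC' i), fun N Q hQ => ?_⟩
  refine (convex_closedBall P 1).norm_image_sub_le_of_norm_fderiv_le (𝕜 := ℝ)
    (fun x _ => (hasFDerivAt_ampInt (ht.testAmp N) x).1) (fun x hx => ?_)
    (Metric.mem_closedBall_self zero_le_one) hQ
  rw [fderiv_ampInt_eq (F := F) ht]
  exact (norm_linForm_le _ _).trans (add_le_add (Finset.sum_le_sum fun i _ => hb i N x hx)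
    (Finset.sum_le_sum fun i _ => hb' i N x hx))

theorem tendsto_fderiv_ampInt (ht : Tame c) (h : F.Amp m n p c) (P : E d × E d) :
    Tendsto (fun N => fderiv ℝ (ampInt (c N)) P) atTop
      (𝓝 (linForm (fun i => limInt (opX i c) P) fun j => limInt (F.opXi j c) P)) := by
  simp only [fderiv_ampInt_eq (F := F) ht]
  exact tendsto_linForm (fun i => tendsto_limInt (tame_opX ht i) (amp_opX h i) P)
    fun j => tendsto_limInt (tame_opXi ht j) (amp_opXi h j) P

theorem hasFDerivAt_limInt (ht : Tame c) (h : F.Amp m n p c) (P : E d × E d) :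
    HasFDerivAt (limInt c)
      (linForm (fun i => limInt (opX i c) P) fun j => limInt (F.opXi j c) P) P := by
  choose C hC hb using fun i => exists_ampInt_lipschitz (tame_opX ht i) (amp_opX h i) P
  choose C' hC' hb' using fun j => exists_ampInt_lipschitz (tame_opXi ht j) (amp_opXi h j) P
  refine hasFDerivAt_of_tendsto (fun N x => (hasFDerivAt_ampInt (ht.testAmp N) x).1)
    (tendsto_limInt ht h) (tendsto_fderiv_ampInt ht h P) (K := ∑ i, C i + ∑ j, C' j)
    (fun N Q hQ => ?_) (add_nonneg (Finset.sum_nonneg fun i _ => hC i)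
    (Finset.sum_nonneg fun i _ => hC' i))
  rw [fderiv_ampInt_eq (F := F) ht, fderiv_ampInt_eq (F := F) ht, linForm_sub, add_mul,
    Finset.sum_mul, Finset.sum_mul]
  exact (norm_linForm_le _ _).trans (add_le_add (Finset.sum_le_sum fun i _ => hb i N Q hQ)
    (Finset.sum_le_sum fun i _ => hb' i N Q hQ))

/-- The derivative of a limit is assembled from limits for the amplitudes `opX` and `opXi`, so
induction over all orders m, n applies. -/
theorem contDiff_limInt (ht : Tame c) (h : F.Amp m n p c) : ContDiff ℝ ∞ (limInt c) := by
  rw [contDiff_infty]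
  intro k
  induction k generalizing c m n with
  | zero =>
    exact contDiff_zero.mpr (continuous_iff_continuousAt.mpr fun P =>
      (hasFDerivAt_limInt ht h P).continuousAt)
  | succ k ih =>
    refine contDiff_succ_iff_hasFDerivAt.mpr ⟨_, ?_, hasFDerivAt_limInt ht h⟩
    exact contDiff_linForm (k := (k : ℕ∞)) (fun i => ih (tame_opX ht i) (amp_opX h i))
      fun j => ih (tame_opXi ht j) (amp_opXi h j)

theorem lie_limInt {c' : ℕ → E d × E d × E d → ℂ} {m' n' p' : ℝ} (ht : Tame c)
    (h : F.Amp m n p c) (ht' : Tame c') (h' : F.Amp m' n' p' c') {Z : E d × E d → E d × E d}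
    (hZ : ∀ N, lie Z (ampInt (c N)) = ampInt (c' N)) : lie Z (limInt c) = limInt c' := by
  funext P
  have h1 := (ContinuousLinearMap.apply ℝ ℂ (Z P)).continuous.tendsto _ |>.comp
    (tendsto_fderiv_ampInt ht h P)
  rw [← (hasFDerivAt_limInt ht h P).fderiv] at h1
  refine tendsto_nhds_unique h1 ((tendsto_limInt ht' h' P).congr fun N => ?_)
  rw [← hZ]
  rfl

variable (F) in
/-- Limits of oscillatory integrals with amplitudes of orders `m`, `n`. -/
def IsLimInt (m n : ℝ) (h : E d × E d → ℂ) : Prop :=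
  ∃ c p, Tame c ∧ F.Amp m n p c ∧ h = limInt c

variable {h : E d × E d → ℂ}

theorem IsLimInt.xi (hh : F.IsLimInt m n h) (j : Fin (d + 1)) :
    F.IsLimInt m (n - 1) (lie (xiField j) h) := by
  obtain ⟨c, p, ht, hc, rfl⟩ := hh
  exact ⟨F.opXi j c, p, tame_opXi ht j, amp_opXi hc j,
    lie_limInt ht hc (tame_opXi ht j) (amp_opXi hc j) (lie_xi_ampInt ht j)⟩

theorem IsLimInt.trans (hh : F.IsLimInt m n h) : F.IsLimInt (m - 1) n (lie F.transField h) := by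
  obtain ⟨c, p, ht, hc, rfl⟩ := hh
  exact ⟨F.opTrans c, p + 1, tame_opTrans ht, amp_opTrans hc,
    lie_limInt ht hc (tame_opTrans ht) (amp_opTrans hc) (lie_trans_ampInt ht)⟩

theorem IsLimInt.good (hh : F.IsLimInt m n h) (i : Fin (d + 1)) :
    F.IsLimInt m n (lie (F.goodField i) h) := by
  obtain ⟨c, p, ht, hc, rfl⟩ := hh
  exact ⟨F.opGood i c, p + 1, tame_opGood ht i, amp_opGood hc i,
    lie_limInt ht hc (tame_opGood ht i) (amp_opGood hc i) (lie_good_ampInt ht i)⟩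

theorem IsLimInt.goodList (hh : F.IsLimInt m n h) (I : List (Fin (d + 1))) :
    F.IsLimInt m n (F.goodList I h) := by
  induction I with
  | nil => exact hh
  | cons i I ih => exact ih.good i

theorem IsLimInt.transIter (hh : F.IsLimInt m n h) (β : ℕ) :
    F.IsLimInt (m - β) n ((lie F.transField)^[β] h) := by
  induction β with
  | zero => simpa using hh
  | succ β ih =>
    rw [Function.iterate_succ_apply', show m - ((β + 1 : ℕ) : ℝ) = m - β - 1 by push_cast; ring]
    exact ih.trans

theorem IsLimInt.xiList (hh : F.IsLimInt m n h) (α : List (Fin (d + 1))) :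
    F.IsLimInt m (n - α.length) (xiList α h) := by
  induction α with
  | nil => simpa [AdaptedFrame.xiList] using hh
  | cons j α ih =>
    rw [List.length_cons, show n - ((α.length + 1 : ℕ) : ℝ) = n - α.length - 1 by push_cast; ring]
    exact ih.xi j

/-- D_i, D_ξ and ∂_ξ act within this class of functions with exactly the shifts of order in the
definition of S^{m,n}. Every estimate is thereby the bound `exists_limInt_le` for another amplitude;
its exponent p, which may have grown, does not appear in that bound. -/
theorem IsLimInt.symBounds (hh : F.IsLimInt m n h) : F.SymBounds m n h := fun I => by
  have h1 := hh.goodList I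
  refine ⟨?_, fun α β => ?_⟩
  · obtain ⟨c, p, ht, hc, e⟩ := h1
    rw [e]
    exact contDiff_limInt ht hc
  · obtain ⟨c, p, ht, hc, e⟩ := (h1.transIter β).xiList α
    obtain ⟨C, -, hC⟩ := exists_limInt_le ht hc
    refine ⟨C, fun x ξ => ?_⟩
    rw [e, mul_assoc]
    exact hC (x, ξ)

end AdaptedFrame

end Limit

/-! ### The operators T_a on functions ĝ: continuity in the symbol and integration by parts in ξ. -/

section WaveIntegral

open Filter Topology LineDeriv

variable {d : ℕ}

/-- The plane wave `e^{2π i x·ξ}`. -/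
def wave (x ξ : E d) : ℂ := Complex.exp (2 * Real.pi * Complex.I * (inner ℝ x ξ : ℝ))

theorem norm_wave (x ξ : E d) : ‖wave x ξ‖ = 1 := by
  rw [wave, show (2 * Real.pi * Complex.I * (inner ℝ x ξ : ℝ) : ℂ)
    = ((2 * Real.pi * inner ℝ x ξ : ℝ) : ℂ) * Complex.I by push_cast; ring,
    Complex.norm_exp_ofReal_mul_I]

theorem contDiff_wave : ContDiff ℝ ∞ fun p : E d × E d => wave p.1 p.2 :=
  Complex.contDiff_exp.comp (contDiff_const.mul (Complex.ofRealCLM.contDiff.comp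
    (contDiff_fst.inner ℝ contDiff_snd)))

theorem contDiff_wave_right (x : E d) : ContDiff ℝ ∞ (wave x) :=
  contDiff_wave.comp (contDiff_prodMk_right x)

theorem fderiv_wave (x ξ t : E d) :
    fderiv ℝ (wave x) ξ t = 2 * Real.pi * Complex.I * (inner ℝ x t : ℝ) * wave x ξ := by
  have h := ((Complex.ofRealCLM.hasFDerivAt.comp ξ ((innerSL ℝ x).hasFDerivAt)).const_mul
    (2 * Real.pi * Complex.I : ℂ)).cexp
  have h' : fderiv ℝ (wave x) ξ = _ := h.fderiv
  rw [h']
  simp [wave]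
  ring

theorem conj_wave (x ξ : E d) : conj (wave x ξ) = wave x (-ξ) := by
  rw [wave, wave, ← Complex.exp_conj]
  congr 1
  simp [Complex.conj_ofReal, map_ofNat (starRingEnd ℂ) 2]

theorem phase_mul_wave (p q : E d × E d) :
    phase (p, q) * wave p.1 p.2 = wave p.1 q.2 * wave q.1 (-q.2) * wave q.1 p.2 := by
  rw [phase, wave, wave, wave, wave, ← Complex.exp_add, ← Complex.exp_add, ← Complex.exp_add]
  congr 1
  simp only [inner_sub_left, inner_sub_right, inner_neg_right]
  push_cast
  ring

/-- The integral `∫ h(x, ξ) g(ξ) e^{2π i x·ξ} dξ`. -/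
def waveInt (h : E d × E d → ℂ) (g : E d → ℂ) (x : E d) : ℂ := ∫ ξ, h (x, ξ) * g ξ * wave x ξ

theorem integral_wave_fourier (g : 𝓢(E d, ℂ)) (y : E d) :
    ∫ ξ, (𝓕 g : 𝓢(E d, ℂ)) ξ * wave y ξ = g y := by
  have h : (𝓕⁻ (𝓕 g : 𝓢(E d, ℂ)) : 𝓢(E d, ℂ)) y = g y := by simp
  rw [← h, fourierInv_coe, Real.fourierInv_eq']
  congr 1
  funext ξ
  rw [smul_eq_mul, mul_comm, wave, real_inner_comm]
  congr 2
  push_cast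
  ring

theorem integral_conj_wave (f : 𝓢(E d, ℂ)) (η : E d) :
    ∫ x, f x * wave x (-η) = (𝓕 f : 𝓢(E d, ℂ)) η := by
  rw [fourier_coe, Real.fourier_eq']
  congr 1
  funext x
  rw [smul_eq_mul, mul_comm, wave, inner_neg_right]
  congr 2
  push_cast
  ring

/-- Continuous functions of `(x, ξ)` of polynomial growth in `ξ`. -/
def PolyLE (C : ℝ) (K : ℕ) (h : E d × E d → ℂ) : Prop :=
  Continuous h ∧ ∀ p, ‖h p‖ ≤ C * (1 + ‖p.2‖) ^ K

variable {C : ℝ} {K : ℕ} {h : E d × E d → ℂ} (g : 𝓢(E d, ℂ))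

theorem integrable_pow_mul_schwartz (K : ℕ) : Integrable fun ξ => (1 + ‖ξ‖) ^ K * ‖g ξ‖ := by
  refine Integrable.mono' (((g.integrable_pow_mul volume 0).add
    (g.integrable_pow_mul volume K)).const_mul (2 ^ (K - 1))) ?_ (Eventually.of_forall fun ξ => ?_)
  · have := g.continuous
    exact Continuous.aestronglyMeasurable (by fun_prop)
  · have := add_pow_le zero_le_one (norm_nonneg ξ) K
    rw [Real.norm_of_nonneg (by positivity)]
    simp only [Pi.add_apply]
    rw [one_pow] at this
    calc _ ≤ 2 ^ (K - 1) * (1 + ‖ξ‖ ^ K) * ‖g ξ‖ := by gcongr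
      _ = _ := by ring

theorem PolyLE.norm_integrand_le (hh : PolyLE C K h) (x ξ : E d) :
    ‖h (x, ξ) * g ξ * wave x ξ‖ ≤ C * ((1 + ‖ξ‖) ^ K * ‖g ξ‖) := by
  rw [norm_mul, norm_mul, norm_wave, mul_one, ← mul_assoc]
  exact mul_le_mul_of_nonneg_right (hh.2 (x, ξ)) (norm_nonneg _)

theorem PolyLE.continuous_integrand (hh : PolyLE C K h) :
    Continuous fun p : E d × E d => h p * g p.2 * wave p.1 p.2 :=
  (hh.1.mul (g.continuous.comp continuous_snd)).mul contDiff_wave.continuous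

theorem PolyLE.integrable (hh : PolyLE C K h) (x : E d) :
    Integrable fun ξ => h (x, ξ) * g ξ * wave x ξ :=
  ((integrable_pow_mul_schwartz g K).const_mul C).mono'
    ((hh.continuous_integrand g).comp (Continuous.prodMk_right x)).aestronglyMeasurable
    (Eventually.of_forall fun ξ => hh.norm_integrand_le g x ξ)

theorem PolyLE.continuous_waveInt (hh : PolyLE C K h) : Continuous (waveInt h g) :=
  continuous_of_dominated
    (fun x => ((hh.continuous_integrand g).comp (Continuous.prodMk_right x)).aestronglyMeasurable)
    (fun x => Eventually.of_forall fun ξ => hh.norm_integrand_le g x ξ)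
    ((integrable_pow_mul_schwartz g K).const_mul C)
    (Eventually.of_forall fun ξ => (hh.continuous_integrand g).comp (Continuous.prodMk_left ξ))

theorem PolyLE.norm_waveInt_le (hh : PolyLE C K h) (x : E d) :
    ‖waveInt h g x‖ ≤ ∫ ξ, C * ((1 + ‖ξ‖) ^ K * ‖g ξ‖) :=
  norm_integral_le_of_norm_le ((integrable_pow_mul_schwartz g K).const_mul C)
    (Eventually.of_forall fun ξ => hh.norm_integrand_le g x ξ)

/-- Continuity of the operators under bounded pointwise convergence of the symbols. -/
theorem tendsto_integral_waveInt {H : ℕ → E d × E d → ℂ} (hH : ∀ N, PolyLE C K (H N))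
    (hl : ∀ p, Tendsto (fun N => H N p) atTop (𝓝 (h p))) {u : E d → ℂ} (hu : Integrable u) :
    Tendsto (fun N => ∫ x, waveInt (H N) g x * u x) atTop (𝓝 (∫ x, waveInt h g x * u x)) := by
  refine tendsto_integral_of_dominated_convergence
    (fun x => (∫ ξ, C * ((1 + ‖ξ‖) ^ K * ‖g ξ‖)) * ‖u x‖)
    (fun N => ((hH N).continuous_waveInt g).aestronglyMeasurable.mul hu.aestronglyMeasurable)
    (hu.norm.const_mul _) (fun N => Eventually.of_forall fun x => ?_)
    (Eventually.of_forall fun x => Tendsto.mul_const _ ?_)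
  · rw [norm_mul]
    exact mul_le_mul_of_nonneg_right ((hH N).norm_waveInt_le g x) (norm_nonneg _)
  · exact tendsto_integral_of_dominated_convergence (fun ξ => C * ((1 + ‖ξ‖) ^ K * ‖g ξ‖))
      (fun N => ((hH N).integrable g x).aestronglyMeasurable)
      ((integrable_pow_mul_schwartz g K).const_mul C)
      (fun N => Eventually.of_forall fun ξ => (hH N).norm_integrand_le g x ξ)
      (Eventually.of_forall fun ξ => ((hl (x, ξ)).mul_const _).mul_const _)

/-- Integration by parts in the operators. -/
theorem coord_mul_waveInt (hh : PolyLE C K h) (hd : ContDiff ℝ ∞ h) (j : Fin (d + 1)) {C' : ℝ}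
    {K' : ℕ} (hh' : PolyLE C' K' (lie (xiField j) h)) (x : E d) :
    (x j : ℂ) * waveInt h g x = -(2 * Real.pi * Complex.I)⁻¹ *
      (waveInt (lie (xiField j) h) g x + waveInt h (∂_{(coordVec j : E d)} g : 𝓢(E d, ℂ)) x) := by
  have hne : (2 * Real.pi * Complex.I : ℂ) ≠ 0 := by simp [Real.pi_ne_zero]
  have hx : ContDiff ℝ ∞ fun ξ => h (x, ξ) := hd.comp (contDiff_prodMk_right x)
  have hg : ContDiff ℝ ∞ g := g.smooth ⊤
  have e1 : ∀ ξ, fderiv ℝ (fun ξ => h (x, ξ) * g ξ) ξ (coordVec j)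
      = lie (xiField j) h (x, ξ) * g ξ + h (x, ξ) * (∂_{(coordVec j : E d)} g : 𝓢(E d, ℂ)) ξ := by
    intro ξ
    have h1 := HasFDerivAt.comp (f := fun ξ : E d => (x, ξ)) ξ (hd.diff_top (x, ξ)).hasFDerivAt
      (hasFDerivAt_prodMk_right x ξ)
    have h2 : fderiv ℝ (fun ξ => h (x, ξ)) ξ = _ := h1.fderiv
    rw [fderiv_fun_mul (hx.diff_top ξ) (hg.diff_top ξ), h2, lineDerivOp_apply_eq_fderiv]
    simp [lie, xiField]
    ring
  have e2 : ∀ ξ, fderiv ℝ (wave x) ξ (coordVec j) = 2 * Real.pi * Complex.I * (x j : ℂ) * wave x ξ := by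
    intro ξ
    rw [fderiv_wave, real_inner_comm, coord_eq_inner]
  have i1 := hh.integrable g x
  have i2 := hh'.integrable g x
  have i3 := hh.integrable (∂_{(coordVec j : E d)} g : 𝓢(E d, ℂ)) x
  have h1 := integral_mul_fderiv_eq_neg_fderiv_mul_of_integrable (μ := volume)
    (f := fun ξ => h (x, ξ) * g ξ) (g := wave x) (v := coordVec j)
    (by simp only [e1, add_mul]; exact i2.add i3)
    (by
      simp only [e2]
      refine (i1.const_mul (2 * Real.pi * Complex.I * (x j : ℂ))).congr
        (Eventually.of_forall fun ξ => ?_)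
      simp only
      ring)
    i1 (fun ξ _ => (hx.mul hg).diff_top ξ) fun ξ _ => (contDiff_wave_right x).diff_top ξ
  simp only [e1, e2, add_mul] at h1
  rw [integral_add i2 i3] at h1
  have h2 : ∫ ξ, h (x, ξ) * g ξ * (2 * Real.pi * Complex.I * (x j : ℂ) * wave x ξ)
      = 2 * Real.pi * Complex.I * ((x j : ℂ) * waveInt h g x) := by
    rw [waveInt, ← integral_const_mul, ← integral_const_mul]
    congr 1
    funext ξ
    ring
  rw [h2] at h1
  rw [neg_mul, eq_neg_iff_add_eq_zero, ← mul_right_inj' hne, mul_add, h1, mul_inv_cancel_left₀ hne]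
  simp [waveInt]

end WaveIntegral

/-! ### The adjoint identity and square integrability. -/

section Adjoint

open Filter Topology LineDeriv

variable {d : ℕ}

theorem fubini_wave {c : E d × E d → ℂ} (hc : Continuous c) (hs : HasCompactSupport c)
    {u : E d → ℂ} (hu : Integrable u) {w : E d → E d × E d → ℂ}
    (hw : Continuous fun z : E d × E d × E d => w z.1 z.2) (hw1 : ∀ x q, ‖w x q‖ = 1) :
    ∫ x, ∫ q, u x * c q * w x q = ∫ q, ∫ x, u x * c q * w x q := by
  refine integral_integral_swap ?_
  exact (hu.mul_prod (hc.integrable_of_hasCompactSupport hs)).mul_bdd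
    hw.aestronglyMeasurable (c := 1) (Eventually.of_forall fun z => (hw1 z.1 z.2).le)

/-- The phase times e^{2πi x·ξ} equals e^{2πi(x-y)·η} e^{2πi y·ξ}, so the ξ-integral can be done
first and is Fourier inversion at y. -/
theorem waveInt_oscInt {c : E d × E d → ℂ} (hc : Continuous c) (hs : HasCompactSupport c)
    (g : 𝓢(E d, ℂ)) (x : E d) :
    waveInt (oscInt c) (𝓕 g : 𝓢(E d, ℂ)) x
      = ∫ q, c q * g q.1 * (wave x q.2 * wave q.1 (-q.2)) := by
  have h1 : ∀ ξ, oscInt c (x, ξ) * (𝓕 g : 𝓢(E d, ℂ)) ξ * wave x ξ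
      = ∫ q, (𝓕 g : 𝓢(E d, ℂ)) ξ * c q * (phase ((x, ξ), q) * wave x ξ) := fun ξ => by
    rw [oscInt, ← integral_mul_const, ← integral_mul_const]
    congr 1
    funext q
    ring
  have hw : Continuous fun z : E d × E d × E d => phase ((x, z.1), z.2) * wave x z.1 :=
    (contDiff_phase.continuous.comp
      ((continuous_const.prodMk continuous_fst).prodMk continuous_snd)).mul
      ((contDiff_wave_right x).continuous.comp continuous_fst)
  simp only [waveInt, h1]
  rw [fubini_wave hc hs (𝓕 g : 𝓢(E d, ℂ)).integrable (w := fun ξ q => phase ((x, ξ), q) * wave x ξ) hw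
    fun ξ q => by rw [norm_mul, norm_phase, norm_wave, mul_one]]
  congr 1
  funext q
  rw [← integral_wave_fourier g q.1, ← integral_const_mul, ← integral_mul_const]
  congr 1
  funext ξ
  rw [phase_mul_wave]
  ring

/-- The adjoint of an operator whose symbol has compact support. -/
theorem integral_waveInt_conj {c : E d × E d → ℂ} (hc : Continuous c) (hs : HasCompactSupport c)
    (f g : 𝓢(E d, ℂ)) :
    ∫ x, waveInt (fun p => conj (c p)) (𝓕 f : 𝓢(E d, ℂ)) x * conj (g x)
      = ∫ x, f x * conj (waveInt (oscInt c) (𝓕 g : 𝓢(E d, ℂ)) x) := by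
  have hc' : Continuous fun q : E d × E d => conj (c q) * conj (g q.1) * wave q.1 q.2 :=
    ((Complex.continuous_conj.comp hc).mul (Complex.continuous_conj.comp
      (g.continuous.comp continuous_fst))).mul contDiff_wave.continuous
  have hs' : HasCompactSupport fun q : E d × E d => conj (c q) * conj (g q.1) * wave q.1 q.2 :=
    ((hs.comp_left (map_zero conj)).mul_right).mul_right
  have h1 : ∀ x, f x * conj (waveInt (oscInt c) (𝓕 g : 𝓢(E d, ℂ)) x)
      = ∫ q, f x * (conj (c q) * conj (g q.1) * wave q.1 q.2) * wave x (-q.2) := fun x => by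
    rw [waveInt_oscInt hc hs, ← integral_conj, ← integral_const_mul]
    congr 1
    funext q
    simp only [map_mul, conj_wave, neg_neg]
    ring
  simp only [h1]
  rw [fubini_wave hc' hs' f.integrable (w := fun x q => wave x (-q.2))
    (contDiff_wave.continuous.comp (continuous_fst.prodMk continuous_snd.snd.neg))
    fun x q => norm_wave _ _]
  have h2 : ∀ q : E d × E d,
      ∫ x, f x * (conj (c q) * conj (g q.1) * wave q.1 q.2) * wave x (-q.2)
        = conj (c q) * conj (g q.1) * wave q.1 q.2 * (𝓕 f : 𝓢(E d, ℂ)) q.2 := fun q => by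
    rw [← integral_conj_wave, ← integral_const_mul]
    congr 1
    funext x
    ring
  simp only [h2]
  have h3 : Integrable (fun q : E d × E d =>
      conj (c q) * conj (g q.1) * wave q.1 q.2 * (𝓕 f : 𝓢(E d, ℂ)) q.2) (volume.prod volume) :=
    (hc'.mul ((𝓕 f : 𝓢(E d, ℂ)).continuous.comp continuous_snd)).integrable_of_hasCompactSupport
      hs'.mul_right
  refine Eq.trans ?_ (integral_prod _ h3).symm
  congr 1
  funext x
  rw [waveInt, ← integral_mul_const]
  congr 1
  funext ξ
  ring

namespace AdaptedFrame

variable {D : E d → Submodule ℝ (E d)} {F : AdaptedFrame D} {m n p : ℝ} {h : E d × E d → ℂ}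

theorem SymBounds.exists_polyLE (hh : F.SymBounds m n h) : ∃ C K, PolyLE C K h := by
  obtain ⟨C, hC⟩ := hh.xiBounds.2 [] 0
  obtain ⟨C', K, hC', hb⟩ := F.exists_symWt_le_pow m n
  refine ⟨|C| * C', K, hh.contDiff.continuous, fun p => ?_⟩
  have h1 := hC p.1 p.2
  simp only [xiList, List.foldr_nil, Function.iterate_zero, id, Nat.cast_zero, sub_zero,
    List.length_nil, Prod.mk.eta, mul_assoc] at h1
  calc ‖h p‖ ≤ C * F.symWt m n p.1 p.2 := h1
    _ ≤ |C| * (C' * (1 + ‖p.2‖) ^ K) :=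
      mul_le_mul (le_abs_self C) (hb _ _) (F.symWt_pos _ _ _ _).le (abs_nonneg C)
    _ = _ := by ring

/-- A factor x_j is traded for a ξ-derivative, which falls on the symbol (again a symbol, of order
(m, n-1)) or on g (again Schwartz). Hence the induction over all orders and all g. -/
theorem SymBounds.waveInt_decay (hh : F.SymBounds m n h) (M : ℕ) (g : 𝓢(E d, ℂ)) :
    ∃ C : ℝ, ∀ x, (1 + ‖x‖) ^ M * ‖waveInt h g x‖ ≤ C := by
  induction M generalizing m n h g with
  | zero =>
    obtain ⟨C, K, hp⟩ := hh.exists_polyLE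
    exact ⟨_, fun x => by simpa using hp.norm_waveInt_le g x⟩
  | succ M ih =>
    obtain ⟨C, K, hp⟩ := hh.exists_polyLE
    choose C' K' hp' using fun j => (hh.xi j).exists_polyLE
    obtain ⟨B, hB⟩ := ih hh g
    choose B₁ hB₁ using fun j => ih (hh.xi j) g
    choose B₂ hB₂ using fun j => ih hh (∂_{(coordVec j : E d)} g : 𝓢(E d, ℂ))
    set z : ℂ := -(2 * Real.pi * Complex.I)⁻¹
    refine ⟨B + ∑ j, ‖z‖ * (B₁ j + B₂ j), fun x => ?_⟩
    have h1 : ‖x‖ * ‖waveInt h g x‖ ≤ ∑ j, ‖z‖ * (‖waveInt (lie (xiField j) h) g x‖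
        + ‖waveInt h (∂_{(coordVec j : E d)} g : 𝓢(E d, ℂ)) x‖) := by
      refine (mul_le_mul_of_nonneg_right (norm_le_sum_abs x) (norm_nonneg _)).trans ?_
      rw [Finset.sum_mul]
      refine Finset.sum_le_sum fun j _ => ?_
      have := congrArg norm (coord_mul_waveInt g hp hh.contDiff j (hp' j) x)
      rw [norm_mul, Complex.norm_real, Real.norm_eq_abs, norm_mul] at this
      rw [this]
      exact mul_le_mul_of_nonneg_left (norm_add_le _ _) (norm_nonneg _)
    calc (1 + ‖x‖) ^ (M + 1) * ‖waveInt h g x‖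
        = (1 + ‖x‖) ^ M * ‖waveInt h g x‖ + (1 + ‖x‖) ^ M * (‖x‖ * ‖waveInt h g x‖) := by ring
      _ ≤ B + (1 + ‖x‖) ^ M * ∑ j, ‖z‖ * (‖waveInt (lie (xiField j) h) g x‖
          + ‖waveInt h (∂_{(coordVec j : E d)} g : 𝓢(E d, ℂ)) x‖) :=
        add_le_add (hB x) (mul_le_mul_of_nonneg_left h1 (by positivity))
      _ = B + ∑ j, ‖z‖ * ((1 + ‖x‖) ^ M * ‖waveInt (lie (xiField j) h) g x‖
          + (1 + ‖x‖) ^ M * ‖waveInt h (∂_{(coordVec j : E d)} g : 𝓢(E d, ℂ)) x‖) := by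
        rw [Finset.mul_sum]
        congr 1
        exact Finset.sum_congr rfl fun j _ => by ring
      _ ≤ _ := by
        gcongr with j _
        · exact hB₁ j x
        · exact hB₂ j x

theorem SymBounds.memLp_waveInt (hh : F.SymBounds m n h) (g : 𝓢(E d, ℂ)) :
    MemLp (waveInt h g) 2 volume := by
  obtain ⟨C, K, hp⟩ := hh.exists_polyLE
  -- The exponent d + 2 exceeds the dimension d + 1. In the square one factor is merely bounded and
  -- the other supplies all the decay.
  obtain ⟨B, hB⟩ := hh.waveInt_decay (d + 2) g
  have hc := hp.continuous_waveInt g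
  rw [memLp_two_iff_integrable_sq_norm hc.aestronglyMeasurable]
  have hB0 : 0 ≤ B := le_trans (by positivity) (hB 0)
  have hi : Integrable (fun x : E d => (1 + ‖x‖) ^ (-((d : ℝ) + 2))) volume :=
    integrable_one_add_norm (by simp)
  refine (hi.const_mul (B * B)).mono' (hc.norm.pow 2).aestronglyMeasurable
    (Eventually.of_forall fun x => ?_)
  have hx : 1 ≤ 1 + ‖x‖ := by linarith [norm_nonneg x]
  have hb := hB x
  have hb' : ‖waveInt h g x‖ ≤ B :=
    (le_mul_of_one_le_left (norm_nonneg _) (one_le_pow₀ hx)).trans hb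
  rw [Real.norm_of_nonneg (by positivity), Real.rpow_neg (by positivity),
    show (d : ℝ) + 2 = ((d + 2 : ℕ) : ℝ) by push_cast; ring, Real.rpow_natCast,
    ← div_eq_mul_inv, le_div_iff₀ (by positivity)]
  calc ‖waveInt h g x‖ ^ 2 * (1 + ‖x‖) ^ (d + 2)
      = ‖waveInt h g x‖ * ((1 + ‖x‖) ^ (d + 2) * ‖waveInt h g x‖) := by ring
    _ ≤ B * B := mul_le_mul hb' hb (by positivity) hB0

theorem exists_polyLE_ampInt {c : ℕ → E d × E d × E d → ℂ} (ht : Tame c) (hc : F.Amp m n p c) :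
    ∃ C K, ∀ N, PolyLE C K (ampInt (c N)) := by
  obtain ⟨C, hC, hb⟩ := exists_ampInt_le ht hc
  obtain ⟨C', K, hC', hb'⟩ := F.exists_symWt_le_pow m n
  refine ⟨C * C', K, fun N => ⟨?_, fun P => (hb N P).trans ?_⟩⟩
  · exact continuous_iff_continuousAt.mpr fun P =>
      (hasFDerivAt_ampInt (ht.testAmp N) P).1.continuousAt
  · rw [mul_assoc]
    exact mul_le_mul_of_nonneg_left (hb' _ _) hC

/-- The identity is exact for each cutoff. Both sides pass to the limit by dominated convergence:
the cut-off symbols are dominated by h, and the symbols of their adjoints have a polynomial bound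
uniform in the cutoff. -/
theorem SymBounds.integral_adjoint (hh : F.SymBounds m n h) (f g : 𝓢(E d, ℂ)) :
    ∫ x, waveInt h (𝓕 f : 𝓢(E d, ℂ)) x * conj (g x)
      = ∫ x, f x * conj (waveInt (limInt (cutoffAmp h)) (𝓕 g : 𝓢(E d, ℂ)) x) := by
  have ht := tame_cutoffAmp hh.contDiff
  have hc := amp_cutoffAmp hh
  obtain ⟨C, K, hp⟩ := hh.exists_polyLE
  obtain ⟨C', K', hp'⟩ := exists_polyLE_ampInt ht hc
  -- The cut-off amplitude does not depend on x, so 0 is an arbitrary choice for that slot.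
  have e1 : ∀ N (q : E d × E d), conj (cutoffAmp h N (0, q))
      = h q * ((bump (d := d) (scale N • q) : ℝ) : ℂ) := fun N q => by
    simp [cutoffAmp, scaled]
  have hl : ∀ q : E d × E d,
      Tendsto (fun N => conj (cutoffAmp h N (0, q))) atTop (𝓝 (h q)) := fun q => by
    refine tendsto_const_nhds.congr' ?_
    filter_upwards [scaled_bump_eventually ((0, q) : E d × E d × E d)] with N hN
    have := hN.eq_of_nhds
    simp only [scaled, pow_zero, one_mul] at this
    rw [e1, this, mul_one]
  have hb : ∀ N, PolyLE C K fun q => conj (cutoffAmp h N (0, q)) := fun N => by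
    refine ⟨Complex.continuous_conj.comp ((ht.testAmp N).slice 0).1.continuous, fun q => ?_⟩
    beta_reduce
    rw [e1, norm_mul, Complex.norm_real, Real.norm_of_nonneg (ContDiffBump.nonneg _)]
    exact (mul_le_of_le_one_right (norm_nonneg _) (ContDiffBump.le_one _)).trans (hp.2 q)
  have hg : Integrable fun x => conj (g x) :=
    Complex.conjCLE.toContinuousLinearMap.integrable_comp g.integrable
  have hf : Integrable fun x => conj (f x) :=
    Complex.conjCLE.toContinuousLinearMap.integrable_comp f.integrable
  have t1 := tendsto_integral_waveInt (𝓕 f : 𝓢(E d, ℂ)) hb hl hg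
  have t2 := (Complex.continuous_conj.tendsto _).comp
    (tendsto_integral_waveInt (𝓕 g : 𝓢(E d, ℂ)) hp' (tendsto_limInt ht hc) hf)
  have e2 : ∀ G : E d → ℂ, conj (∫ x, G x * conj (f x)) = ∫ x, f x * conj (G x) := fun G => by
    rw [← integral_conj]
    congr 1
    funext x
    simp [mul_comm]
  simp only [Function.comp_def, e2] at t2
  refine tendsto_nhds_unique t1 (t2.congr fun N => ?_)
  have e3 : ampInt (cutoffAmp h N) = oscInt fun q => cutoffAmp h N (0, q) := rfl
  rw [e3]
  exact (integral_waveInt_conj ((ht.testAmp N).slice 0).1.continuous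
    ((ht.testAmp N).slice 0).2 f g).symm

theorem exists_adjoint {a : E d → E d → ℂ} (ha : a ∈ F.symbolClass m n) :
    ∃ a' ∈ F.symbolClass m n, IsL2Adjoint (pseudoOp a) (pseudoOp a') := by
  have hh := mem_symbolClass_iff.mp ha
  have hb : F.SymBounds m n (limInt (cutoffAmp fun p => a p.1 p.2)) :=
    IsLimInt.symBounds ⟨_, 0, tame_cutoffAmp hh.contDiff, amp_cutoffAmp hh, rfl⟩
  refine ⟨fun x ξ => limInt (cutoffAmp fun p => a p.1 p.2) (x, ξ), mem_symbolClass_iff.mpr hb,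
    fun f => hh.memLp_waveInt (𝓕 f : 𝓢(E d, ℂ)), fun g => hb.memLp_waveInt (𝓕 g : 𝓢(E d, ℂ)),
    hh.integral_adjoint⟩

end AdaptedFrame

end Adjoint

end MixedSymbol

end

theorem mainTheorem2 (d : ℕ) (D : MixedSymbol.E d → Submodule ℝ (MixedSymbol.E d))
    (F : MixedSymbol.AdaptedFrame D) (m n : ℝ)
    (a : MixedSymbol.E d → MixedSymbol.E d → ℂ) (ha : a ∈ F.symbolClass m n) :
    ∃ a' ∈ F.symbolClass m n,
      MixedSymbol.IsL2Adjoint (MixedSymbol.pseudoOp a) (MixedSymbol.pseudoOp a') :=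
  MixedSymbol.AdaptedFrame.exists_adjoint ha
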